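/- **Model.** In round $t=1,\dots,T$ a covariate $x_t\in\mathbb R$ is drawn i.i.d. from a law $Q$ on a compact set $\mathcal X$. Knowing $x_t$ and $(x_s,p_s,y_s)_{s<t}$, a (possibly randomized) policy $\pi$ posts a price $p_t\in\mathcal P=[1/8,7/16]$. The seller then observes $y_t=\mathbf 1\{m(x_t)+\varepsilon_t\ge p_t\}$, where the $\varepsilon_t$ are i.i.d. with distribution function (CDF) $F$ and independent of the past and of $x_t$. Put $r(x,p)=p\,(1-F(p-m(x)))$ and $$\operatorname{Regret}(\pi,T)=\sum_{t=1}^T\Bigl(\max_{p\in\mathcal P}r(x_t,p)-r(x_t,p_t)\Bigr).$$ **Assumptions.** Let $\beta\ge2$, $q=\lfloor\beta\rfloor$, and $\phi_F(u)=u-\frac{1-F(u)}{F'(u)}$. * (A1) with constant $C$ on $S\subseteq\mathbb R$: $F\in C^q(S)$ and $|F^{(q)}(x)-F^{(q)}(y)|\le C|x-y|^{\beta-q}$ for $x,y\in S$. * (A2) with constant $c_\phi>0$ on $S$: $F'>0$, $\phi_F$ is differentiable and $\phi_F'\ge c_\phi$ at every point of $S$. * (A3) for $\hat m$ with constants $0<c_d\le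 C_d$ (boundary exponent $\kappa=0$): $\hat m(\mathcal X)$ is a nondegenerate interval, and $\hat m(x)$, $x\sim Q$, has a density with values in $[c_d,C_d]$ on it. * (A4) for $(\hat m,m)$ with constant $L$: with $\Delta=\hat m-m$, the function $t\mapsto\mathbb E[\Delta(x)/\|\Delta\|_\infty\mid\hat m(x)=t]$ has an $L$-Lipschitz version on $\hat m(\mathcal X)$ (the quotient is $0$ if $\Delta=0$ on $\mathcal X$). **First class.** $Q=\mathrm{Unif}[0,1/4]$, $\mathcal X=[0,1/4]$, $m_\theta(x)=\theta x$ with $\theta\ne0$, and $F_{a,b}(u)=\min\{1,\max\{0,au+b\}\}$ with $a>0$, $b\in\mathbb R$. For $\eta>0$ let $\mathfrak C_1(\eta)$ be the subclass with $|a-1|\le\eta$, $|b-\frac12|\le\eta$, $|\theta-1|\le\eta$. **Second class.** $Q=\mathrm{Unif}[-1/4,1/4]$, $\mathcal X=[-1/4,1/4]$, and $m(x)=x$. A *baseline* is a CDF $F_0$ with $F_0(u)=u+\frac12$ on $[-1/4,1/4]$ that satisfies (A1) and (A2) on $\mathbb R$ with some constants. Let $V\not\equiv0$ be a $C^\infty$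 function vanishing outside $[-1/4,1/4]$. For an integer $N\ge1$ put $h=1/N$, and let $\mu_1,\dots,\mu_N$ be the midpoints of the $N$ intervals of equal length that divide $[-1/4,1/4]$. For $\rho>0$ and $\iota\in\{0,1\}^N$ let $$F_\iota(u)=F_0(u)+\sum_{j=1}^N\iota_j\,\rho\,h^\beta\,V\!\left(\frac{u-\mu_j}{h}\right),\qquad u\in\mathbb R .$$ Let $\mathfrak C_2(N)$ be the class of all these instances with $F=F_\iota$, $\iota\in\{0,1\}^N$. **Theorem.** Let $\beta\ge2$. 1. There are constants $C$ and $c_\phi>0$ such that for all $a>0$, $b\in\mathbb R$ the function $F_{a,b}$ is a CDF and satisfies (A1) and (A2) with these constants on $\{u:0<au+b<1\}$. If $0<\eta\le1/32$, this set contains $p-\theta x$ for all $p\in\mathcal P$, $x\in[0,1/4]$, whenever $|a-1|,|b-\frac12|,|\theta-1|\le\eta$. 2. For every $R\ge1$ there are $0<c_d\le C_d$ and $L\ge0$ such that, for both covariate laws, every $\hat m(x)=\hat\theta x$ with $R^{-1}\le|\hat\theta|\le R$ satisfies (A3) with constants $c_d,C_d$. With constant $L$ such an $\hat m$ also satisfies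 (A4) against every $m_\theta$, $\theta\neq0$, for $\mathrm{Unif}[0,1/4]$, and against $m(x)=x$ for $\mathrm{Unif}[-1/4,1/4]$. 3. A baseline exists. For all $V$ and $F_0$ as above there are $\rho_0>0$, $C$ and $c_\phi>0$ such that for every $\rho\in(0,\rho_0]$, all $N\ge1$ and all $\iota\in\{0,1\}^N$, the function $F_\iota$ is a CDF and satisfies (A1) and (A2) on $\mathbb R$ with constants $C,c_\phi$. 4. For all $V$, $F_0$ as above, all $\rho\in(0,\rho_0]$ (with $\rho_0$ from 3) and all $\eta\in(0,1/32]$ there is $\tilde c>0$ such that for every $T\ge1$, with $N=\lceil T^{1/(2\beta+1)}\rceil$, every policy $\pi$ satisfies $$\max_{(m,F)\in\mathfrak C_1(\eta)\cup\mathfrak C_2(N)}\mathbb E\bigl[\operatorname{Regret}(\pi,T)\bigr]\ \ge\ \tilde c\,T^{\max\{\frac3{2\beta+1},\frac12\}},$$ in the sense that some instance of the union has expected regret at least the right-hand side. -/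

import Mathlib

open MeasureTheory ProbabilityTheory Set
open scoped NNReal ENNReal ContDiff

noncomputable section

namespace Pricing

/-! ### Analytic conditions on a noise distribution function -/

/-- `F` is the distribution function of a probability measure on the line. -/
def IsCDF (F : ℝ → ℝ) : Prop :=
  ∃ ν : Measure ℝ, IsProbabilityMeasure ν ∧ ∀ u, cdf ν u = F u

/-- `F` is `β`-smooth on `S` with constant `C`: with `q = ⌊β⌋`, `F` is `q` times continuously
differentiable on `S` and `F^(q)` is Hölder continuous of exponent `β - q` on `S`. -/
def BetaSmoothOn (β C : ℝ) (F : ℝ → ℝ) (S : Set ℝ) : Prop :=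
  ContDiffOn ℝ ⌊β⌋₊ F S ∧
    ∀ x ∈ S, ∀ y ∈ S,
      |iteratedDerivWithin ⌊β⌋₊ F S x - iteratedDerivWithin ⌊β⌋₊ F S y|
        ≤ C * |x - y| ^ (β - (⌊β⌋₊ : ℝ))

/-- The transform `φ(u) = u - (1 - F(u)) / F'(u)`. -/
def phi (F : ℝ → ℝ) (u : ℝ) : ℝ := u - (1 - F u) / deriv F u

/-- On `S` the transform `φ` is well defined (`F' > 0`), differentiable, and `φ' ≥ c`. -/
def TransformIncreasingOn (c : ℝ) (F : ℝ → ℝ) (S : Set ℝ) : Prop :=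
  ∀ u ∈ S, 0 < deriv F u ∧ DifferentiableAt ℝ (phi F) u ∧ c ≤ deriv (phi F) u

/-! ### Conditions on the covariate distribution -/

/-- The uniform distribution on `[lo, hi]`. -/
def unif (lo hi : ℝ) : Measure ℝ := ProbabilityTheory.cond volume (Icc lo hi)

/-- The boundary profile `δ(z) = min {(z - lo)^κ, (hi - z)^κ}`. -/
def boundaryProfile (κ lo hi z : ℝ) : ℝ := min ((z - lo) ^ κ) ((hi - z) ^ κ)

/-- Feature diversity of `mhat` when the covariate has law `μ` on `X`: the range of `mhat` is a
nondegenerate interval, and the law of `mhat` has a density that lies between `cd * δ` and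
`Cd * δ` on that interval. -/
def FeatureDiverse (μ : Measure ℝ) (X : Set ℝ) (mhat : ℝ → ℝ) (κ cd Cd : ℝ) : Prop :=
  ∃ lo hi : ℝ, lo < hi ∧ mhat '' X = Icc lo hi ∧
    ∃ dens : ℝ → ℝ, Measurable dens ∧
      μ.map mhat = volume.withDensity (fun z => ENNReal.ofReal (dens z)) ∧
      ∀ z ∈ Icc lo hi,
        cd * boundaryProfile κ lo hi z ≤ dens z ∧ dens z ≤ Cd * boundaryProfile κ lo hi z

/-- The supremum norm of `D` on `X`. -/
def supNormOn (X : Set ℝ) (D : ℝ → ℝ) : ℝ := sSup ((fun x => |D x|) '' X)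

/-- Conditional mean regularity: with `Δ = mhat - m`, the function
`t ↦ E[Δ(x) / ‖Δ‖_∞ | mhat(x) = t]` has a version that is `L`-Lipschitz on the range of `mhat`
(for `mhat = m` on `X` the quotient is read as `0`). -/
def ConditionalMeanRegular (μ : Measure ℝ) (X : Set ℝ) (mhat m : ℝ → ℝ) (L : ℝ≥0) : Prop :=
  ∃ g : ℝ → ℝ, LipschitzOnWith L g (mhat '' X) ∧
    μ[fun x => (mhat x - m x) / supNormOn X (fun x => mhat x - m x) |
        MeasurableSpace.comap mhat inferInstance] =ᵐ[μ] fun x => g (mhat x)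

/-! ### The pricing model with one-dimensional covariates -/

/-- The interval of admissible prices. -/
def prices : Set ℝ := Icc (1 / 8) (7 / 16)

/-- A market: the covariates are i.i.d. with law `ctx` on the compact set `dom`, the noise
variables are i.i.d. with law `noise`, and `util` is the mean utility. -/
structure Market where
  ctx : Measure ℝ
  dom : Set ℝ
  noise : Measure ℝ
  util : ℝ → ℝ
  ctx_prob : IsProbabilityMeasure ctx
  dom_compact : IsCompact dom
  ctx_dom : ctx domᶜ = 0
  noise_prob : IsProbabilityMeasure noise
  util_meas : Measurable util

/-- The distribution function `F` of the noise. -/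
def Market.F (I : Market) : ℝ → ℝ := fun u => cdf I.noise u

/-- What the seller sees in one round: `((x, p), y)`, that is the covariate, the posted price, and
whether a purchase occurred. -/
abbrev Obs : Type := (ℝ × ℝ) × Bool

/-- The data of the first `t` rounds. -/
abbrev Hist (t : ℕ) : Type := Fin t → Obs

/-- A (possibly randomized) nonanticipating pricing policy: given the data of the first `t` rounds
and the current covariate, the next price is drawn from `price t`, a distribution on `prices`. -/
structure Policy where
  price : (t : ℕ) → Kernel (Hist t × ℝ) ℝ
  price_markov : ∀ t, IsMarkovKernel (price t)
  price_mem : ∀ t z, price t z pricesᶜ = 0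

/-- Given covariate and price `(x, p)`, the law of `y = 1{m(x) + ε ≥ p}`, with `ε` a fresh noise
variable. -/
def Market.purchase (I : Market) : Kernel (ℝ × ℝ) Bool :=
  (Kernel.id ×ₖ Kernel.const (ℝ × ℝ) I.noise).map
    (fun q => decide (q.1.2 ≤ I.util q.1.1 + q.2))

/-- One round: draw the covariate, let the policy post a price, observe the purchase decision. -/
def Market.step (I : Market) (π : Policy) (t : ℕ) : Kernel (Hist t) Obs :=
  (Kernel.const (Hist t) I.ctx ⊗ₖ π.price t) ⊗ₖ Kernel.prodMkLeft (Hist t) I.purchase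

/-- The law of the data of the first `t` rounds under the policy `π`. -/
def Market.law (I : Market) (π : Policy) : (t : ℕ) → Measure (Hist t)
  | 0 => Measure.dirac Fin.elim0
  | t + 1 => (I.law π t ⊗ₘ I.step π t).map (fun q => Fin.snoc (α := fun _ => Obs) q.1 q.2)

/-- The expected revenue `r(x, p) = p (1 - F(p - m(x)))`. -/
def Market.revenue (I : Market) (x p : ℝ) : ℝ := p * (1 - I.F (p - I.util x))

/-- The clairvoyant revenue `r(x, p*) = sup_{p ∈ prices} r(x, p)`. -/
def Market.optRevenue (I : Market) (x : ℝ) : ℝ := sSup (I.revenue x '' prices)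

/-- The expected regret `E[∑_{t ≤ T} (r(x_t, p_t*) - r(x_t, p_t))]`. -/
def Market.expectedRegret (I : Market) (π : Policy) (T : ℕ) : ℝ :=
  ∫ d, ∑ t : Fin T, (I.optRevenue (d t).1.1 - I.revenue (d t).1.1 (d t).1.2) ∂(I.law π T)

/-- The markets with covariates uniform on `[lo, hi]`, mean utility in `M`, and noise distribution
function in `Fs`. -/
def marketsOver (lo hi : ℝ) (M Fs : Set (ℝ → ℝ)) : Set Market :=
  {I | I.ctx = unif lo hi ∧ I.dom = Icc lo hi ∧ I.util ∈ M ∧ I.F ∈ Fs}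

/-! ### The first class: clipped linear distribution functions -/

/-- `F_{a,b}(u)`: the number `a * u + b` clipped to `[0, 1]`. -/
def clippedLinear (a b : ℝ) : ℝ → ℝ := fun u => max 0 (min 1 (a * u + b))

/-- The open interval on which the clipping in `F_{a,b}` is not active. -/
def linearRegion (a b : ℝ) : Set ℝ := {u | 0 < a * u + b ∧ a * u + b < 1}

/-- The functions `F_{a,b}` with `a > 0` and `(a, b) ∈ A`. -/
def clippedLinearCDFs (A : Set (ℝ × ℝ)) : Set (ℝ → ℝ) :=
  {F | ∃ a b : ℝ, (a, b) ∈ A ∧ 0 < a ∧ F = clippedLinear a b}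

/-- The nonzero linear utilities `x ↦ θ * x` with `θ ∈ Θ`. -/
def linearUtilities (Θ : Set ℝ) : Set (ℝ → ℝ) :=
  {m | ∃ θ ∈ Θ, θ ≠ 0 ∧ m = fun x => θ * x}

/-- The first hard class, with all parameters within `η` of `a = 1`, `b = 1/2`, `θ = 1`. -/
def classOne (η : ℝ) : Set Market :=
  marketsOver 0 (1 / 4) (linearUtilities (Icc (1 - η) (1 + η)))
    (clippedLinearCDFs (Icc (1 - η) (1 + η) ×ˢ Icc (1 / 2 - η) (1 / 2 + η)))

/-! ### The second class: a baseline with localized bumps -/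

/-- A baseline: a distribution function that equals `u + 1/2` on `[-1/4, 1/4]`, and that is
`β`-smooth on `ℝ` with `φ'` bounded below by a positive constant on `ℝ`. -/
structure IsBaseline (β : ℝ) (F₀ : ℝ → ℝ) : Prop where
  isCDF : IsCDF F₀
  eq_on : ∀ u ∈ Icc (-(1 / 4) : ℝ) (1 / 4), F₀ u = u + 1 / 2
  smooth : ∃ C, BetaSmoothOn β C F₀ univ
  incr : ∃ c > 0, TransformIncreasingOn c F₀ univ

/-- A bump: a nonzero `C^∞` function with support in `[-1/4, 1/4]`, so that for `h = 1/N` the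
function `u ↦ V((u - μ_j) / h)` lives on the cell `I_j`, whose half-width is `h / 4`. -/
structure IsBump (V : ℝ → ℝ) : Prop where
  smooth : ContDiff ℝ ∞ V
  support : Function.support V ⊆ Icc (-(1 / 4)) (1 / 4)
  ne_zero : ∃ u, V u ≠ 0

/-- The midpoint of the `j`-th of the `N` cells of equal length of `[-1/4, 1/4]`. -/
def cellMid (N : ℕ) (j : Fin N) : ℝ := -(1 / 4) + ((j : ℝ) + 1 / 2) / (2 * N)

/-- `F_ι(u) = F₀(u) + ∑_j ι_j ρ h^β V((u - μ_j) / h)` with `h = 1/N`. -/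
def bumpCDF (β ρ : ℝ) (V F₀ : ℝ → ℝ) (N : ℕ) (ι : Fin N → Bool) : ℝ → ℝ := fun u =>
  F₀ u + ∑ j : Fin N, (if ι j then 1 else 0) * ρ * (1 / (N : ℝ)) ^ β *
    V ((u - cellMid N j) / (1 / (N : ℝ)))

/-- The second hard class with `N` cells: `m(x) = x` and `F = F_ι` for some `ι ∈ {0,1}^N`. -/
def classTwo (β ρ : ℝ) (V F₀ : ℝ → ℝ) (N : ℕ) : Set Market :=
  marketsOver (-(1 / 4)) (1 / 4) {fun x => x} (range (bumpCDF β ρ V F₀ N))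

/-- The number of cells `⌈T^{1/(2β+1)}⌉` used at horizon `T`. -/
def cellCount (β : ℝ) (T : ℕ) : ℕ := ⌈(T : ℝ) ^ (1 / (2 * β + 1))⌉₊

end Pricing

end

/-! The rate is the larger of two separate lower bounds, and both rest on one two-point inequality.
Under a fixed policy, the data laws of two markets with the same covariate law have densities with
respect to a common reference measure (counting measure for the responses), and these densities
involve only the purchase probabilities. The Hellinger affinity of the two laws starts at 1 and
drops in each round by at most half the sum of the expected one-round Hellinger distances under the
two markets (`affinity_le_succ`). Hence, if no price has small loss in both markets, the two
expected losses add up to a fixed fraction of the separation unless the accumulated information is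
large (`two_point`). The one-round distance is at most 16 times the squared difference of the
demands (`hell_le`).

Order `√T` (`classOne_lower`). Two linear demand models cross exactly at the optimal price of the
first one, so information is paid for by loss: one round reveals at most a multiple of `δ²` times
its loss, up to a term of order `δ⁴`. With `δ` of order `T^(-1/4)` the two models cannot be told
apart cheaply, and their optimal prices differ by order `δ`.

Order `T^(3/(2β+1))` (`classTwo_lower`). Switching on the bump in one cell changes demand by order
`h^β`, but changes the density, and with it the optimal price, by order `h^(β-1)`. The loss is
quadratic around the optimum (`quadratic_loss`), so not knowing the bits costs order `h^(2β-2)` per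
round. An observation depends on `p - x`, which lies in at most one cell, so the `N` cells share a
total information of order `T h^(2β)`, whatever the policy does. For `N` of order `T^(1/(2β+1))`
this is a small constant per cell, and averaging over the hypercube (`exists_large_of_two_point`)
gives regret of order `T h^(2β-2)`, which is the stated power.

The baseline has density 1 on `[-1/4, 1/4]` and log-concave tails; log-concavity makes `1 -
(1-F)/F'` type corrections to `φ` harmless and gives `φ' ≥ 1`. Bumps with derivatives at most `1/64`
up to order 2 leave this structure intact. For linear utilities the normalized error is a linear
function of the estimate itself, which settles the conditions on covariates. -/

noncomputable section

set_option linter.unusedSectionVars false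

namespace Pricing

section

/-! ### Laws of the data under a general response kernel -/

/-- The joint law of covariate and price in round `t`, given the past. -/
def roundKernel (ctx : Measure ℝ) (π : Policy) (t : ℕ) : Kernel (Hist t) (ℝ × ℝ) :=
  Kernel.const (Hist t) ctx ⊗ₖ π.price t

/-- The law of the data of the first `t` rounds when responses are generated by the kernel `K`. -/
def lawWith (ctx : Measure ℝ) (π : Policy) (K : Kernel (ℝ × ℝ) Bool) : (t : ℕ) → Measure (Hist t)
  | 0 => Measure.dirac Fin.elim0
  | t + 1 => (lawWith ctx π K t ⊗ₘ (roundKernel ctx π t ⊗ₖ Kernel.prodMkLeft (Hist t) K)).map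
      (fun q => Fin.snoc (α := fun _ => Obs) q.1 q.2)

lemma Market.law_eq_lawWith (I : Market) (π : Policy) (t : ℕ) :
    I.law π t = lawWith I.ctx π I.purchase t := by
  induction t with
  | zero => rfl
  | succ t ih => simp only [Market.law, lawWith, ih]; rfl

lemma measurable_snoc (t : ℕ) :
    Measurable (fun q : Hist t × Obs => (Fin.snoc (α := fun _ => Obs) q.1 q.2 : Hist (t + 1))) := by
  rw [measurable_pi_iff]
  intro i
  refine Fin.lastCases ?_ (fun j => ?_) i
  · simpa using measurable_snd
  · simp only [Fin.snoc_castSucc]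
    exact (measurable_pi_apply j).comp measurable_fst

attribute [instance] Policy.price_markov Market.ctx_prob Market.noise_prob

instance roundKernel_markov (ctx : Measure ℝ) [IsProbabilityMeasure ctx] (π : Policy) (t : ℕ) :
    IsMarkovKernel (roundKernel ctx π t) := by
  unfold roundKernel; infer_instance

variable (ctx : Measure ℝ) [IsProbabilityMeasure ctx] (π : Policy)

instance lawWith_finite (K : Kernel (ℝ × ℝ) Bool) [IsFiniteKernel K] (t : ℕ) :
    IsFiniteMeasure (lawWith ctx π K t) := by
  induction t with
  | zero => unfold lawWith; infer_instance
  | succ t ih => unfold lawWith; infer_instance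

instance lawWith_prob (K : Kernel (ℝ × ℝ) Bool) [IsMarkovKernel K] (t : ℕ) :
    IsProbabilityMeasure (lawWith ctx π K t) := by
  induction t with
  | zero => unfold lawWith; infer_instance
  | succ t ih =>
    unfold lawWith
    exact Measure.isProbabilityMeasure_map (measurable_snoc t).aemeasurable

lemma lintegral_lawWith_succ (K : Kernel (ℝ × ℝ) Bool) [IsFiniteKernel K] (t : ℕ)
    {f : Hist (t + 1) → ℝ≥0∞} (hf : Measurable f) :
    ∫⁻ d, f d ∂lawWith ctx π K (t + 1) =
      ∫⁻ h, ∫⁻ z, ∫⁻ y, f (Fin.snoc (α := fun _ => Obs) h (z, y)) ∂K z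
        ∂roundKernel ctx π t h ∂lawWith ctx π K t := by
  have hm : Measurable (fun q : Hist t × Obs =>
      f (Fin.snoc (α := fun _ => Obs) q.1 q.2)) := hf.comp (measurable_snoc t)
  rw [lawWith, lintegral_map hf (measurable_snoc t), Measure.lintegral_compProd hm]
  refine lintegral_congr fun h => ?_
  exact Kernel.lintegral_compProd (roundKernel ctx π t) (Kernel.prodMkLeft (Hist t) K) h
    (hm.comp measurable_prodMk_left)

/-- The law of covariate and price in round `t`. -/
def roundLaw (K : Kernel (ℝ × ℝ) Bool) (t : ℕ) : Measure (ℝ × ℝ) :=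
  (lawWith ctx π K t).bind (roundKernel ctx π t)

instance roundLaw_prob (K : Kernel (ℝ × ℝ) Bool) [IsMarkovKernel K] (t : ℕ) :
    IsProbabilityMeasure (roundLaw ctx π K t) := by
  unfold roundLaw; infer_instance

lemma lintegral_roundLaw (K : Kernel (ℝ × ℝ) Bool) (t : ℕ)
    {f : ℝ × ℝ → ℝ≥0∞} (hf : Measurable f) :
    ∫⁻ z, f z ∂roundLaw ctx π K t =
      ∫⁻ h, ∫⁻ z, f z ∂roundKernel ctx π t h ∂lawWith ctx π K t := by
  rw [roundLaw, Measure.lintegral_bind (roundKernel ctx π t).measurable.aemeasurable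
    hf.aemeasurable]

lemma lintegral_roundKernel (t : ℕ) (h : Hist t) {f : ℝ × ℝ → ℝ≥0∞} (hf : Measurable f) :
    ∫⁻ z, f z ∂roundKernel ctx π t h = ∫⁻ x, ∫⁻ p, f (x, p) ∂π.price t (h, x) ∂ctx := by
  rw [roundKernel, Kernel.lintegral_compProd _ _ _ hf, Kernel.const_apply]

lemma measurableSet_prices : MeasurableSet prices := measurableSet_Icc

lemma lintegral_roundLaw_mono (K : Kernel (ℝ × ℝ) Bool) (t : ℕ) {X : Set ℝ} (hX : ctx Xᶜ = 0)
    {f g : ℝ × ℝ → ℝ≥0∞} (hf : Measurable f) (hg : Measurable g)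
    (h : ∀ x ∈ X, ∀ p ∈ prices, f (x, p) ≤ g (x, p)) :
    ∫⁻ z, f z ∂roundLaw ctx π K t ≤ ∫⁻ z, g z ∂roundLaw ctx π K t := by
  rw [lintegral_roundLaw ctx π K t hf, lintegral_roundLaw ctx π K t hg]
  refine lintegral_mono fun hh => ?_
  rw [lintegral_roundKernel ctx π t hh hf, lintegral_roundKernel ctx π t hh hg]
  refine lintegral_mono_ae ?_
  have h1 : ∀ᵐ x ∂ctx, x ∈ X := by rw [ae_iff]; exact hX
  filter_upwards [h1] with x hx
  refine lintegral_mono_ae ?_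
  have h2 : ∀ᵐ p ∂π.price t (hh, x), p ∈ prices := by rw [ae_iff]; exact π.price_mem t (hh, x)
  filter_upwards [h2] with p hp using h x hx p hp

lemma ae_roundLaw (K : Kernel (ℝ × ℝ) Bool) [IsFiniteKernel K] (t : ℕ) {X : Set ℝ}
    (hXm : MeasurableSet X) (hX : ctx Xᶜ = 0) :
    ∀ᵐ z ∂roundLaw ctx π K t, z.1 ∈ X ∧ z.2 ∈ prices := by
  rw [ae_iff]
  have hs : MeasurableSet (X ×ˢ prices)ᶜ := (hXm.prod measurableSet_prices).compl
  have e : {z : ℝ × ℝ | ¬ (z.1 ∈ X ∧ z.2 ∈ prices)} = (X ×ˢ prices)ᶜ := by ext; simp [mem_prod]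
  rw [e, ← nonpos_iff_eq_zero, ← lintegral_indicator_one hs]
  calc _ ≤ ∫⁻ z, 0 ∂roundLaw ctx π K t := by
        refine lintegral_roundLaw_mono ctx π K t hX (measurable_one.indicator hs)
          measurable_const ?_
        intro x hx p hp
        simp [hx, hp]
    _ = 0 := by simp

/-! ### Densities with respect to the counting response -/

/-- The reference law of the data, with counting measure for the responses. -/
abbrev refLaw (t : ℕ) : Measure (Hist t) := lawWith ctx π (Kernel.const _ Measure.count) t

/-- The product of `q` over the observed rounds. -/
def weight (q : Obs → ℝ≥0∞) (t : ℕ) (h : Hist t) : ℝ≥0∞ := ∏ s, q (h s)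

lemma measurable_weight {q : Obs → ℝ≥0∞} (hq : Measurable q) (t : ℕ) : Measurable (weight q t) := by
  unfold weight
  exact Finset.measurable_prod _ fun i _ => hq.comp (measurable_pi_apply i)

lemma weight_snoc (q : Obs → ℝ≥0∞) (t : ℕ) (h : Hist t) (o : Obs) :
    weight q (t + 1) (Fin.snoc (α := fun _ => Obs) h o) = weight q t h * q o := by
  simp [weight, Fin.prod_univ_castSucc]

lemma lintegral_refLaw_succ (t : ℕ) {f : Hist (t + 1) → ℝ≥0∞} (hf : Measurable f) :
    ∫⁻ d, f d ∂refLaw ctx π (t + 1) =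
      ∫⁻ h, ∫⁻ z, (f (Fin.snoc (α := fun _ => Obs) h (z, true))
        + f (Fin.snoc (α := fun _ => Obs) h (z, false)))
        ∂roundKernel ctx π t h ∂refLaw ctx π t := by
  rw [lintegral_lawWith_succ ctx π _ t hf]
  simp [lintegral_count, tsum_fintype]

/-- Covariates and prices are drawn by the same kernels under both laws, so the density is the
product of the response probabilities alone. This puts the laws for different markets over one
measure. -/
lemma lintegral_lawWith_eq_refLaw (K : Kernel (ℝ × ℝ) Bool) [IsFiniteKernel K]
    {q : Obs → ℝ≥0∞} (hq : Measurable q)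
    (hK : ∀ z, ∀ f : Bool → ℝ≥0∞,
      ∫⁻ y, f y ∂K z = f true * q (z, true) + f false * q (z, false))
    (t : ℕ) : ∀ {f : Hist t → ℝ≥0∞}, Measurable f →
    ∫⁻ d, f d ∂lawWith ctx π K t = ∫⁻ d, f d * weight q t d ∂refLaw ctx π t := by
  induction t with
  | zero =>
    intro f hf
    simp only [lawWith, weight]
    simp
  | succ t ih =>
    intro f hf
    rw [lintegral_lawWith_succ ctx π K t hf,
      lintegral_refLaw_succ ctx π t (f := fun d => f d * weight q (t + 1) d)
        (hf.mul (measurable_weight hq _))]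
    simp only [hK, weight_snoc]
    have hs := measurable_snoc t
    have m1 : ∀ b : Bool, Measurable (fun a : Hist t × (ℝ × ℝ) =>
        f (Fin.snoc (α := fun _ => Obs) a.1 (a.2, b)) * q (a.2, b)) := by
      intro b
      have : Measurable (fun a : Hist t × (ℝ × ℝ) => (a.1, ((a.2, b) : Obs))) := by fun_prop
      exact (hf.comp (hs.comp this)).mul (hq.comp (by fun_prop))
    have hM : Measurable (fun h : Hist t => ∫⁻ z,
        (f (Fin.snoc (α := fun _ => Obs) h (z, true)) * q (z, true)
          + f (Fin.snoc (α := fun _ => Obs) h (z, false)) * q (z, false))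
          ∂roundKernel ctx π t h) :=
      Measurable.lintegral_kernel_prod_right ((m1 true).add (m1 false))
    rw [ih hM]
    refine lintegral_congr fun h => ?_
    rw [← lintegral_mul_const]
    · refine lintegral_congr fun z => ?_
      ring
    · exact ((m1 true).add (m1 false)).comp measurable_prodMk_left

/-! ### Bernoulli responses and their Hellinger affinity -/

/-- The probability of the response in `o` when purchases have probability `D`. -/
def bern (D : ℝ × ℝ → ℝ) (o : Obs) : ℝ := if o.2 then D o.1 else 1 - D o.1

lemma measurable_bern {D : ℝ × ℝ → ℝ} (hD : Measurable D) : Measurable (bern D) := by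
  unfold bern
  refine Measurable.ite ?_ (hD.comp measurable_fst) (measurable_const.sub (hD.comp measurable_fst))
  exact measurable_snd (measurableSet_singleton true)

lemma bern_nonneg {D : ℝ × ℝ → ℝ} (hD : ∀ z, D z ∈ Icc (0 : ℝ) 1) (o : Obs) : 0 ≤ bern D o := by
  unfold bern
  split_ifs
  · exact (hD _).1
  · linarith [(hD o.1).2]

/-- The squared Hellinger distance (up to a factor) of the Bernoulli laws with parameters
`D₀ z` and `D₁ z`. -/
def hell (D₀ D₁ : ℝ × ℝ → ℝ) (z : ℝ × ℝ) : ℝ :=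
  1 - √(D₀ z * D₁ z) - √((1 - D₀ z) * (1 - D₁ z))

lemma sqrt_mul_le_half {a b : ℝ} (ha : 0 ≤ a) (hb : 0 ≤ b) : √(a * b) ≤ (a + b) / 2 := by
  rw [show (a + b) / 2 = √(((a + b) / 2) ^ 2) from (Real.sqrt_sq (by positivity)).symm]
  exact Real.sqrt_le_sqrt (by nlinarith [sq_nonneg (a - b)])

lemma hell_nonneg {D₀ D₁ : ℝ × ℝ → ℝ} (h₀ : ∀ z, D₀ z ∈ Icc (0 : ℝ) 1)
    (h₁ : ∀ z, D₁ z ∈ Icc (0 : ℝ) 1) (z : ℝ × ℝ) : 0 ≤ hell D₀ D₁ z := by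
  have a := sqrt_mul_le_half (h₀ z).1 (h₁ z).1
  have b := sqrt_mul_le_half (sub_nonneg.2 (h₀ z).2) (sub_nonneg.2 (h₁ z).2)
  unfold hell; linarith

lemma hell_le_one (D₀ D₁ : ℝ × ℝ → ℝ) (z : ℝ × ℝ) : hell D₀ D₁ z ≤ 1 := by
  unfold hell
  linarith [Real.sqrt_nonneg (D₀ z * D₁ z), Real.sqrt_nonneg ((1 - D₀ z) * (1 - D₁ z))]

lemma measurable_hell {D₀ D₁ : ℝ × ℝ → ℝ} (h₀ : Measurable D₀) (h₁ : Measurable D₁) :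
    Measurable (hell D₀ D₁) := by
  unfold hell; fun_prop

/-- The left side is `(√a - √b)² / 2`, and `a - b = (√a - √b)(√a + √b)` with `√a + √b ≥ 1/4`. -/
lemma sub_sqrt_mul_le {a b : ℝ} (ha : 1 / 16 ≤ a) (hb : 0 ≤ b) :
    (a + b) / 2 - √(a * b) ≤ 8 * (a - b) ^ 2 := by
  have h0 : 0 ≤ √a := Real.sqrt_nonneg a
  have h1 : 0 ≤ √b := Real.sqrt_nonneg b
  have ea : √a ^ 2 = a := Real.sq_sqrt (by linarith)
  have eb : √b ^ 2 = b := Real.sq_sqrt hb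
  have hs : 1 / 4 ≤ √a := by
    rw [show (1 / 4 : ℝ) = √(1 / 16) by
      rw [show (1 / 16 : ℝ) = (1 / 4) ^ 2 by norm_num]; exact (Real.sqrt_sq (by norm_num)).symm]
    exact Real.sqrt_le_sqrt ha
  rw [Real.sqrt_mul (by linarith)]
  have e : (a - b) ^ 2 = (√a - √b) ^ 2 * (√a + √b) ^ 2 := by rw [← ea, ← eb]; simp; ring
  have e2 : (a + b) / 2 - √a * √b = (√a - √b) ^ 2 / 2 := by nlinarith
  rw [e, e2]
  have : 1 / 16 ≤ (√a + √b) ^ 2 := by nlinarith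
  nlinarith [sq_nonneg (√a - √b)]

/-- Only one of the two demands has to stay away from 0 and 1, which is why Hellinger distance is
convenient here. -/
lemma hell_le {D₀ D₁ : ℝ × ℝ → ℝ} {z : ℝ × ℝ} (h₀ : D₀ z ∈ Icc (1 / 16 : ℝ) (15 / 16))
    (h₁ : D₁ z ∈ Icc (0 : ℝ) 1) : hell D₀ D₁ z ≤ 16 * (D₀ z - D₁ z) ^ 2 := by
  have a := sub_sqrt_mul_le h₀.1 h₁.1
  have b := sub_sqrt_mul_le (a := 1 - D₀ z) (b := 1 - D₁ z) (by linarith [h₀.2])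
    (by linarith [h₁.2])
  have e : (1 - D₀ z - (1 - D₁ z)) ^ 2 = (D₀ z - D₁ z) ^ 2 := by ring
  unfold hell; rw [e] at b; linarith

end

section

variable (ctx : Measure ℝ) [IsProbabilityMeasure ctx] (π : Policy)

/-! ### Comparison of two response kernels -/

/-- `K` draws `true` with probability `D`. -/
def IsBernoulliKernel (K : Kernel (ℝ × ℝ) Bool) (D : ℝ × ℝ → ℝ) : Prop :=
  ∀ z, ∀ f : Bool → ℝ≥0∞, ∫⁻ y, f y ∂K z =
    f true * ENNReal.ofReal (bern D (z, true)) + f false * ENNReal.ofReal (bern D (z, false))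

/-- The geometric mean of the probabilities of a response under `D₀` and `D₁`. -/
def geo (D₀ D₁ : ℝ × ℝ → ℝ) (o : Obs) : ℝ := √(bern D₀ o * bern D₁ o)

lemma measurable_geo {D₀ D₁ : ℝ × ℝ → ℝ} (h₀ : Measurable D₀) (h₁ : Measurable D₁) :
    Measurable (geo D₀ D₁) :=
  ((measurable_bern h₀).mul (measurable_bern h₁)).sqrt

/-- The Hellinger affinity of the two laws of the data of the first `t` rounds. -/
def affinity (D₀ D₁ : ℝ × ℝ → ℝ) (t : ℕ) : ℝ≥0∞ :=
  ∫⁻ d, weight (fun o => ENNReal.ofReal (geo D₀ D₁ o)) t d ∂refLaw ctx π t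

lemma weight_ofReal {b : Obs → ℝ} (hb : ∀ o, 0 ≤ b o) (t : ℕ) (h : Hist t) :
    weight (fun o => ENNReal.ofReal (b o)) t h = ENNReal.ofReal (∏ s, b (h s)) := by
  unfold weight
  rw [ENNReal.ofReal_prod_of_nonneg fun i _ => hb _]

lemma prod_geo_sq {D₀ D₁ : ℝ × ℝ → ℝ} (h₀ : ∀ z, D₀ z ∈ Icc (0 : ℝ) 1)
    (h₁ : ∀ z, D₁ z ∈ Icc (0 : ℝ) 1) (t : ℕ) (h : Hist t) :
    (∏ s, geo D₀ D₁ (h s)) ^ 2 = (∏ s, bern D₀ (h s)) * ∏ s, bern D₁ (h s) := by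
  rw [← Finset.prod_pow, ← Finset.prod_mul_distrib]
  exact Finset.prod_congr rfl fun i _ =>
    Real.sq_sqrt (mul_nonneg (bern_nonneg h₀ _) (bern_nonneg h₁ _))

/-- Transfers the extended nonnegative form of the two-point inequality to the reals. -/
lemma le_of_ofReal_le {k a b S : ℝ} (hk : 0 ≤ k) (ha : 0 ≤ a) (hb : 0 ≤ b) (hS : 0 ≤ S)
    (h : 4 * ENNReal.ofReal k ≤ 3 * (ENNReal.ofReal a + ENNReal.ofReal b) + 2 * ENNReal.ofReal k
      + 2 * ENNReal.ofReal k * ENNReal.ofReal S) :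
    4 * k ≤ 3 * (a + b) + 2 * k + 2 * k * S := by
  rw [← ENNReal.ofReal_add ha hb,
    show (4 : ℝ≥0∞) = ENNReal.ofReal 4 by simp, show (3 : ℝ≥0∞) = ENNReal.ofReal 3 by simp,
    show (2 : ℝ≥0∞) = ENNReal.ofReal 2 by simp,
    ← ENNReal.ofReal_mul (by norm_num), ← ENNReal.ofReal_mul (by norm_num),
    ← ENNReal.ofReal_mul (by norm_num), ← ENNReal.ofReal_mul (by positivity),
    ← ENNReal.ofReal_add (by positivity) (by positivity),
    ← ENNReal.ofReal_add (by positivity) (by positivity),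
    ENNReal.ofReal_le_ofReal_iff (by positivity)] at h
  exact h

section

variable {D₀ D₁ : ℝ × ℝ → ℝ} (m₀ : Measurable D₀) (m₁ : Measurable D₁)
  (h₀ : ∀ z, D₀ z ∈ Icc (0 : ℝ) 1) (h₁ : ∀ z, D₁ z ∈ Icc (0 : ℝ) 1)

include h₀ h₁

/-- AM-GM for the two likelihoods. -/
lemma two_mul_weight_geo_le (t : ℕ) (h : Hist t) :
    2 * weight (fun o => ENNReal.ofReal (geo D₀ D₁ o)) t h ≤
      weight (fun o => ENNReal.ofReal (bern D₀ o)) t h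
        + weight (fun o => ENNReal.ofReal (bern D₁ o)) t h := by
  rw [weight_ofReal (b := geo D₀ D₁) (fun o => Real.sqrt_nonneg _), weight_ofReal (bern_nonneg h₀),
    weight_ofReal (bern_nonneg h₁)]
  have e := prod_geo_sq h₀ h₁ t h
  have p0 : 0 ≤ ∏ s, bern D₀ (h s) := Finset.prod_nonneg fun i _ => bern_nonneg h₀ _
  have p1 : 0 ≤ ∏ s, bern D₁ (h s) := Finset.prod_nonneg fun i _ => bern_nonneg h₁ _
  rw [← ENNReal.ofReal_add p0 p1, show (2 : ℝ≥0∞) = ENNReal.ofReal 2 by simp,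
    ← ENNReal.ofReal_mul (by norm_num)]
  apply ENNReal.ofReal_le_ofReal
  nlinarith [sq_nonneg (∏ s, bern D₀ (h s) - ∏ s, bern D₁ (h s)),
    abs_le_of_sq_le_sq' (a := 2 * ∏ s, geo D₀ D₁ (h s)) (b := ∏ s, bern D₀ (h s) + ∏ s, bern D₁ (h s))
      (by nlinarith [sq_nonneg (∏ s, bern D₀ (h s) - ∏ s, bern D₁ (h s))]) (by positivity)]

/-- If `P ≤ Q` are the likelihoods, AM-GM applied to `4P` and `Q` gives `4√(PQ) ≤ 4P + Q`. The
weights are chosen so that integrating bounds the affinity by the overlap of the two laws plus a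
constant. -/
lemma four_mul_weight_geo_le (t : ℕ) (h : Hist t) :
    4 * weight (fun o => ENNReal.ofReal (geo D₀ D₁ o)) t h ≤
      3 * min (weight (fun o => ENNReal.ofReal (bern D₀ o)) t h)
          (weight (fun o => ENNReal.ofReal (bern D₁ o)) t h)
        + (weight (fun o => ENNReal.ofReal (bern D₀ o)) t h
        + weight (fun o => ENNReal.ofReal (bern D₁ o)) t h) := by
  rw [weight_ofReal (b := geo D₀ D₁) (fun o => Real.sqrt_nonneg _), weight_ofReal (bern_nonneg h₀),
    weight_ofReal (bern_nonneg h₁)]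
  have e := prod_geo_sq h₀ h₁ t h
  have p0 : 0 ≤ ∏ s, bern D₀ (h s) := Finset.prod_nonneg fun i _ => bern_nonneg h₀ _
  have p1 : 0 ≤ ∏ s, bern D₁ (h s) := Finset.prod_nonneg fun i _ => bern_nonneg h₁ _
  generalize ∏ s, bern D₀ (h s) = P at *
  generalize ∏ s, bern D₁ (h s) = Q at *
  generalize ∏ s, geo D₀ D₁ (h s) = w at *
  rw [← ENNReal.ofReal_add p0 p1, show (4 : ℝ≥0∞) = ENNReal.ofReal 4 by simp,
    show (3 : ℝ≥0∞) = ENNReal.ofReal 3 by simp, ← ENNReal.ofReal_min,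
    ← ENNReal.ofReal_mul (by norm_num), ← ENNReal.ofReal_mul (by norm_num),
    ← ENNReal.ofReal_add (by positivity) (by positivity)]
  apply ENNReal.ofReal_le_ofReal
  rcases le_total P Q with h | h
  · rw [min_eq_left h]
    exact (abs_le_of_sq_le_sq' (by nlinarith [sq_nonneg (4 * P - Q)]) (by positivity)).2
  · rw [min_eq_right h]
    exact (abs_le_of_sq_le_sq' (by nlinarith [sq_nonneg (4 * Q - P)]) (by positivity)).2

variable {K₀ K₁ : Kernel (ℝ × ℝ) Bool} [IsMarkovKernel K₀] [IsMarkovKernel K₁]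
  (k₀ : IsBernoulliKernel K₀ D₀) (k₁ : IsBernoulliKernel K₁ D₁)

include m₀ m₁ k₀ k₁

/-- The next response multiplies the integrand by `1 - hell`, so the drop of the affinity is the
integral of `hell` against the geometric mean of the likelihoods. AM-GM replaces that mean by the
average of the two laws. -/
lemma affinity_le_succ (t : ℕ) :
    2 * affinity ctx π D₀ D₁ t ≤ 2 * affinity ctx π D₀ D₁ (t + 1)
      + (∫⁻ z, ENNReal.ofReal (hell D₀ D₁ z) ∂roundLaw ctx π K₀ t
        + ∫⁻ z, ENNReal.ofReal (hell D₀ D₁ z) ∂roundLaw ctx π K₁ t) := by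
  have mg : Measurable (fun o => ENNReal.ofReal (geo D₀ D₁ o)) :=
    (measurable_geo m₀ m₁).ennreal_ofReal
  have mb₀ : Measurable (fun o => ENNReal.ofReal (bern D₀ o)) :=
    (measurable_bern m₀).ennreal_ofReal
  have mb₁ : Measurable (fun o => ENNReal.ofReal (bern D₁ o)) :=
    (measurable_bern m₁).ennreal_ofReal
  have mh : Measurable (fun z => ENNReal.ofReal (hell D₀ D₁ z)) :=
    (measurable_hell m₀ m₁).ennreal_ofReal
  have mH : Measurable (fun h : Hist t =>
      ∫⁻ z, ENNReal.ofReal (hell D₀ D₁ z) ∂roundKernel ctx π t h) :=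
    mh.lintegral_kernel
  rw [lintegral_roundLaw _ _ _ _ mh, lintegral_roundLaw _ _ _ _ mh,
    lintegral_lawWith_eq_refLaw ctx π K₀ mb₀ k₀ t mH,
    lintegral_lawWith_eq_refLaw ctx π K₁ mb₁ k₁ t mH]
  have mgW := measurable_weight mg t
  have hsucc : affinity ctx π D₀ D₁ (t + 1) = ∫⁻ h,
      weight (fun o => ENNReal.ofReal (geo D₀ D₁ o)) t h * ∫⁻ z, ENNReal.ofReal (1 - hell D₀ D₁ z)
        ∂roundKernel ctx π t h ∂refLaw ctx π t := by
    rw [affinity, lintegral_refLaw_succ ctx π t (measurable_weight mg _)]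
    refine lintegral_congr fun h => ?_
    rw [← lintegral_const_mul _ (measurable_const.fun_sub (measurable_hell m₀ m₁)).ennreal_ofReal]
    refine lintegral_congr fun z => ?_
    have n : ∀ o, 0 ≤ geo D₀ D₁ o := fun o => Real.sqrt_nonneg _
    rw [weight_snoc, weight_snoc, ← mul_add, ← ENNReal.ofReal_add (n _) (n _)]
    congr 2
    simp [hell, geo, bern]; ring
  -- The drop is written as a sum, which avoids truncated subtraction in `ℝ≥0∞`.
  have key : affinity ctx π D₀ D₁ t = affinity ctx π D₀ D₁ (t + 1) + ∫⁻ h,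
      weight (fun o => ENNReal.ofReal (geo D₀ D₁ o)) t h * ∫⁻ z, ENNReal.ofReal (hell D₀ D₁ z)
        ∂roundKernel ctx π t h ∂refLaw ctx π t := by
    rw [hsucc, ← lintegral_add_right _ (mgW.fun_mul mH), affinity]
    refine lintegral_congr fun h => ?_
    rw [← mul_add, ← lintegral_add_right _ mh]
    have : ∀ z, ENNReal.ofReal (1 - hell D₀ D₁ z) + ENNReal.ofReal (hell D₀ D₁ z) = 1 := by
      intro z
      rw [← ENNReal.ofReal_add (by linarith [hell_le_one D₀ D₁ z]) (hell_nonneg h₀ h₁ z)]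
      simp
    simp [this]
  rw [key, mul_add]
  gcongr
  rw [← lintegral_const_mul _ (mgW.fun_mul mH), ← lintegral_add_left (mH.fun_mul (measurable_weight mb₀ t))]
  refine lintegral_mono fun h => ?_
  rw [← mul_add, ← mul_assoc, mul_comm]
  gcongr
  exact two_mul_weight_geo_le h₀ h₁ t h

/-- Telescoping, starting from affinity 1 for empty data. -/
lemma two_le_affinity_add (t : ℕ) :
    2 ≤ 2 * affinity ctx π D₀ D₁ t + ∑ s ∈ Finset.range t,
      (∫⁻ z, ENNReal.ofReal (hell D₀ D₁ z) ∂roundLaw ctx π K₀ s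
        + ∫⁻ z, ENNReal.ofReal (hell D₀ D₁ z) ∂roundLaw ctx π K₁ s) := by
  induction t with
  | zero => simp [affinity, weight, refLaw, lawWith]
  | succ t ih =>
    refine ih.trans ?_
    rw [Finset.sum_range_succ]
    calc _ ≤ (2 * affinity ctx π D₀ D₁ (t + 1) + (_ + _)) + _ := by
          gcongr
          exact affinity_le_succ ctx π m₀ m₁ h₀ h₁ k₀ k₁ t
      _ = _ := by ring

/-- The sum of the two risks dominates `κ` times the overlap `∫ min` of the laws. The overlap is
bounded below by the affinity, and the affinity by the information `S`. -/
lemma two_point_lintegral (t : ℕ) {ψ₀ ψ₁ : Hist t → ℝ≥0∞} (hψ₀ : Measurable ψ₀)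
    (hψ₁ : Measurable ψ₁) {κ : ℝ≥0∞} (hκ : ∀ h, κ ≤ ψ₀ h + ψ₁ h) :
    4 * κ ≤ 3 * (∫⁻ h, ψ₀ h ∂lawWith ctx π K₀ t + ∫⁻ h, ψ₁ h ∂lawWith ctx π K₁ t) + 2 * κ
      + 2 * κ * ∑ s ∈ Finset.range t,
        (∫⁻ z, ENNReal.ofReal (hell D₀ D₁ z) ∂roundLaw ctx π K₀ s
        + ∫⁻ z, ENNReal.ofReal (hell D₀ D₁ z) ∂roundLaw ctx π K₁ s) := by
  have mg : Measurable (fun o => ENNReal.ofReal (geo D₀ D₁ o)) :=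
    (measurable_geo m₀ m₁).ennreal_ofReal
  have mb₀ : Measurable (fun o => ENNReal.ofReal (bern D₀ o)) :=
    (measurable_bern m₀).ennreal_ofReal
  have mb₁ : Measurable (fun o => ENNReal.ofReal (bern D₁ o)) :=
    (measurable_bern m₁).ennreal_ofReal
  set S := ∑ s ∈ Finset.range t,
        (∫⁻ z, ENNReal.ofReal (hell D₀ D₁ z) ∂roundLaw ctx π K₀ s
        + ∫⁻ z, ENNReal.ofReal (hell D₀ D₁ z) ∂roundLaw ctx π K₁ s)
  have hA : 2 ≤ 2 * affinity ctx π D₀ D₁ t + S :=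
    two_le_affinity_add ctx π m₀ m₁ h₀ h₁ k₀ k₁ t
  have w₀ := measurable_weight mb₀ t
  have w₁ := measurable_weight mb₁ t
  have e₀ : ∫⁻ h, weight (fun o => ENNReal.ofReal (bern D₀ o)) t h ∂refLaw ctx π t = 1 := by
    have := lintegral_lawWith_eq_refLaw ctx π K₀ mb₀ k₀ t (f := fun _ => 1) measurable_const
    simpa using this.symm
  have e₁ : ∫⁻ h, weight (fun o => ENNReal.ofReal (bern D₁ o)) t h ∂refLaw ctx π t = 1 := by
    have := lintegral_lawWith_eq_refLaw ctx π K₁ mb₁ k₁ t (f := fun _ => 1) measurable_const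
    simpa using this.symm
  have hB : 4 * affinity ctx π D₀ D₁ t ≤
      3 * ∫⁻ h, min (weight (fun o => ENNReal.ofReal (bern D₀ o)) t h)
          (weight (fun o => ENNReal.ofReal (bern D₁ o)) t h) ∂refLaw ctx π t + 2 := by
    rw [show (2 : ℝ≥0∞) = 1 + 1 by norm_num]
    nth_rewrite 1 [← e₀]
    rw [← e₁, ← lintegral_add_left w₀, ← lintegral_const_mul _ (w₀.min w₁),
      ← lintegral_add_left ((w₀.min w₁).const_mul _), affinity,
      ← lintegral_const_mul _ (measurable_weight mg t)]
    exact lintegral_mono fun h => four_mul_weight_geo_le h₀ h₁ t h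
  have hC : κ * ∫⁻ h, min (weight (fun o => ENNReal.ofReal (bern D₀ o)) t h)
          (weight (fun o => ENNReal.ofReal (bern D₁ o)) t h) ∂refLaw ctx π t ≤
        ∫⁻ h, ψ₀ h ∂lawWith ctx π K₀ t + ∫⁻ h, ψ₁ h ∂lawWith ctx π K₁ t := by
    rw [lintegral_lawWith_eq_refLaw ctx π K₀ mb₀ k₀ t hψ₀,
      lintegral_lawWith_eq_refLaw ctx π K₁ mb₁ k₁ t hψ₁, ← lintegral_add_left (hψ₀.fun_mul w₀),
      ← lintegral_const_mul _ (w₀.min w₁)]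
    refine lintegral_mono fun h => ?_
    refine (mul_le_mul_left (hκ h) _).trans ?_
    rw [add_mul]
    gcongr
    · exact min_le_left _ _
    · exact min_le_right _ _
  calc 4 * κ = 2 * κ * 2 := by ring
    _ ≤ 2 * κ * (2 * affinity ctx π D₀ D₁ t + S) := by gcongr
    _ = κ * (4 * affinity ctx π D₀ D₁ t) + 2 * κ * S := by ring
    _ ≤ κ * (3 * ∫⁻ h, min (weight (fun o => ENNReal.ofReal (bern D₀ o)) t h)
          (weight (fun o => ENNReal.ofReal (bern D₁ o)) t h) ∂refLaw ctx π t + 2)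
          + 2 * κ * S := by gcongr
    _ = 3 * (κ * ∫⁻ h, min (weight (fun o => ENNReal.ofReal (bern D₀ o)) t h)
          (weight (fun o => ENNReal.ofReal (bern D₁ o)) t h) ∂refLaw ctx π t) + 2 * κ
          + 2 * κ * S := by ring
    _ ≤ _ := by gcongr

/-- Two-point lower bound: if no price does well in both problems for covariates in `X`, the
errors add up to a constant unless the problems are told apart. -/
lemma two_point (t : ℕ) {g₀ g₁ : ℝ × ℝ → ℝ} (hg₀ : Measurable g₀) (hg₁ : Measurable g₁)
    (i₀ : Integrable g₀ (roundLaw ctx π K₀ t)) (i₁ : Integrable g₁ (roundLaw ctx π K₁ t))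
    {Y : Set ℝ} (hY : ctx Yᶜ = 0) (hYm : MeasurableSet Y)
    (n₀ : ∀ x ∈ Y, ∀ p ∈ prices, 0 ≤ g₀ (x, p)) (n₁ : ∀ x ∈ Y, ∀ p ∈ prices, 0 ≤ g₁ (x, p))
    {X : Set ℝ} (hX : MeasurableSet X) {κ : ℝ} (hκ0 : 0 ≤ κ)
    (hκ : ∀ x ∈ X, x ∈ Y → ∀ p ∈ prices, κ ≤ g₀ (x, p) + g₁ (x, p)) :
    κ * ctx.real X ≤ 3 / 4 * (∫ z, g₀ z ∂roundLaw ctx π K₀ t + ∫ z, g₁ z ∂roundLaw ctx π K₁ t)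
      + κ * ctx.real X / 2
      + κ * ctx.real X / 2 * ∑ s ∈ Finset.range t,
        (∫ z, hell D₀ D₁ z ∂roundLaw ctx π K₀ s + ∫ z, hell D₀ D₁ z ∂roundLaw ctx π K₁ s) := by
  have G₀ := hg₀.ennreal_ofReal
  have G₁ := hg₁.ennreal_ofReal
  have hψ₀ : Measurable (fun h : Hist t => ∫⁻ z, ENNReal.ofReal (g₀ z) ∂roundKernel ctx π t h) :=
    G₀.lintegral_kernel
  have hψ₁ : Measurable (fun h : Hist t => ∫⁻ z, ENNReal.ofReal (g₁ z) ∂roundKernel ctx π t h) :=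
    G₁.lintegral_kernel
  -- Given history and covariate, the price has the same distribution in both problems, so the
  -- pointwise separation survives averaging over prices.
  have hlow : ∀ h : Hist t, ENNReal.ofReal κ * ctx X ≤
      (∫⁻ z, ENNReal.ofReal (g₀ z) ∂roundKernel ctx π t h)
        + ∫⁻ z, ENNReal.ofReal (g₁ z) ∂roundKernel ctx π t h := by
    intro h
    rw [← lintegral_add_left G₀, lintegral_roundKernel ctx π t h (G₀.fun_add G₁),
      ← lintegral_indicator_const hX]
    refine lintegral_mono_ae ?_
    have h1 : ∀ᵐ x ∂ctx, x ∈ Y := by rw [ae_iff]; exact hY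
    filter_upwards [h1] with x hx
    by_cases hxX : x ∈ X
    · rw [indicator_of_mem hxX]
      have h2 : ∀ᵐ p ∂π.price t (h, x), p ∈ prices := by rw [ae_iff]; exact π.price_mem t (h, x)
      calc ENNReal.ofReal κ = ∫⁻ p, ENNReal.ofReal κ ∂π.price t (h, x) := by simp
        _ ≤ _ := by
          refine lintegral_mono_ae ?_
          filter_upwards [h2] with p hp
          rw [← ENNReal.ofReal_add (n₀ x hx p hp) (n₁ x hx p hp)]
          exact ENNReal.ofReal_le_ofReal (hκ x hxX hx p hp)
    · rw [indicator_of_notMem hxX]; exact zero_le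
  have main := two_point_lintegral ctx π m₀ m₁ h₀ h₁ k₀ k₁ t hψ₀ hψ₁ hlow
  rw [← lintegral_roundLaw ctx π K₀ t G₀, ← lintegral_roundLaw ctx π K₁ t G₁] at main
  have c₀ : ∫⁻ z, ENNReal.ofReal (g₀ z) ∂roundLaw ctx π K₀ t
      = ENNReal.ofReal (∫ z, g₀ z ∂roundLaw ctx π K₀ t) := by
    rw [ofReal_integral_eq_lintegral_ofReal i₀]
    filter_upwards [ae_roundLaw ctx π K₀ t hYm hY] with z hz using n₀ _ hz.1 _ hz.2
  have c₁ : ∫⁻ z, ENNReal.ofReal (g₁ z) ∂roundLaw ctx π K₁ t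
      = ENNReal.ofReal (∫ z, g₁ z ∂roundLaw ctx π K₁ t) := by
    rw [ofReal_integral_eq_lintegral_ofReal i₁]
    filter_upwards [ae_roundLaw ctx π K₁ t hYm hY] with z hz using n₁ _ hz.1 _ hz.2
  have p₀ : 0 ≤ ∫ z, g₀ z ∂roundLaw ctx π K₀ t := by
    refine integral_nonneg_of_ae ?_
    filter_upwards [ae_roundLaw ctx π K₀ t hYm hY] with z hz using n₀ _ hz.1 _ hz.2
  have p₁ : 0 ≤ ∫ z, g₁ z ∂roundLaw ctx π K₁ t := by
    refine integral_nonneg_of_ae ?_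
    filter_upwards [ae_roundLaw ctx π K₁ t hYm hY] with z hz using n₁ _ hz.1 _ hz.2
  have ch : ∀ (K : Kernel (ℝ × ℝ) Bool) [IsMarkovKernel K] (s : ℕ),
      ∫⁻ z, ENNReal.ofReal (hell D₀ D₁ z) ∂roundLaw ctx π K s
      = ENNReal.ofReal (∫ z, hell D₀ D₁ z ∂roundLaw ctx π K s) := by
    intro K _ s
    rw [ofReal_integral_eq_lintegral_ofReal]
    · refine Integrable.of_bound (measurable_hell m₀ m₁).aestronglyMeasurable 1 ?_
      refine Filter.Eventually.of_forall fun z => ?_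
      rw [Real.norm_eq_abs, abs_le]
      exact ⟨by linarith [hell_nonneg h₀ h₁ z], hell_le_one _ _ z⟩
    · exact Filter.Eventually.of_forall (hell_nonneg h₀ h₁)
  have ph : ∀ (K : Kernel (ℝ × ℝ) Bool) (s : ℕ), 0 ≤ ∫ z, hell D₀ D₁ z ∂roundLaw ctx π K s :=
    fun K s => integral_nonneg (hell_nonneg h₀ h₁)
  have ph2 : ∀ s ∈ Finset.range t, 0 ≤
      ∫ z, hell D₀ D₁ z ∂roundLaw ctx π K₀ s + ∫ z, hell D₀ D₁ z ∂roundLaw ctx π K₁ s :=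
    fun s _ => add_nonneg (ph _ _) (ph _ _)
  simp only [c₀, c₁, ch, ← ENNReal.ofReal_add (ph _ _) (ph _ _)] at main
  rw [show ctx X = ENNReal.ofReal (ctx.real X) by simp [measureReal_def],
    ← ENNReal.ofReal_mul hκ0, ← ENNReal.ofReal_sum_of_nonneg ph2] at main
  have := le_of_ofReal_le (mul_nonneg hκ0 measureReal_nonneg) p₀ p₁ (Finset.sum_nonneg ph2) main
  linarith

end

end

section

/-! ### Markets as Bernoulli responses, and regret as a sum over rounds -/

/-- Rounds after `t` integrate to 1 because all kernels are Markov; the induction strips the last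
round. -/
lemma lintegral_lawWith_apply (ctx : Measure ℝ) [IsProbabilityMeasure ctx] (π : Policy)
    (K : Kernel (ℝ × ℝ) Bool) [IsMarkovKernel K] {f : ℝ × ℝ → ℝ≥0∞} (hf : Measurable f) (T : ℕ)
    (t : Fin T) : ∫⁻ d, f (d t).1 ∂lawWith ctx π K T = ∫⁻ z, f z ∂roundLaw ctx π K t := by
  induction T with
  | zero => exact t.elim0
  | succ T ih =>
    have hm : Measurable (fun d : Hist (T + 1) => f (d t).1) :=
      hf.comp (measurable_fst.comp (measurable_pi_apply t))
    rw [lintegral_lawWith_succ ctx π K T hm]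
    have hK : ∀ z, K z {false, true} = 1 := fun z => by rw [← Bool.univ_eq]; exact measure_univ
    refine Fin.lastCases ?_ (fun j => ?_) t
    · simp [hK, lintegral_roundLaw ctx π K T hf]
    · simpa [hK] using ih j

lemma map_lawWith_apply (ctx : Measure ℝ) [IsProbabilityMeasure ctx] (π : Policy)
    (K : Kernel (ℝ × ℝ) Bool) [IsMarkovKernel K] (T : ℕ) (t : Fin T) :
    (lawWith ctx π K T).map (fun d => (d t).1) = roundLaw ctx π K t := by
  have hm : Measurable (fun d : Hist T => (d t).1) := measurable_fst.comp (measurable_pi_apply t)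
  refine Measure.ext_of_lintegral _ fun f hf => ?_
  rw [lintegral_map hf hm, lintegral_lawWith_apply ctx π K hf]

namespace Market

variable (I : Market)

/-- The probability of a purchase given covariate and price. -/
def demand (z : ℝ × ℝ) : ℝ := 1 - I.F (z.2 - I.util z.1)

lemma demand_mem (z : ℝ × ℝ) : I.demand z ∈ Icc (0 : ℝ) 1 :=
  ⟨sub_nonneg.2 (cdf_le_one _ _), sub_le_self _ (cdf_nonneg _ _)⟩

lemma measurable_demand : Measurable I.demand :=
  measurable_const.sub ((monotone_cdf I.noise).measurable.comp
    (measurable_snd.sub (I.util_meas.comp measurable_fst)))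

lemma measurable_buy : Measurable
    (fun q : (ℝ × ℝ) × ℝ => decide (q.1.2 ≤ I.util q.1.1 + q.2)) := by
  refine measurable_to_bool ?_
  have e : (fun q : (ℝ × ℝ) × ℝ => decide (q.1.2 ≤ I.util q.1.1 + q.2)) ⁻¹' {true}
      = {q | q.1.2 ≤ I.util q.1.1 + q.2} := by ext; simp
  rw [e]
  exact measurableSet_le (by fun_prop)
    ((I.util_meas.comp (measurable_fst.comp measurable_fst)).add measurable_snd)

instance purchase_markov : IsMarkovKernel I.purchase := by
  unfold purchase
  exact Kernel.IsMarkovKernel.map _ I.measurable_buy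

/-- A purchase is the event `ε ≥ p - m(x)`, a closed half-line. Continuity of `F` excludes an atom
at its end, so the probability is `1 - F` and not one minus a left limit. -/
lemma purchase_bernoulli (hF : Continuous I.F) : IsBernoulliKernel I.purchase I.demand := by
  intro z f
  rw [lintegral_fintype]
  have hset : ∀ b : Bool, I.purchase z {b} =
      I.noise {e | decide (z.2 ≤ I.util z.1 + e) = b} := by
    intro b
    rw [purchase, Kernel.map_apply' _ I.measurable_buy _ (measurableSet_singleton b),
      Kernel.prod_apply, Kernel.id_apply, Kernel.const_apply, Measure.dirac_prod,
      Measure.map_apply measurable_prodMk_left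
        (I.measurable_buy (measurableSet_singleton b))]
    rfl
  have hn : ∀ b, I.purchase z {b} = ENNReal.ofReal (bern I.demand (z, b)) := by
    have hl : Function.leftLim (cdf I.noise) (z.2 - I.util z.1) = I.F (z.2 - I.util z.1) :=
      (hF.continuousAt.continuousWithinAt).leftLim_eq
    intro b
    rw [hset]
    cases b
    · have e : {e | decide (z.2 ≤ I.util z.1 + e) = false} = Iio (z.2 - I.util z.1) := by
        ext e; simp [lt_sub_iff_add_lt']
      rw [e, ← measure_cdf I.noise, StieltjesFunction.measure_Iio _ (tendsto_cdf_atBot _), hl]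
      simp [bern, demand]
    · have e : {e | decide (z.2 ≤ I.util z.1 + e) = true} = Ici (z.2 - I.util z.1) := by
        ext e; simp [add_comm]
      rw [e, ← measure_cdf I.noise, StieltjesFunction.measure_Ici _ (tendsto_cdf_atTop _), hl]
      simp [bern, demand]
  simp [hn]

/-- The revenue lost by a price at a covariate. -/
def loss (z : ℝ × ℝ) : ℝ := I.optRevenue z.1 - I.revenue z.1 z.2

lemma revenue_mem {x p : ℝ} (hp : p ∈ prices) : I.revenue x p ∈ Icc (0 : ℝ) 1 := by
  have h := I.demand_mem (x, p)
  have e : I.revenue x p = p * I.demand (x, p) := rfl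
  have h1 : (1 / 8 : ℝ) ≤ p := hp.1
  have h2 : p ≤ 7 / 16 := hp.2
  rw [e]
  exact ⟨mul_nonneg (by linarith) h.1, by nlinarith [h.1, h.2]⟩

lemma bddAbove_revenue (x : ℝ) : BddAbove (I.revenue x '' prices) :=
  ⟨1, by rintro _ ⟨p, hp, rfl⟩; exact (I.revenue_mem hp).2⟩

lemma revenue_le_opt (x : ℝ) {p : ℝ} (hp : p ∈ prices) : I.revenue x p ≤ I.optRevenue x :=
  le_csSup (I.bddAbove_revenue x) ⟨p, hp, rfl⟩

lemma revenue_sub_le_loss {x p q : ℝ} (hq : q ∈ prices) :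
    I.revenue x q - I.revenue x p ≤ I.loss (x, p) :=
  sub_le_sub_right (I.revenue_le_opt x hq) _

lemma loss_nonneg {x p : ℝ} (hp : p ∈ prices) : 0 ≤ I.loss (x, p) :=
  sub_nonneg.2 (I.revenue_le_opt x hp)

lemma loss_le_one {x p : ℝ} (hp : p ∈ prices) : I.loss (x, p) ≤ 1 := by
  have h : I.optRevenue x ≤ 1 := csSup_le ⟨_, p, hp, rfl⟩ (by
    rintro _ ⟨q, hq, rfl⟩; exact (I.revenue_mem hq).2)
  have := (I.revenue_mem (x := x) hp).1
  unfold loss; linarith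

/-- The clairvoyant revenue is a supremum over a compact set of a jointly continuous function.
Continuity also supplies the measurability of the loss. -/
lemma continuous_loss (hF : Continuous I.F) (hu : Continuous I.util) : Continuous I.loss := by
  have hr : Continuous (fun z : ℝ × ℝ => I.revenue z.1 z.2) := by
    unfold revenue
    exact continuous_snd.mul (continuous_const.sub
      (hF.comp (continuous_snd.sub (hu.comp continuous_fst))))
  have ho : Continuous I.optRevenue :=
    IsCompact.continuous_sSup (f := I.revenue) (isCompact_Icc (a := (1 / 8 : ℝ)) (b := 7 / 16)) hr
  exact (ho.comp continuous_fst).sub hr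

/-- The law of covariate and price in round `t`. -/
def round (π : Policy) (t : ℕ) : Measure (ℝ × ℝ) := roundLaw I.ctx π I.purchase t

instance (π : Policy) (t : ℕ) : IsProbabilityMeasure (I.round π t) := by
  unfold round; infer_instance

lemma ae_round (π : Policy) (t : ℕ) :
    ∀ᵐ z ∂I.round π t, z.1 ∈ I.dom ∧ z.2 ∈ prices :=
  ae_roundLaw I.ctx π I.purchase t I.dom_compact.measurableSet I.ctx_dom

lemma integrable_of_bound (π : Policy) (t : ℕ) {g : ℝ × ℝ → ℝ} (hg : Measurable g) (C : ℝ)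
    (h : ∀ x ∈ I.dom, ∀ p ∈ prices, |g (x, p)| ≤ C) : Integrable g (I.round π t) := by
  refine Integrable.of_bound hg.aestronglyMeasurable C ?_
  filter_upwards [I.ae_round π t] with z hz using h _ hz.1 _ hz.2

lemma integral_mono_round (π : Policy) (t : ℕ) {f g : ℝ × ℝ → ℝ}
    (hf : Integrable f (I.round π t)) (hg : Integrable g (I.round π t))
    (h : ∀ x ∈ I.dom, ∀ p ∈ prices, f (x, p) ≤ g (x, p)) :
    ∫ z, f z ∂I.round π t ≤ ∫ z, g z ∂I.round π t := by
  refine integral_mono_ae hf hg ?_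
  filter_upwards [I.ae_round π t] with z hz using h _ hz.1 _ hz.2

lemma integrable_loss (hF : Continuous I.F) (hu : Continuous I.util) (π : Policy) (t : ℕ) :
    Integrable I.loss (I.round π t) :=
  I.integrable_of_bound π t (I.continuous_loss hF hu).measurable 1 fun x _ p hp => by
    rw [abs_of_nonneg (I.loss_nonneg hp)]; exact I.loss_le_one hp

lemma integrable_hell (π : Policy) (t : ℕ) {D₀ D₁ : ℝ × ℝ → ℝ} (m₀ : Measurable D₀)
    (m₁ : Measurable D₁) (h₀ : ∀ z, D₀ z ∈ Icc (0 : ℝ) 1) (h₁ : ∀ z, D₁ z ∈ Icc (0 : ℝ) 1) :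
    Integrable (hell D₀ D₁) (I.round π t) :=
  I.integrable_of_bound π t (measurable_hell m₀ m₁) 1 fun x _ p _ => by
    rw [abs_of_nonneg (hell_nonneg h₀ h₁ _)]; exact hell_le_one _ _ _

lemma integral_loss_nonneg (π : Policy) (t : ℕ) : 0 ≤ ∫ z, I.loss z ∂I.round π t := by
  refine integral_nonneg_of_ae ?_
  filter_upwards [I.ae_round π t] with z hz using I.loss_nonneg hz.2

lemma expectedRegret_eq_sum (hF : Continuous I.F) (hu : Continuous I.util) (π : Policy) (T : ℕ) :
    I.expectedRegret π T = ∑ t ∈ Finset.range T, ∫ z, I.loss z ∂I.round π t := by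
  have hm : ∀ t : Fin T, Measurable (fun d : Hist T => (d t).1) := fun t =>
    measurable_fst.comp (measurable_pi_apply t)
  have key : ∀ t : Fin T, (I.law π T).map (fun d => (d t).1) = I.round π t := by
    intro t
    rw [law_eq_lawWith, map_lawWith_apply]; rfl
  have hint : ∀ t : Fin T, Integrable (fun d : Hist T => I.loss (d t).1) (I.law π T) := by
    intro t
    have := I.integrable_loss hF hu π t
    rw [← key t] at this
    exact this.comp_measurable (hm t)
  have e : I.expectedRegret π T = ∑ t : Fin T, ∫ d, I.loss (d t).1 ∂I.law π T := by
    rw [← integral_finsetSum _ fun t _ => hint t]; rfl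
  rw [e, ← Fin.sum_univ_eq_sum_range (fun t => ∫ z, I.loss z ∂I.round π t)]
  refine Finset.sum_congr rfl fun t _ => ?_
  rw [← key t, integral_map (hm t).aemeasurable]
  exact (I.continuous_loss hF hu).measurable.aestronglyMeasurable

/-- The two-point lower bound for the losses of two markets with the same covariates. -/
lemma two_point_loss (J : Market) (hctx : J.ctx = I.ctx) (hFI : Continuous I.F)
    (hFJ : Continuous J.F) (huI : Continuous I.util) (huJ : Continuous J.util) (π : Policy) (t : ℕ)
    {X : Set ℝ} (hX : MeasurableSet X) {κ : ℝ} (hκ0 : 0 ≤ κ)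
    (hκ : ∀ x ∈ X, x ∈ I.dom → ∀ p ∈ prices, κ ≤ I.loss (x, p) + J.loss (x, p)) :
    κ * I.ctx.real X ≤ 3 / 4 * (∫ z, (Prod.fst ⁻¹' X).indicator I.loss z ∂I.round π t
        + ∫ z, (Prod.fst ⁻¹' X).indicator J.loss z ∂J.round π t)
      + κ * I.ctx.real X / 2
      + κ * I.ctx.real X / 2 * ∑ s ∈ Finset.range t,
        (∫ z, hell I.demand J.demand z ∂I.round π s + ∫ z, hell I.demand J.demand z ∂J.round π s) := by
  have hXm : MeasurableSet (Prod.fst ⁻¹' X : Set (ℝ × ℝ)) := measurable_fst hX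
  have i₀ := (I.integrable_loss hFI huI π t).indicator hXm
  have i₁ := (J.integrable_loss hFJ huJ π t).indicator hXm
  have pos : ∀ K : Market, ∀ x, ∀ p ∈ prices,
      0 ≤ (Prod.fst ⁻¹' X : Set (ℝ × ℝ)).indicator K.loss (x, p) := by
    intro K x p hp
    by_cases h : (x, p) ∈ (Prod.fst ⁻¹' X : Set (ℝ × ℝ))
    · rw [indicator_of_mem h]; exact K.loss_nonneg hp
    · rw [indicator_of_notMem h]
  simp only [round, hctx] at i₀ i₁ ⊢
  refine two_point I.ctx π I.measurable_demand J.measurable_demand I.demand_mem J.demand_mem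
    (I.purchase_bernoulli hFI) (J.purchase_bernoulli hFJ) t
    ((I.continuous_loss hFI huI).measurable.indicator hXm)
    ((J.continuous_loss hFJ huJ).measurable.indicator hXm) i₀ i₁ I.ctx_dom
    I.dom_compact.measurableSet (fun x _ p hp => pos I x p hp) (fun x _ p hp => pos J x p hp)
    hX hκ0 ?_
  intro x hx hd p hp
  have h : (x, p) ∈ (Prod.fst ⁻¹' X : Set (ℝ × ℝ)) := hx
  rw [indicator_of_mem h, indicator_of_mem h]
  exact hκ x hx hd p hp

end Market

end

section

open Filter Topology

/-! ### Distribution functions and markets -/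

lemma isCDF_of_monotone {F : ℝ → ℝ} (hm : Monotone F) (hc : Continuous F)
    (h0 : Tendsto F atBot (𝓝 0)) (h1 : Tendsto F atTop (𝓝 1)) : IsCDF F := by
  let f : StieltjesFunction ℝ := ⟨F, hm, fun x => hc.continuousAt.continuousWithinAt⟩
  refine ⟨f.measure, ⟨?_⟩, fun u => ?_⟩
  · rw [f.measure_univ h0 h1]; simp
  · rw [cdf_measure_stieltjesFunction f h0 h1]

lemma unif_prob {lo hi : ℝ} (h : lo < hi) : IsProbabilityMeasure (unif lo hi) := by
  refine cond_isProbabilityMeasure_of_finite ?_ ?_ <;> simp [h]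

lemma unif_compl (lo hi : ℝ) : unif lo hi (Icc lo hi)ᶜ = 0 := by
  simp [unif, cond_apply measurableSet_Icc]

lemma unif_real_Icc {lo hi u v : ℝ} (h : lo < hi) (hu : lo ≤ u) (hv : v ≤ hi) (huv : u ≤ v) :
    (unif lo hi).real (Icc u v) = (v - u) / (hi - lo) := by
  rw [measureReal_def, unif, cond_apply measurableSet_Icc,
    inter_eq_self_of_subset_right (Icc_subset_Icc hu hv), Real.volume_Icc, Real.volume_Icc,
    ENNReal.toReal_mul, ENNReal.toReal_inv, ENNReal.toReal_ofReal (by linarith),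
    ENNReal.toReal_ofReal (by linarith)]
  field_simp

lemma exists_market {lo hi : ℝ} (h : lo < hi) {m F : ℝ → ℝ} (hm : Measurable m) (hF : IsCDF F) :
    ∃ I : Market, I.ctx = unif lo hi ∧ I.dom = Icc lo hi ∧ I.util = m ∧ I.F = F := by
  obtain ⟨ν, hν, hνF⟩ := hF
  exact ⟨⟨unif lo hi, Icc lo hi, ν, m, unif_prob h, isCompact_Icc, unif_compl lo hi, hν, hm⟩,
    rfl, rfl, rfl, funext hνF⟩

/-! ### Clipped linear distribution functions -/

lemma continuous_clippedLinear (a b : ℝ) : Continuous (clippedLinear a b) := by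
  unfold clippedLinear; fun_prop

lemma isCDF_clippedLinear {a : ℝ} (b : ℝ) (ha : 0 < a) : IsCDF (clippedLinear a b) := by
  refine isCDF_of_monotone ?_ (continuous_clippedLinear a b) ?_ ?_
  · intro u v huv
    unfold clippedLinear
    gcongr
  · refine tendsto_const_nhds.congr' ?_
    filter_upwards [eventually_le_atBot (-b / a)] with u hu
    rw [le_div_iff₀ ha] at hu
    rw [clippedLinear, max_eq_left]
    exact (min_le_right _ _).trans (by linarith)
  · refine tendsto_const_nhds.congr' ?_
    filter_upwards [eventually_ge_atTop ((1 - b) / a)] with u hu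
    rw [div_le_iff₀ ha] at hu
    rw [clippedLinear, min_eq_left (by linarith), max_eq_right (by norm_num)]

lemma clippedLinear_of_mem {a b u : ℝ} (h : u ∈ linearRegion a b) :
    clippedLinear a b u = a * u + b := by
  rw [clippedLinear, min_eq_right h.2.le, max_eq_right h.1.le]

lemma isOpen_linearRegion (a b : ℝ) : IsOpen (linearRegion a b) :=
  isOpen_Ioo.preimage (f := fun u : ℝ => a * u + b) (by fun_prop : Continuous _)

/-- Since `⌊β⌋ ≥ 2`, the relevant derivative of an affine function vanishes, so the constant 0
serves all `a` and `b`. -/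
lemma betaSmoothOn_clippedLinear {β : ℝ} (hβ : 2 ≤ β) (a b : ℝ) :
    BetaSmoothOn β 0 (clippedLinear a b) (linearRegion a b) := by
  have ho := isOpen_linearRegion a b
  have he : EqOn (clippedLinear a b) (fun u => a * u + b) (linearRegion a b) :=
    fun u hu => clippedLinear_of_mem hu
  have hz : ∀ x ∈ linearRegion a b,
      iteratedDerivWithin ⌊β⌋₊ (clippedLinear a b) (linearRegion a b) x = 0 := by
    intro x hx
    obtain ⟨k, hk⟩ : ∃ k, ⌊β⌋₊ = k + 2 := ⟨⌊β⌋₊ - 2, by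
      have : 2 ≤ ⌊β⌋₊ := Nat.le_floor (by exact_mod_cast hβ)
      omega⟩
    rw [iteratedDerivWithin_congr he hx, iteratedDerivWithin_of_isOpen ho hx, hk,
      iteratedDeriv_succ', iteratedDeriv_succ']
    have h1 : deriv (fun u : ℝ => a * u + b) = fun _ => a := by
      ext u; simp
    have h2 : deriv (fun _ : ℝ => a) = fun _ => 0 := by ext; simp
    rw [h1, h2]
    simp
  refine ⟨ContDiffOn.congr (by fun_prop) he, fun x hx y hy => ?_⟩
  rw [hz x hx, hz y hy]; simp

/-- Here `φ(u) = 2u - (1 - b)/a`, whose slope is free of the parameters. -/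
lemma transformIncreasingOn_clippedLinear {a : ℝ} (b : ℝ) (ha : 0 < a) :
    TransformIncreasingOn 2 (clippedLinear a b) (linearRegion a b) := by
  have ho := isOpen_linearRegion a b
  have hd : ∀ u ∈ linearRegion a b, deriv (clippedLinear a b) u = a := by
    intro u hu
    have : clippedLinear a b =ᶠ[𝓝 u] fun u => a * u + b :=
      eventually_of_mem (ho.mem_nhds hu) fun v hv => clippedLinear_of_mem hv
    rw [this.deriv_eq]; simp
  intro u hu
  have hphi : phi (clippedLinear a b) =ᶠ[𝓝 u] fun u => 2 * u - (1 - b) / a := by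
    refine eventually_of_mem (ho.mem_nhds hu) fun v hv => ?_
    rw [phi, hd v hv, clippedLinear_of_mem hv]
    field_simp
    ring
  have h2 : HasDerivAt (fun u : ℝ => 2 * u - (1 - b) / a) 2 u := by
    simpa using ((hasDerivAt_id u).const_mul 2).sub_const ((1 - b) / a)
  refine ⟨by rw [hd u hu]; exact ha, ?_, ?_⟩
  · exact (hphi.differentiableAt_iff).2 h2.differentiableAt
  · rw [hphi.deriv_eq, h2.deriv]

/-- The argument `p - θx` lies between `1/8 - 33/128 = -17/128` and `7/16`; with `a ≤ 33/32` and `b`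
between `15/32` and `17/32` the affine value stays strictly inside `(0, 1)`. -/
lemma sub_mem_linearRegion {η : ℝ} (hη : η ≤ 1 / 32) {a b θ p x : ℝ}
    (ha : a ∈ Icc (1 - η) (1 + η)) (hb : b ∈ Icc (1 / 2 - η) (1 / 2 + η))
    (hθ : θ ∈ Icc (1 - η) (1 + η)) (hp : p ∈ prices) (hx : x ∈ Icc (0 : ℝ) (1 / 4)) :
    p - θ * x ∈ linearRegion a b := by
  obtain ⟨a1, a2⟩ := ha
  obtain ⟨b1, b2⟩ := hb
  obtain ⟨t1, t2⟩ := hθ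
  obtain ⟨p1, p2⟩ := hp
  obtain ⟨x1, x2⟩ := hx
  have h1 : θ * x ≤ 33 / 32 * (1 / 4) := by gcongr; linarith
  have h0 : 0 ≤ θ * x := mul_nonneg (by linarith) x1
  constructor
  · have : -(33 / 32 * (17 / 128)) ≤ a * (p - θ * x) := by nlinarith
    linarith
  · have : a * (p - θ * x) ≤ 33 / 32 * (7 / 16) := by nlinarith
    linarith

/-! ### Feature diversity and conditional mean regularity -/

lemma map_unif {lo hi θ : ℝ} (h : lo < hi) (hθ : θ ≠ 0) :
    (unif lo hi).map (fun x => θ * x) = volume.withDensity (fun z => ENNReal.ofReal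
      ((uIcc (θ * lo) (θ * hi)).indicator (fun _ => 1 / (|θ| * (hi - lo))) z)) := by
  have himg : (fun x => θ * x) '' Icc lo hi = uIcc (θ * lo) (θ * hi) := by
    rw [← uIcc_of_le h.le]; exact image_const_mul_uIcc θ lo hi
  have hpre : (fun x => θ * x) ⁻¹' uIcc (θ * lo) (θ * hi) = Icc lo hi := by
    rw [← himg, preimage_image_eq _ (mul_right_injective₀ hθ)]
  have hd : (fun z => ENNReal.ofReal
      ((uIcc (θ * lo) (θ * hi)).indicator (fun _ => 1 / (|θ| * (hi - lo))) z))
      = (uIcc (θ * lo) (θ * hi)).indicator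
        (fun _ => ENNReal.ofReal (1 / (|θ| * (hi - lo)))) := by
    ext z
    by_cases hz : z ∈ uIcc (θ * lo) (θ * hi) <;> simp [hz]
  rw [hd, withDensity_indicator measurableSet_uIcc, withDensity_const, unif, ProbabilityTheory.cond,
    Measure.map_smul, ← hpre, ← Measure.restrict_map (by fun_prop) measurableSet_uIcc,
    Real.map_volume_mul_left hθ, Measure.restrict_smul, smul_smul, hpre, Real.volume_Icc,
    ← ENNReal.ofReal_inv_of_pos (by linarith), ← ENNReal.ofReal_mul (inv_nonneg.2 (by linarith))]
  congr 2
  rw [abs_inv]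
  field_simp

lemma featureDiverse_unif {lo hi θ cd Cd : ℝ} (h : lo < hi) (hθ : θ ≠ 0)
    (hcd : cd ≤ 1 / (|θ| * (hi - lo))) (hCd : 1 / (|θ| * (hi - lo)) ≤ Cd) :
    FeatureDiverse (unif lo hi) (Icc lo hi) (fun x => θ * x) 0 cd Cd := by
  refine ⟨min (θ * lo) (θ * hi), max (θ * lo) (θ * hi), ?_, ?_, _,
    measurable_const.indicator measurableSet_uIcc, map_unif h hθ, ?_⟩
  · rw [min_lt_max]
    exact fun e => h.ne (mul_left_cancel₀ hθ e)
  · rw [← uIcc_of_le h.le]; exact image_const_mul_uIcc θ lo hi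
  · intro z hz
    have : z ∈ uIcc (θ * lo) (θ * hi) := hz
    rw [indicator_of_mem this]
    simp only [boundaryProfile, Real.rpow_zero, min_self, mul_one]
    exact ⟨hcd, hCd⟩

/-- The difference of two linear utilities is a multiple of the estimate, so conditioning does
nothing and the version is linear, of slope at most `4/|θ|` in absolute value. For `θ = θ'` division
by zero gives the value 0, as the convention requires. -/
lemma conditionalMeanRegular_unif {lo hi : ℝ} (h : lo < hi) (hlo : -(1 / 4) ≤ lo) (hhi : hi = 1 / 4)
    {θ θ' R : ℝ} (hR : 0 < R) (hθ : R⁻¹ ≤ |θ|) {L : ℝ≥0} (hL : 4 * R ≤ L) :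
    ConditionalMeanRegular (unif lo hi) (Icc lo hi) (fun x => θ * x) (fun x => θ' * x) L := by
  subst hhi
  have hθ0 : θ ≠ 0 := by
    rintro rfl
    simp at hθ
    linarith
  have hθp : 0 < |θ| := abs_pos.2 hθ0
  set d := θ - θ'
  have hsup : supNormOn (Icc lo (1 / 4)) (fun x => θ * x - θ' * x) = |d| / 4 := by
    refine IsGreatest.csSup_eq ⟨⟨1 / 4, ⟨h.le, le_rfl⟩, ?_⟩, ?_⟩
    · simp only [← sub_mul, d, abs_mul]
      rw [abs_of_pos (show (0 : ℝ) < 1 / 4 by norm_num)]; ring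
    · rintro _ ⟨x, hx, rfl⟩
      simp only [← sub_mul, abs_mul]
      have : |x| ≤ 1 / 4 := abs_le.2 ⟨hlo.trans hx.1, hx.2⟩
      have := mul_le_mul_of_nonneg_left this (abs_nonneg d)
      simp only [d] at this ⊢
      linarith
  have hf : (fun x => (θ * x - θ' * x) / supNormOn (Icc lo (1 / 4)) (fun x => θ * x - θ' * x))
      = fun x => (d / (|d| / 4) / θ) * (θ * x) := by
    rw [hsup]
    ext x
    field_simp
    simp only [d]
  have hcoef : |d / (|d| / 4) / θ| ≤ 4 * R := by
    rw [abs_div]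
    have h1 : |d / (|d| / 4)| ≤ 4 := by
      rw [abs_div, abs_div, abs_abs]
      rcases eq_or_ne d 0 with hd | hd
      · simp [hd]
      · have : |d| ≠ 0 := abs_ne_zero.2 hd
        field_simp
        norm_num
    have h2 : 1 ≤ R * |θ| := by
      have := mul_le_mul_of_nonneg_left hθ hR.le
      rwa [mul_inv_cancel₀ hR.ne'] at this
    rw [div_le_iff₀ hθp]
    nlinarith
  refine ⟨fun t => (d / (|d| / 4) / θ) * t, ?_, ?_⟩
  · refine LipschitzOnWith.of_dist_le_mul fun x _ y _ => ?_
    rw [Real.dist_eq, Real.dist_eq, ← mul_sub, abs_mul]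
    gcongr
    exact hcoef.trans hL
  · rw [hf]
    have := unif_prob h
    have hm : MeasurableSpace.comap (fun x : ℝ => θ * x) inferInstance ≤
        (inferInstance : MeasurableSpace ℝ) := Measurable.comap_le (by fun_prop)
    rw [condExp_of_stronglyMeasurable hm]
    · apply Measurable.stronglyMeasurable
      exact (measurable_const_mul (d / (|d| / 4) / θ)).comp (comap_measurable _)
    · refine Integrable.of_bound (by fun_prop) (4 * R * (|θ| * (1 / 4))) ?_
      have : ∀ᵐ x ∂unif lo (1 / 4), x ∈ Icc lo (1 / 4) := by rw [ae_iff]; exact unif_compl _ _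
      filter_upwards [this] with x hx
      rw [Real.norm_eq_abs, abs_mul, abs_mul]
      gcongr
      exact abs_le.2 ⟨hlo.trans hx.1, hx.2⟩

lemma exists_covariate_constants {R : ℝ} (hR : 1 ≤ R) :
    ∃ (cd Cd : ℝ) (L : NNReal), 0 < cd ∧ cd ≤ Cd ∧
      ∀ mhat ∈ linearUtilities {θ | R⁻¹ ≤ |θ| ∧ |θ| ≤ R},
        FeatureDiverse (unif 0 (1 / 4)) (Icc 0 (1 / 4)) mhat 0 cd Cd ∧
        FeatureDiverse (unif (-(1 / 4)) (1 / 4)) (Icc (-(1 / 4)) (1 / 4)) mhat 0 cd Cd ∧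
        (∀ m ∈ linearUtilities univ,
          ConditionalMeanRegular (unif 0 (1 / 4)) (Icc 0 (1 / 4)) mhat m L) ∧
        ConditionalMeanRegular (unif (-(1 / 4)) (1 / 4))
          (Icc (-(1 / 4)) (1 / 4)) mhat (fun x => x) L := by
  have hR0 : 0 < R := by linarith
  -- The densities of the estimate are `4/|θ|` and `2/|θ|` for the two covariate laws; `2/R` and
  -- `4R` bracket both.
  refine ⟨2 / R, 4 * R, ⟨4 * R, by positivity⟩, by positivity, ?_, ?_⟩
  · rw [div_le_iff₀ hR0]; nlinarith
  · rintro _ ⟨θ, ⟨h1, h2⟩, hθ0, rfl⟩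
    have hθp : 0 < |θ| := abs_pos.2 hθ0
    have h3 : 1 ≤ R * |θ| := by
      have := mul_le_mul_of_nonneg_left h1 hR0.le
      rwa [mul_inv_cancel₀ hR0.ne'] at this
    refine ⟨featureDiverse_unif (by norm_num) hθ0 ?_ ?_,
      featureDiverse_unif (by norm_num) hθ0 ?_ ?_, ?_, ?_⟩
    · rw [div_le_div_iff₀ hR0 (by positivity)]; nlinarith
    · rw [div_le_iff₀ (by positivity)]; nlinarith
    · rw [div_le_div_iff₀ hR0 (by norm_num; positivity)]; nlinarith
    · rw [div_le_iff₀ (by norm_num; positivity)]; nlinarith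
    · rintro _ ⟨θ', -, -, rfl⟩
      exact conditionalMeanRegular_unif (by norm_num) (by norm_num) rfl hR0 h1 le_rfl
    · have := conditionalMeanRegular_unif (lo := -(1 / 4)) (hi := 1 / 4) (by norm_num) le_rfl rfl
        (θ' := 1) (L := ⟨4 * R, by positivity⟩) hR0 h1 le_rfl
      simpa using this

end

/-! ### The lower bound of order `√T` from the first class -/

lemma exists_mem_classOne {η a b θ : ℝ} (hη : η ≤ 1 / 32) (ha : a ∈ Icc (1 - η) (1 + η))
    (hb : b ∈ Icc (1 / 2 - η) (1 / 2 + η)) (hθ : θ ∈ Icc (1 - η) (1 + η)) :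
    ∃ I ∈ classOne η, I.ctx = unif 0 (1 / 4) ∧ I.dom = Icc 0 (1 / 4) ∧
      Continuous I.F ∧ Continuous I.util ∧
      ∀ x ∈ Icc (0 : ℝ) (1 / 4), ∀ p ∈ prices, I.demand (x, p) = 1 - (a * (p - θ * x) + b) := by
  have ha0 : 0 < a := by linarith [ha.1]
  obtain ⟨I, h1, h2, h3, h4⟩ := exists_market (lo := 0) (hi := 1 / 4) (by norm_num)
    (m := fun x => θ * x) (by fun_prop) (isCDF_clippedLinear b ha0)
  refine ⟨I, ⟨h1, h2, ⟨θ, hθ, ?_, h3⟩, ⟨a, b, ⟨ha, hb⟩, ha0, h4⟩⟩, h1, h2, ?_, ?_, ?_⟩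
  · have := hθ.1
    intro h
    linarith
  · rw [h4]; exact continuous_clippedLinear a b
  · rw [h3]; fun_prop
  · intro x hx p hp
    rw [Market.demand, h3, h4, clippedLinear_of_mem (sub_mem_linearRegion hη ha hb hθ hp hx)]

/-- Summation of the two-point bounds over the rounds. -/
lemma sum_le_of_two_point {T : ℕ} {r₀ r₁ : ℕ → ℝ} (h₀ : ∀ t, 0 ≤ r₀ t) (h₁ : ∀ t, 0 ≤ r₁ t)
    {κ A B : ℝ} (hκ : 0 ≤ κ) (hA : 0 ≤ A) (hB : 0 ≤ B) (hBT : T * B ≤ 1 / 4)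
    (hAT : T * κ * A ≤ 1 / 2)
    (h : ∀ t < T, κ ≤ 3 / 4 * (r₀ t + r₁ t) + κ / 2
      + κ / 2 * ∑ s ∈ Finset.range t, (A * (r₀ s + r₁ s) + B)) :
    3 / 8 * (T * κ) ≤ ∑ t ∈ Finset.range T, r₀ t + ∑ t ∈ Finset.range T, r₁ t := by
  rw [← Finset.sum_add_distrib]
  set S := ∑ t ∈ Finset.range T, (r₀ t + r₁ t) with hS
  have hpos : ∀ s, 0 ≤ A * (r₀ s + r₁ s) + B := fun s =>
    add_nonneg (mul_nonneg hA (add_nonneg (h₀ s) (h₁ s))) hB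
  have hS0 : 0 ≤ S := Finset.sum_nonneg fun s _ => add_nonneg (h₀ s) (h₁ s)
  -- The information is bounded by the total regret `S` itself. As `TκA ≤ 1/2`, summing over the
  -- rounds produces only another `S/4` from it, to be added to `3S/4`.
  have hb : ∀ t ∈ Finset.range T, κ ≤ 3 / 4 * (r₀ t + r₁ t) + κ / 2 + κ / 2 * (A * S + T * B) := by
    intro t ht
    have ht' := Finset.mem_range.1 ht
    refine (h t ht').trans ?_
    gcongr
    calc _ ≤ ∑ s ∈ Finset.range T, (A * (r₀ s + r₁ s) + B) :=
          Finset.sum_le_sum_of_subset_of_nonneg (Finset.range_mono ht'.le) fun s _ _ => hpos s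
      _ = A * S + T * B := by
          rw [Finset.sum_add_distrib, ← Finset.mul_sum]; simp [S]
  have := Finset.sum_le_sum hb
  simp only [Finset.sum_add_distrib, Finset.sum_const, Finset.card_range, nsmul_eq_mul,
    ← Finset.mul_sum] at this
  rw [← Finset.sum_add_distrib, ← hS] at this
  have e1 : (T : ℝ) * (κ / 2 * (A * S + T * B)) = T * κ * A * S / 2 + T * κ / 2 * (T * B) := by ring
  have e2 : T * κ * A * S ≤ 1 / 2 * S := mul_le_mul_of_nonneg_right hAT hS0
  have e3 : (T : ℝ) * κ / 2 * (T * B) ≤ T * κ / 2 * (1 / 4) :=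
    mul_le_mul_of_nonneg_left hBT (by positivity)
  linarith

/-- The two demands differ by `δ (1/4 + x/2 - p)`, which vanishes at the optimal price of the first
market. Prices that are good there are uninformative, and learning the difference costs loss. -/
lemma classOne_lower {η : ℝ} (hη0 : 0 < η) (hη : η ≤ 1 / 32) :
    ∃ c : ℝ, 0 < c ∧ ∀ T : ℕ, 1 ≤ T → ∀ π : Policy, ∃ I ∈ classOne η,
      c * (T : ℝ) ^ (1 / 2 : ℝ) ≤ I.expectedRegret π T := by
  refine ⟨η ^ 2 * (3 / 3200), by positivity, fun T hT π => ?_⟩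
  have hT1 : (1 : ℝ) ≤ T := by exact_mod_cast hT
  set τ : ℝ := (T : ℝ) ^ (1 / 4 : ℝ) with hτ
  have hτ1 : 1 ≤ τ := Real.one_le_rpow hT1 (by norm_num)
  have hτ2 : (T : ℝ) ^ (1 / 2 : ℝ) = τ ^ 2 := by
    rw [hτ, ← Real.rpow_natCast, ← Real.rpow_mul (by positivity)]; norm_num
  have hτ4 : (T : ℝ) = τ ^ 4 := by
    rw [hτ, ← Real.rpow_natCast, ← Real.rpow_mul (by positivity)]; norm_num
  -- With this choice `T δ⁴ = η⁴` stays bounded, while `T δ²`, the order of the regret, grows like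
  -- `√T`.
  set δ : ℝ := η / τ with hδ
  have hδ0 : 0 < δ := by positivity
  have hδη : δ ≤ η := div_le_self hη0.le hτ1
  have hδ32 : δ ≤ 1 / 32 := hδη.trans hη
  have hdiv1 : (1 + δ / 2) / (1 + δ) ≤ 1 + η := by
    rw [div_le_iff₀ (by positivity)]; nlinarith
  have hdiv2 : 1 - η ≤ (1 + δ / 2) / (1 + δ) := by
    rw [le_div_iff₀ (by positivity)]; nlinarith
  obtain ⟨I, hI, Ic, Id, IF, Iu, Idem⟩ := exists_mem_classOne (η := η) (a := 1) (b := 1 / 2)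
    (θ := 1) hη ⟨by linarith, by linarith⟩ ⟨by linarith, by linarith⟩ ⟨by linarith, by linarith⟩
  -- All three parameters move together; `a * θ = 1 + δ/2` makes the demands cross at `1/4 + x/2`
  -- for every covariate.
  obtain ⟨J, hJ, Jc, Jd, JF, Ju, Jdem⟩ := exists_mem_classOne (η := η) (a := 1 + δ)
    (b := 1 / 2 - δ / 4) (θ := (1 + δ / 2) / (1 + δ)) hη ⟨by linarith, by linarith⟩
    ⟨by linarith, by linarith⟩ ⟨hdiv2, hdiv1⟩
  have Idem' : ∀ x ∈ Icc (0 : ℝ) (1 / 4), ∀ p ∈ prices, I.demand (x, p) = 1 / 2 - p + x := by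
    intro x hx p hp; rw [Idem x hx p hp]; ring
  have Jdem' : ∀ x ∈ Icc (0 : ℝ) (1 / 4), ∀ p ∈ prices,
      J.demand (x, p) = 1 / 2 + δ / 4 - (1 + δ) * p + (1 + δ / 2) * x := by
    intro x hx p hp
    rw [Jdem x hx p hp]
    have : (1 + δ) * ((1 + δ / 2) / (1 + δ) * x) = (1 + δ / 2) * x := by
      field_simp
    linear_combination this
  have rev : ∀ (K : Market) x p, K.revenue x p = p * K.demand (x, p) := fun _ _ _ => rfl
  -- the shift between the optimal prices of the two markets
  set w : ℝ → ℝ := fun x => (1 / 4 + x / 2) * (δ / 2) / (1 + δ) with hw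
  have hwmul : ∀ x, w x * (1 + δ) = (1 / 4 + x / 2) * (δ / 2) := by
    intro x; simp only [hw]; field_simp
  have hwle : ∀ x ∈ Icc (0 : ℝ) (1 / 4), w x ≤ δ / 4 := by
    intro x hx
    simp only [hw]
    rw [div_le_iff₀ (by positivity)]
    nlinarith [hx.1, hx.2]
  have hwge : ∀ x ∈ Icc (0 : ℝ) (1 / 4), δ / 9 ≤ w x := by
    intro x hx
    simp only [hw]
    rw [le_div_iff₀ (by positivity)]
    nlinarith [hx.1, hx.2]
  have lossI : ∀ x ∈ Icc (0 : ℝ) (1 / 4), ∀ p ∈ prices,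
      (p - (1 / 4 + x / 2)) ^ 2 ≤ I.loss (x, p) := by
    intro x hx p hp
    have hq : 1 / 4 + x / 2 ∈ prices := ⟨by linarith [hx.1], by linarith [hx.2]⟩
    refine le_trans (le_of_eq ?_) (I.revenue_sub_le_loss hq)
    rw [rev, rev, Idem' x hx p hp, Idem' x hx _ hq]; ring
  have lossJ : ∀ x ∈ Icc (0 : ℝ) (1 / 4), ∀ p ∈ prices,
      (p - (1 / 4 + x / 2 - w x)) ^ 2 ≤ J.loss (x, p) := by
    intro x hx p hp
    have a1 := hwle x hx
    have a2 := hwge x hx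
    have hq : 1 / 4 + x / 2 - w x ∈ prices := ⟨by linarith [hx.1], by linarith [hx.2]⟩
    refine le_trans ?_ (J.revenue_sub_le_loss hq)
    rw [rev, rev, Jdem' x hx p hp, Jdem' x hx _ hq]
    have e : (1 / 4 + x / 2 - w x) * (1 / 2 + δ / 4 - (1 + δ) * (1 / 4 + x / 2 - w x)
        + (1 + δ / 2) * x) - p * (1 / 2 + δ / 4 - (1 + δ) * p + (1 + δ / 2) * x)
        = (1 + δ) * (p - (1 / 4 + x / 2 - w x)) ^ 2 := by
      linear_combination (2 * ((1 / 4 + x / 2 - w x) - p)) * hwmul x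
    rw [e]
    nlinarith [sq_nonneg (p - (1 / 4 + x / 2 - w x))]
  -- The two squared distances add up to at least `w²/2 ≥ δ²/162`.
  have hsep : ∀ x ∈ (univ : Set ℝ), x ∈ I.dom → ∀ p ∈ prices,
      δ ^ 2 / 200 ≤ I.loss (x, p) + J.loss (x, p) := by
    intro x _ hx p hp
    rw [Id] at hx
    have a := lossI x hx p hp
    have b := lossJ x hx p hp
    have c := hwge x hx
    nlinarith [sq_nonneg (2 * (p - (1 / 4 + x / 2)) + w x)]
  have hdiff : ∀ x ∈ Icc (0 : ℝ) (1 / 4), ∀ p ∈ prices,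
      hell I.demand J.demand (x, p) ≤ 16 * δ ^ 2 * (p - (1 / 4 + x / 2)) ^ 2 := by
    intro x hx p hp
    have hb : I.demand (x, p) ∈ Icc (1 / 16 : ℝ) (15 / 16) := by
      rw [Idem' x hx p hp]
      constructor
      · linarith [hp.2, hx.1]
      · linarith [hp.1, hx.2]
    refine (hell_le hb (J.demand_mem _)).trans (le_of_eq ?_)
    rw [Idem' x hx p hp, Jdem' x hx p hp]; ring
  have iI := fun s => I.integrable_loss IF Iu π s
  have iJ := fun s => J.integrable_loss JF Ju π s
  have hellI : ∀ s, ∫ z, hell I.demand J.demand z ∂I.round π s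
      ≤ 32 * δ ^ 2 * ∫ z, I.loss z ∂I.round π s := by
    intro s
    rw [← integral_const_mul]
    refine I.integral_mono_round π s (I.integrable_hell π s I.measurable_demand
      J.measurable_demand I.demand_mem J.demand_mem) ((iI s).const_mul _) ?_
    intro x hx p hp
    rw [Id] at hx
    refine (hdiff x hx p hp).trans ?_
    have := mul_le_mul_of_nonneg_left (lossI x hx p hp) (show 0 ≤ 32 * δ ^ 2 by positivity)
    nlinarith [mul_nonneg (sq_nonneg δ) (sq_nonneg (p - (1 / 4 + x / 2)))]
  -- Under `J` the uninformative price is off the optimum by `w ≤ δ/4`, so even lossless play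
  -- reveals something: the extra `2δ⁴` per round, at most `2η⁴` in total.
  have hellJ : ∀ s, ∫ z, hell I.demand J.demand z ∂J.round π s
      ≤ 32 * δ ^ 2 * ∫ z, J.loss z ∂J.round π s + 2 * δ ^ 4 := by
    intro s
    have hc : ∫ z, (2 * δ ^ 4 : ℝ) ∂J.round π s = 2 * δ ^ 4 := by simp
    rw [← hc, ← integral_const_mul, ← integral_add ((iJ s).const_mul _) (integrable_const _)]
    refine J.integral_mono_round π s (J.integrable_hell π s I.measurable_demand
      J.measurable_demand I.demand_mem J.demand_mem)
      (((iJ s).const_mul _).add (integrable_const _)) ?_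
    intro x hx p hp
    rw [Jd] at hx
    refine (hdiff x hx p hp).trans ?_
    have h1 := lossJ x hx p hp
    have h2 := hwle x hx
    have h3 := hwge x hx
    have h4 : w x ^ 2 ≤ δ ^ 2 / 16 := by nlinarith
    have h5 : (p - (1 / 4 + x / 2)) ^ 2 ≤ 2 * J.loss (x, p) + δ ^ 2 / 8 := by
      nlinarith [sq_nonneg (p - (1 / 4 + x / 2) + 2 * w x)]
    calc 16 * δ ^ 2 * (p - (1 / 4 + x / 2)) ^ 2
        ≤ 16 * δ ^ 2 * (2 * J.loss (x, p) + δ ^ 2 / 8) := by gcongr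
      _ = 32 * δ ^ 2 * J.loss (x, p) + 2 * δ ^ 4 := by ring
  have hδT2 : (T : ℝ) * δ ^ 2 = η ^ 2 * τ ^ 2 := by
    rw [hτ4, hδ]; field_simp
  have hδT4 : (T : ℝ) * δ ^ 4 = η ^ 4 := by
    rw [hτ4, hδ]; field_simp
  have hη4 : η ^ 4 ≤ (1 / 32) ^ 4 := by gcongr
  have key := sum_le_of_two_point (T := T) (r₀ := fun t => ∫ z, I.loss z ∂I.round π t)
    (r₁ := fun t => ∫ z, J.loss z ∂J.round π t) (I.integral_loss_nonneg π)
    (J.integral_loss_nonneg π) (κ := δ ^ 2 / 200) (A := 32 * δ ^ 2) (B := 2 * δ ^ 4)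
    (by positivity) (by positivity) (by positivity) (by nlinarith)
    (by
      have : T * (δ ^ 2 / 200) * (32 * δ ^ 2) = 4 / 25 * (T * δ ^ 4) := by ring
      rw [this, hδT4]; linarith)
    (by
      intro t _
      have h := I.two_point_loss J (Jc.trans Ic.symm) IF JF Iu Ju π t MeasurableSet.univ
        (by positivity) hsep
      simp only [preimage_univ, indicator_univ, probReal_univ, mul_one] at h
      refine h.trans ?_
      have hs := Finset.sum_le_sum (s := Finset.range t) fun s _ => add_le_add (hellI s) (hellJ s)
      simp only [← add_assoc, ← mul_add] at hs
      have := mul_le_mul_of_nonneg_left hs (show 0 ≤ δ ^ 2 / 200 / 2 by positivity)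
      linarith)
  rw [← I.expectedRegret_eq_sum IF Iu, ← J.expectedRegret_eq_sum JF Ju] at key
  have e : (T : ℝ) * (δ ^ 2 / 200) = η ^ 2 * τ ^ 2 / 200 := by rw [← hδT2]; ring
  rw [e] at key
  rw [hτ2]
  rcases le_total (I.expectedRegret π T) (J.expectedRegret π T) with h | h
  · exact ⟨J, hJ, by linarith⟩
  · exact ⟨I, hI, by linarith⟩

section

open Filter Topology

/-! ### Criteria for smoothness and monotonicity of the transform -/

/-- For distances up to 1 the Lipschitz bound is the stronger one, as `t ≤ t^γ`; beyond 1 the bound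
on `g` suffices. -/
lemma holder_of_bounds {g : ℝ → ℝ} (hg : Differentiable ℝ g) {M : ℝ} (h0 : ∀ u, |g u| ≤ M)
    (h1 : ∀ u, |deriv g u| ≤ M) {γ : ℝ} (γ0 : 0 ≤ γ) (γ1 : γ ≤ 1) (x y : ℝ) :
    |g x - g y| ≤ 2 * M * |x - y| ^ γ := by
  have hM : 0 ≤ M := (abs_nonneg _).trans (h0 0)
  rcases le_or_gt |x - y| 1 with h | h
  · have hl : |g x - g y| ≤ M * |x - y| := by
      have := Convex.norm_image_sub_le_of_norm_deriv_le (f := g) (s := univ) (C := M)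
        (fun u _ => hg u) (fun u _ => h1 u) convex_univ (mem_univ y) (mem_univ x)
      simpa using this
    rcases eq_or_lt_of_le (abs_nonneg (x - y)) with h' | h'
    · rw [← h', mul_zero] at hl
      exact hl.trans (by positivity)
    · have : |x - y| ≤ |x - y| ^ γ := by
        conv_lhs => rw [← Real.rpow_one |x - y|]
        exact Real.rpow_le_rpow_of_exponent_ge h' h γ1
      nlinarith [mul_le_mul_of_nonneg_left this hM, Real.rpow_nonneg (abs_nonneg (x - y)) γ]
  · have : 1 ≤ |x - y| ^ γ := Real.one_le_rpow h.le γ0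
    calc |g x - g y| ≤ |g x| + |g y| := abs_sub _ _
      _ ≤ 2 * M * 1 := by linarith [h0 x, h0 y]
      _ ≤ _ := by gcongr

lemma floor_bounds {β : ℝ} (hβ : 2 ≤ β) :
    2 ≤ ⌊β⌋₊ ∧ 0 ≤ β - (⌊β⌋₊ : ℝ) ∧ β - (⌊β⌋₊ : ℝ) ≤ 1 :=
  ⟨Nat.le_floor (by exact_mod_cast hβ), sub_nonneg.2 (Nat.floor_le (by linarith)), by
    linarith [Nat.lt_floor_add_one β]⟩

lemma hasDerivAt_phi {F f : ℝ → ℝ} (hF : ∀ u, HasDerivAt F (f u) u) {u f' : ℝ}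
    (hf : HasDerivAt f f' u) (hpos : 0 < f u) :
    HasDerivAt (phi F) (2 + (1 - F u) * f' / f u ^ 2) u := by
  have e : phi F = fun u => u - (1 - F u) / f u := by
    ext v; rw [phi, (hF v).deriv]
  rw [e]
  have h := (hasDerivAt_id u).sub (((hF u).const_sub 1).div hf hpos.ne')
  refine h.congr_deriv ?_
  field_simp
  ring

/-- For the exponential tails of the baseline density, where every derivative is a multiple of the
density. -/
lemma iteratedDeriv_eq_pow_mul {f : ℝ → ℝ} {U : Set ℝ} (hU : IsOpen U) {a : ℝ}
    (h : ∀ u ∈ U, deriv f u = a * f u) (k : ℕ) : ∀ u ∈ U, iteratedDeriv k f u = a ^ k * f u := by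
  induction k with
  | zero => intro u _; simp
  | succ k ih =>
    intro u hu
    have e : iteratedDeriv k f =ᶠ[𝓝 u] fun v => a ^ k * f v :=
      eventually_of_mem (hU.mem_nhds hu) ih
    rw [iteratedDeriv_succ, e.deriv_eq, deriv_const_mul_field, h u hu]
    ring

/-! ### Existence of a baseline -/

/-- A convex function with slope `0` on the left and `1` from `1` on. -/
def ramp (x : ℝ) : ℝ := ∫ t in (0 : ℝ)..x, Real.smoothTransition t

lemma hasDerivAt_ramp (x : ℝ) : HasDerivAt ramp (Real.smoothTransition x) x :=
  intervalIntegral.integral_hasDerivAt_right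
    (Real.smoothTransition.continuous.intervalIntegrable _ _)
    (Real.smoothTransition.continuous.stronglyMeasurableAtFilter _ _)
    Real.smoothTransition.continuousAt

lemma contDiff_of_hasDerivAt {f g : ℝ → ℝ} (h : ∀ x, HasDerivAt f (g x) x)
    (hg : ContDiff ℝ ∞ g) : ContDiff ℝ ∞ f := by
  rw [contDiff_infty_iff_deriv]
  refine ⟨fun x => (h x).differentiableAt, ?_⟩
  rwa [show deriv f = g from funext fun x => (h x).deriv]

lemma contDiff_ramp : ContDiff ℝ ∞ ramp :=
  contDiff_of_hasDerivAt hasDerivAt_ramp Real.smoothTransition.contDiff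

lemma ramp_of_nonpos {x : ℝ} (hx : x ≤ 0) : ramp x = 0 := by
  rw [ramp]
  rw [intervalIntegral.integral_congr (g := fun _ => 0)]
  · simp
  · intro t ht
    rw [uIcc_of_ge hx] at ht
    exact Real.smoothTransition.zero_of_nonpos ht.2

lemma ramp_mono : Monotone ramp :=
  monotone_of_deriv_nonneg (fun x => (hasDerivAt_ramp x).differentiableAt) fun x => by
    rw [(hasDerivAt_ramp x).deriv]; exact Real.smoothTransition.nonneg x

lemma sub_one_le_ramp {x : ℝ} (hx : 1 ≤ x) : x - 1 ≤ ramp x := by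
  have h1 : ramp x = ramp 1 + ∫ t in (1 : ℝ)..x, Real.smoothTransition t :=
    (intervalIntegral.integral_add_adjacent_intervals
      (Real.smoothTransition.continuous.intervalIntegrable _ _)
      (Real.smoothTransition.continuous.intervalIntegrable _ _)).symm
  have h2 : ∫ t in (1 : ℝ)..x, Real.smoothTransition t = ∫ t in (1 : ℝ)..x, (1 : ℝ) := by
    refine intervalIntegral.integral_congr fun t ht => ?_
    rw [uIcc_of_le hx] at ht
    exact Real.smoothTransition.one_of_one_le ht.1
  have h3 : 0 ≤ ramp 1 := by
    rw [← ramp_of_nonpos le_rfl]; exact ramp_mono zero_le_one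
  rw [h1, h2]; simp; exact h3

/-- The primitive of `exp (- ramp)` vanishing at `0`. -/
def rampInt (x : ℝ) : ℝ := ∫ t in (0 : ℝ)..x, Real.exp (-ramp t)

lemma continuous_exp_ramp : Continuous (fun t => Real.exp (-ramp t)) :=
  (contDiff_ramp.continuous.neg).rexp

lemma hasDerivAt_rampInt (x : ℝ) : HasDerivAt rampInt (Real.exp (-ramp x)) x :=
  intervalIntegral.integral_hasDerivAt_right (continuous_exp_ramp.intervalIntegrable _ _)
    (continuous_exp_ramp.stronglyMeasurableAtFilter _ _) continuous_exp_ramp.continuousAt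

lemma rampInt_of_nonpos {x : ℝ} (hx : x ≤ 0) : rampInt x = x := by
  rw [rampInt, intervalIntegral.integral_congr (g := fun _ => 1)]
  · simp
  · intro t ht
    rw [uIcc_of_ge hx] at ht
    simp [ramp_of_nonpos ht.2]

lemma rampInt_mono : Monotone rampInt :=
  monotone_of_deriv_nonneg (fun x => (hasDerivAt_rampInt x).differentiableAt) fun x => by
    rw [(hasDerivAt_rampInt x).deriv]; exact (Real.exp_pos _).le

/-- From 1 on, the integrand is dominated by `exp 1 * exp (-t)`. -/
lemma exists_tendsto_rampInt : ∃ A, 0 < A ∧ Tendsto rampInt atTop (𝓝 A) := by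
  have hint : IntegrableOn (fun t => Real.exp (-ramp t)) (Ioi 1) := by
    have h := (integrableOn_exp_neg_Ioi 1).const_mul (Real.exp 1)
    refine Integrable.mono' h continuous_exp_ramp.aestronglyMeasurable ?_
    refine (ae_restrict_mem measurableSet_Ioi).mono fun t ht => ?_
    rw [Real.norm_eq_abs, abs_of_pos (Real.exp_pos _), ← Real.exp_add]
    exact Real.exp_le_exp.2 (by linarith [sub_one_le_ramp (le_of_lt ht)])
  have hint0 : IntegrableOn (fun t => Real.exp (-ramp t)) (Ioi 0) := by
    rw [← Ioc_union_Ioi_eq_Ioi (zero_le_one' ℝ)]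
    exact (continuous_exp_ramp.integrableOn_Ioc).union hint
  have ht : Tendsto rampInt atTop (𝓝 (∫ t in Ioi (0 : ℝ), Real.exp (-ramp t))) :=
    intervalIntegral_tendsto_integral_Ioi 0 hint0 tendsto_id
  refine ⟨_, ?_, ht⟩
  have h1 : rampInt 1 ≤ ∫ t in Ioi (0 : ℝ), Real.exp (-ramp t) :=
    rampInt_mono.ge_of_tendsto ht 1
  refine lt_of_lt_of_le ?_ h1
  exact intervalIntegral.intervalIntegral_pos_of_pos
    (continuous_exp_ramp.intervalIntegrable _ _) (fun t => Real.exp_pos _) zero_lt_one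

/-- Hazard rate bound for the density `exp (- ramp)`. -/
lemma smoothTransition_mul_le {A : ℝ} (hA : Tendsto rampInt atTop (𝓝 A)) (x : ℝ) :
    Real.smoothTransition x * (A - rampInt x) ≤ Real.exp (-ramp x) := by
  have hle : ∀ x, rampInt x ≤ A := fun x => rampInt_mono.ge_of_tendsto hA x
  have hs : Differentiable ℝ Real.smoothTransition :=
    (Real.smoothTransition.contDiff (n := 1)).differentiable (by norm_num)
  have hd : ∀ x, HasDerivAt
      (fun x => Real.exp (-ramp x) - Real.smoothTransition x * (A - rampInt x))
      (-(deriv Real.smoothTransition x * (A - rampInt x))) x := by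
    intro x
    have := ((hasDerivAt_ramp x).neg.exp).sub
      ((hs x).hasDerivAt.mul ((hasDerivAt_rampInt x).const_sub A))
    refine this.congr_deriv ?_
    simp only [Pi.neg_apply]
    ring
  -- The terms with `exp (-ramp)` cancel in the derivative; what is left is signed by monotonicity
  -- of the transition. It remains to see that the limit at infinity is nonnegative.
  have hanti : Antitone
      (fun x => Real.exp (-ramp x) - Real.smoothTransition x * (A - rampInt x)) := by
    refine antitone_of_deriv_nonpos (fun x => (hd x).differentiableAt) fun x => ?_
    rw [(hd x).deriv, neg_nonpos]
    exact mul_nonneg (Real.smoothTransition.monotone.deriv_nonneg) (sub_nonneg.2 (hle x))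
  have hlow : ∀ᶠ y in atTop, rampInt y - A ≤
      Real.exp (-ramp x) - Real.smoothTransition x * (A - rampInt x) := by
    filter_upwards [eventually_ge_atTop x] with y hy
    refine le_trans ?_ (hanti hy)
    have h1 := Real.smoothTransition.le_one y
    have h2 := hle y
    have h3 := Real.exp_pos (-ramp y)
    nlinarith
  have hlim : Tendsto (fun y => rampInt y - A) atTop (𝓝 0) := by
    simpa using hA.sub_const A
  linarith [le_of_tendsto hlim hlow]

/-- The density is symmetric, equals 1 on `[-1/4, 1/4]`, and has a log-concave tail that is exactly
exponential far out. The first property of the tail bounds `φ'` below; the second bounds all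
derivatives. -/
lemma exists_isBaseline {β : ℝ} (hβ : 2 ≤ β) : ∃ F₀ : ℝ → ℝ, IsBaseline β F₀ := by
  obtain ⟨A, hA0, hA⟩ := exists_tendsto_rampInt
  -- The tail beyond `1/4` has mass `c * A`, which must be `1/4`.
  set c : ℝ := 1 / (4 * A) with hc
  have hc0 : 0 < c := by positivity
  have hcA : c * A = 1 / 4 := by rw [hc]; field_simp
  clear_value c
  -- the right half of the distribution function and of its density
  set P : ℝ → ℝ := fun u => 1 / 4 + c * rampInt ((u - 1 / 4) / c) with hP
  set e : ℝ → ℝ := fun u => Real.exp (-ramp ((u - 1 / 4) / c)) with he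
  set r : ℝ → ℝ := fun u => Real.smoothTransition ((u - 1 / 4) / c) / c with hr
  have harg : ∀ u : ℝ, HasDerivAt (fun u : ℝ => (u - 1 / 4) / c) (1 / c) u := fun u =>
    ((hasDerivAt_id u).sub_const (1 / 4)).div_const c
  have dP : ∀ u, HasDerivAt P (e u) u := by
    intro u
    have := (((hasDerivAt_rampInt _).comp u (harg u)).const_mul c).const_add (1 / 4)
    refine this.congr_deriv ?_
    simp only [he]; field_simp
  have de : ∀ u, HasDerivAt e (-(r u * e u)) u := by
    intro u
    have := (((hasDerivAt_ramp _).comp u (harg u)).neg).exp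
    refine this.congr_deriv ?_
    simp only [he, hr, Pi.neg_apply, Function.comp]; ring
  have sP : ∀ u ≤ 1 / 4, P u = u := by
    intro u hu
    simp only [hP]
    rw [rampInt_of_nonpos (div_nonpos_of_nonpos_of_nonneg (by linarith) hc0.le)]
    field_simp
    ring
  have se : ∀ u ≤ 1 / 4, e u = 1 := by
    intro u hu
    simp only [he]
    rw [ramp_of_nonpos (div_nonpos_of_nonpos_of_nonneg (by linarith) hc0.le)]; simp
  have sr : ∀ u ≤ 1 / 4, r u = 0 := by
    intro u hu
    simp only [hr]
    rw [Real.smoothTransition.zero_of_nonpos (div_nonpos_of_nonpos_of_nonneg (by linarith) hc0.le)]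
    simp
  have sr1 : ∀ u, 1 / 4 + c < u → r u = 1 / c := by
    intro u hu
    simp only [hr]
    rw [Real.smoothTransition.one_of_one_le]
    rw [le_div_iff₀ hc0]; linarith
  have epos : ∀ u, 0 < e u := fun u => Real.exp_pos _
  have ramp0 : ∀ x, 0 ≤ ramp x := fun x => by
    rcases le_total x 0 with h | h
    · rw [ramp_of_nonpos h]
    · rw [← ramp_of_nonpos le_rfl]; exact ramp_mono h
  have ele : ∀ u, e u ≤ 1 := fun u => by
    simp only [he]; exact Real.exp_le_one_iff.2 (neg_nonpos.2 (ramp0 _))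
  have rnn : ∀ u, 0 ≤ r u := fun u => div_nonneg (Real.smoothTransition.nonneg _) hc0.le
  have tP : Tendsto P atTop (𝓝 (1 / 2)) := by
    have : Tendsto (fun u : ℝ => (u - 1 / 4) / c) atTop atTop :=
      (tendsto_atTop_add_const_right _ _ tendsto_id).atTop_div_const hc0
    have h := ((hA.comp this).const_mul c).const_add (1 / 4)
    rw [hcA] at h
    norm_num at h ⊢
    exact h
  have Phalf : ∀ u, P u ≤ 1 / 2 := by
    have : Monotone P := monotone_of_deriv_nonneg (fun u => (dP u).differentiableAt) fun u => by
      rw [(dP u).deriv]; exact (epos u).le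
    exact fun u => this.ge_of_tendsto tP u
  have hazard : ∀ u, r u * (1 / 2 - P u) ≤ e u := by
    intro u
    have h := smoothTransition_mul_le hA ((u - 1 / 4) / c)
    have e1 : r u * (1 / 2 - P u)
        = Real.smoothTransition ((u - 1 / 4) / c) * (A - rampInt ((u - 1 / 4) / c)) := by
      simp only [hr, hP]
      rw [show (1 / 2 : ℝ) - (1 / 4 + c * rampInt ((u - 1 / 4) / c))
        = c * (A - rampInt ((u - 1 / 4) / c)) by linear_combination -hcA]
      field_simp
    rw [e1]; exact h
  -- A single smooth formula for both halves: on each side of the plateau one of the two `P` terms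
  -- is linear and cancels against `u`.
  set F : ℝ → ℝ := fun u => 1 / 2 + P u - P (-u) - u with hF
  set f : ℝ → ℝ := fun u => e u + e (-u) - 1 with hf
  have dF : ∀ u, HasDerivAt F (f u) u := by
    intro u
    have h1 : HasDerivAt (fun u => P (-u)) (-(e (-u))) u :=
      ((dP (-u)).comp u (hasDerivAt_neg u)).congr_deriv (by ring)
    have := (((dP u).const_add (1 / 2)).sub h1).sub (hasDerivAt_id u)
    exact this.congr_deriv (by simp only [hf]; ring)
  have df : ∀ u, HasDerivAt f (-(r u * e u) + r (-u) * e (-u)) u := by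
    intro u
    have h1 : HasDerivAt (fun u => e (-u)) (r (-u) * e (-u)) u :=
      ((de (-u)).comp u (hasDerivAt_neg u)).congr_deriv (by ring)
    have := ((de u).add h1).sub_const 1
    exact this.congr_deriv (by ring)
  have fr : ∀ u, -(1 / 4) ≤ u → f u = e u := by
    intro u hu; simp only [hf]; rw [se (-u) (by linarith)]; ring
  have fl : ∀ u, u ≤ 1 / 4 → f u = e (-u) := by
    intro u hu; simp only [hf]; rw [se u hu]; ring
  have Fr : ∀ u, -(1 / 4) ≤ u → F u = 1 / 2 + P u := by
    intro u hu; simp only [hF]; rw [sP (-u) (by linarith)]; ring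
  have Fl : ∀ u, u ≤ 1 / 4 → F u = 1 / 2 - P (-u) := by
    intro u hu; simp only [hF]; rw [sP u hu]; ring
  have fpos : ∀ u, 0 < f u := by
    intro u
    rcases le_total u 0 with h | h
    · rw [fl u (by linarith)]; exact epos _
    · rw [fr u (by linarith)]; exact epos _
  have fle : ∀ u, f u ≤ 1 := by
    intro u
    rcases le_total u 0 with h | h
    · rw [fl u (by linarith)]; exact ele _
    · rw [fr u (by linarith)]; exact ele _
  have Fcdf : IsCDF F := by
    refine isCDF_of_monotone ?_ (continuous_iff_continuousAt.2 fun u => (dF u).continuousAt) ?_ ?_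
    · exact monotone_of_deriv_nonneg (fun u => (dF u).differentiableAt) fun u => by
        rw [(dF u).deriv]; exact (fpos u).le
    · have h := (tP.comp tendsto_neg_atBot_atTop).const_sub (1 / 2)
      rw [sub_self] at h
      refine h.congr' ?_
      filter_upwards [eventually_le_atBot 0] with u hu
      rw [Fl u (by linarith)]; rfl
    · have h := tP.const_add (1 / 2)
      rw [show (1 / 2 + 1 / 2 : ℝ) = 1 by norm_num] at h
      refine h.congr' ?_
      filter_upwards [eventually_ge_atTop 0] with u hu
      rw [Fr u (by linarith)]
  have ce : ContDiff ℝ ∞ e := by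
    have : ContDiff ℝ ∞ (fun u : ℝ => (u - 1 / 4) / c) := by fun_prop
    exact ((contDiff_ramp.comp this).neg).exp
  have cf : ContDiff ℝ ∞ f := (ce.add (ce.comp contDiff_neg)).sub contDiff_const
  have cF : ContDiff ℝ ∞ F := contDiff_of_hasDerivAt dF cf
  have bounded : ∀ k, ∃ M, ∀ u, |iteratedDeriv k f u| ≤ M := by
    intro k
    have hfr : ∀ u ∈ Ioi (1 / 4 + c), deriv f u = (-(1 / c)) * f u := by
      intro u hu
      have hu' : 1 / 4 + c < u := hu
      rw [(df u).deriv, fr u (by linarith), sr1 u hu', sr (-u) (by linarith)]; ring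
    have hfl : ∀ u ∈ Iio (-(1 / 4 + c)), deriv f u = (1 / c) * f u := by
      intro u hu
      have hu' : u < -(1 / 4 + c) := hu
      rw [(df u).deriv, fl u (by linarith), sr1 (-u) (by linarith), sr u (by linarith)]; ring
    have hcont : Continuous (iteratedDeriv k f) :=
      cf.continuous_iteratedDeriv k (by exact_mod_cast le_top)
    obtain ⟨M, hM⟩ := (isCompact_Icc (a := -(1 / 4 + c)) (b := 1 / 4 + c)).exists_bound_of_continuousOn
      hcont.continuousOn
    have habs : ∀ u, |f u| ≤ 1 := fun u => by rw [abs_of_pos (fpos u)]; exact fle u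
    have hck : 0 ≤ (1 / c) ^ k := by positivity
    refine ⟨max M ((1 / c) ^ k), fun u => ?_⟩
    rcases lt_or_ge u (-(1 / 4 + c)) with h | h
    · refine le_max_of_le_right ?_
      rw [iteratedDeriv_eq_pow_mul isOpen_Iio hfl k u h, abs_mul, abs_of_nonneg hck]
      nlinarith [habs u]
    · rcases lt_or_ge (1 / 4 + c) u with h' | h'
      · refine le_max_of_le_right ?_
        rw [iteratedDeriv_eq_pow_mul isOpen_Ioi hfr k u h', abs_mul, abs_pow, abs_neg,
          abs_of_pos (by positivity : (0 : ℝ) < 1 / c)]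
        nlinarith [habs u]
      · exact le_max_of_le_left (hM u ⟨h, h'⟩)
  have hderivF : deriv F = f := funext fun u => (dF u).deriv
  refine ⟨F, Fcdf, ?_, ?_, 1, one_pos, ?_⟩
  · intro u hu
    rw [Fr u hu.1, sP u hu.2]; ring
  · obtain ⟨h2, γ0, γ1⟩ := floor_bounds hβ
    obtain ⟨k, hk⟩ : ∃ k, ⌊β⌋₊ = k + 1 := ⟨⌊β⌋₊ - 1, by omega⟩
    obtain ⟨M₀, hM₀⟩ := bounded k
    obtain ⟨M₁, hM₁⟩ := bounded (k + 1)
    refine ⟨2 * max M₀ M₁, (cF.of_le (by exact_mod_cast le_top)).contDiffOn, ?_⟩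
    intro x _ y _
    have hit : iteratedDeriv ⌊β⌋₊ F = iteratedDeriv k f := by
      rw [hk, iteratedDeriv_succ', hderivF]
    rw [iteratedDerivWithin_univ, hit]
    refine holder_of_bounds (cf.differentiable_iteratedDeriv k (by exact_mod_cast ENat.natCast_lt_top k))
      (fun u => (hM₀ u).trans (le_max_left _ _)) (fun u => ?_) γ0 γ1 x y
    rw [← iteratedDeriv_succ]
    exact (hM₁ u).trans (le_max_right _ _)
  · intro u _
    have h := hasDerivAt_phi dF (df u) (fpos u)
    refine ⟨by rw [hderivF]; exact fpos u, h.differentiableAt, ?_⟩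
    rw [h.deriv]
    -- On the left the density is nondecreasing and `φ' ≥ 2`; on the right the hazard bound keeps
    -- the correction above `-1`.
    rcases le_total u 0 with hu | hu
    · have h1 : 0 ≤ 1 - F u := by
        obtain ⟨ν, -, hν⟩ := Fcdf
        rw [← hν]; exact sub_nonneg.2 (cdf_le_one _ _)
      rw [sr u (by linarith)]
      have : 0 ≤ (1 - F u) * (-(0 * e u) + r (-u) * e (-u)) / f u ^ 2 := by
        have := mul_nonneg (rnn (-u)) (epos (-u)).le
        have : 0 ≤ -(0 * e u) + r (-u) * e (-u) := by linarith
        positivity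
      linarith
    · rw [sr (-u) (by linarith), fr u (by linarith), Fr u (by linarith)]
      have e1 : (1 - (1 / 2 + P u)) * (-(r u * e u) + 0 * e (-u)) / e u ^ 2
          = -(r u * (1 / 2 - P u) / e u) := by
        have := (epos u).ne'
        field_simp
        ring
      have e2 : r u * (1 / 2 - P u) / e u ≤ 1 := (div_le_one (epos u)).2 (hazard u)
      rw [e1]; linarith

end

section

open Filter Topology

/-! ### Sums with at most one nonzero term -/

lemma abs_sum_le_of_subsingleton {ι : Type*} [Fintype ι] {a : ι → ℝ} {M : ℝ} (hM : 0 ≤ M)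
    (hd : ∀ i j, a i ≠ 0 → a j ≠ 0 → i = j) (h : ∀ i, |a i| ≤ M) : |∑ i, a i| ≤ M := by
  by_cases hz : ∃ i, a i ≠ 0
  · obtain ⟨i, hi⟩ := hz
    rw [Finset.sum_eq_single i]
    · exact h i
    · intro j _ hj
      by_contra h0
      exact hj (hd j i h0 hi)
    · simp
  · push Not at hz
    simp [hz, hM]

/-- The nonzero terms of the two sums may have different indices, hence the factor 2. -/
lemma abs_sum_sub_le {ι : Type*} [Fintype ι] {a b : ι → ℝ} {D : ℝ} (hD : 0 ≤ D)
    (ha : ∀ i j, a i ≠ 0 → a j ≠ 0 → i = j) (hb : ∀ i j, b i ≠ 0 → b j ≠ 0 → i = j)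
    (h : ∀ i, |a i - b i| ≤ D) : |∑ i, a i - ∑ i, b i| ≤ 2 * D := by
  classical
  have aux : ∀ {c : ι → ℝ}, (∀ i j, c i ≠ 0 → c j ≠ 0 → i = j) →
      ∑ i, (if c i ≠ 0 then D else 0) ≤ D := by
    intro c hc
    refine (le_abs_self _).trans (abs_sum_le_of_subsingleton hD (fun i j hi hj => ?_) fun i => ?_)
    · refine hc i j ?_ ?_
      · intro h0; simp [h0] at hi
      · intro h0; simp [h0] at hj
    · split_ifs
      · rw [abs_of_nonneg hD]
      · simpa using hD
  rw [← Finset.sum_sub_distrib]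
  calc |∑ i, (a i - b i)| ≤ ∑ i, |a i - b i| := Finset.abs_sum_le_sum_abs _ _
    _ ≤ ∑ i, ((if a i ≠ 0 then D else 0) + if b i ≠ 0 then D else 0) := by
        refine Finset.sum_le_sum fun i _ => ?_
        by_cases h1 : a i ≠ 0
        · rw [if_pos h1]
          have := h i
          split_ifs <;> linarith
        · by_cases h2 : b i ≠ 0
          · rw [if_pos h2, if_neg h1]
            linarith [h i]
          · push Not at h1 h2
            simp [h1, h2]
    _ ≤ 2 * D := by
        rw [Finset.sum_add_distrib, two_mul]
        exact add_le_add (aux ha) (aux hb)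

/-! ### Bumps -/

/-- By continuity the derivatives vanish at `±1/4` too, so only open cells matter and endpoints
shared by neighbouring cells do no harm. -/
lemma IsBump.iteratedDeriv_eq_zero {V : ℝ → ℝ} (hV : IsBump V) (k : ℕ) {z : ℝ}
    (hz : z ∉ Ioo (-(1 / 4) : ℝ) (1 / 4)) : iteratedDeriv k V z = 0 := by
  have hcont : Continuous (iteratedDeriv k V) :=
    hV.smooth.continuous_iteratedDeriv k (by exact_mod_cast le_top)
  have h0 : ∀ u, u ∉ Icc (-(1 / 4) : ℝ) (1 / 4) → iteratedDeriv k V u = 0 := by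
    intro u hu
    have : V =ᶠ[𝓝 u] fun _ => 0 :=
      eventually_of_mem (isClosed_Icc.isOpen_compl.mem_nhds hu) fun v hv => by
        by_contra h
        exact hv (hV.support h)
    rw [this.iteratedDeriv_eq k]; simp
  have hcl : closure (Icc (-(1 / 4) : ℝ) (1 / 4))ᶜ = (Ioo (-(1 / 4) : ℝ) (1 / 4))ᶜ := by
    rw [closure_compl, interior_Icc]
  have hsub : closure (Icc (-(1 / 4) : ℝ) (1 / 4))ᶜ ⊆ {u | iteratedDeriv k V u = 0} :=
    closure_minimal h0 (isClosed_eq hcont continuous_const)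
  rw [hcl] at hsub
  exact hsub hz

lemma IsBump.exists_bound {V : ℝ → ℝ} (hV : IsBump V) (n : ℕ) :
    ∃ M, 1 ≤ M ∧ ∀ k ≤ n, ∀ z, |iteratedDeriv k V z| ≤ M := by
  have hk : ∀ k, ∃ M, ∀ z, |iteratedDeriv k V z| ≤ M := by
    intro k
    have hcont : Continuous (iteratedDeriv k V) :=
      hV.smooth.continuous_iteratedDeriv k (by exact_mod_cast le_top)
    obtain ⟨M, hM⟩ := (isCompact_Icc (a := (-(1 / 4) : ℝ)) (b := 1 / 4)).exists_bound_of_continuousOn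
      hcont.continuousOn
    refine ⟨max M 0, fun z => ?_⟩
    by_cases hz : z ∈ Ioo (-(1 / 4) : ℝ) (1 / 4)
    · exact le_max_of_le_left (hM z (Ioo_subset_Icc_self hz))
    · rw [hV.iteratedDeriv_eq_zero k hz]; simp
  induction n with
  | zero =>
    obtain ⟨M, hM⟩ := hk 0
    refine ⟨max 1 M, le_max_left _ _, fun k hk z => ?_⟩
    obtain rfl : k = 0 := by omega
    exact (hM z).trans (le_max_right _ _)
  | succ n ih =>
    obtain ⟨M, h1, hM⟩ := ih
    obtain ⟨M', hM'⟩ := hk (n + 1)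
    refine ⟨max M M', h1.trans (le_max_left _ _), fun k hk z => ?_⟩
    rcases Nat.lt_or_ge k (n + 1) with h | h
    · exact (hM k (by omega) z).trans (le_max_left _ _)
    · obtain rfl : k = n + 1 := by omega
      exact (hM' z).trans (le_max_right _ _)

/-- The coordinate of `u` relative to the `j`-th cell. -/
def cellCoord (N : ℕ) (j : Fin N) (u : ℝ) : ℝ := (u - cellMid N j) / (1 / (N : ℝ))

lemma cellCoord_eq (N : ℕ) (j : Fin N) (u : ℝ) : cellCoord N j u = N * (u - cellMid N j) := by
  unfold cellCoord; rw [div_div_eq_mul_div, div_one, mul_comm]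

lemma cellCoord_formula {N : ℕ} (hN : 1 ≤ N) (j : Fin N) (u : ℝ) :
    cellCoord N j u = N * (u + 1 / 4) - ((j : ℝ) + 1 / 2) / 2 := by
  have : (N : ℝ) ≠ 0 := by positivity
  rw [cellCoord_eq, cellMid]
  field_simp
  ring

lemma cellCoord_inj {N : ℕ} (hN : 1 ≤ N) {i j : Fin N} {u : ℝ}
    (hi : cellCoord N i u ∈ Ioo (-(1 / 4) : ℝ) (1 / 4))
    (hj : cellCoord N j u ∈ Ioo (-(1 / 4) : ℝ) (1 / 4)) : i = j := by
  rw [cellCoord_formula hN] at hi hj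
  have h1 : ((i : ℕ) : ℝ) < (j : ℕ) + 1 := by linarith [hi.1, hj.2]
  have h2 : ((j : ℕ) : ℝ) < (i : ℕ) + 1 := by linarith [hi.2, hj.1]
  have h1' : (i : ℕ) < j + 1 := by exact_mod_cast h1
  have h2' : (j : ℕ) < i + 1 := by exact_mod_cast h2
  exact Fin.ext (by omega)

lemma mem_of_cellCoord_mem {N : ℕ} (hN : 1 ≤ N) {j : Fin N} {u : ℝ}
    (hj : cellCoord N j u ∈ Ioo (-(1 / 4) : ℝ) (1 / 4)) : u ∈ Ioo (-(1 / 4) : ℝ) (1 / 4) := by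
  rw [cellCoord_formula hN] at hj
  have h0 : (0 : ℝ) < N := by positivity
  have h1 : (0 : ℝ) ≤ (j : ℕ) := by positivity
  have h2 : ((j : ℕ) : ℝ) + 1 ≤ N := by exact_mod_cast j.2
  constructor
  · have : 0 < N * (u + 1 / 4) := by linarith [hj.1]
    have := pos_of_mul_pos_right this h0.le
    linarith
  · have : (N : ℝ) * (u + 1 / 4) < N * (1 / 2) := by linarith [hj.2]
    have := lt_of_mul_lt_mul_left this h0.le
    linarith

/-- The `j`-th term of the `k`-th derivative of the perturbation. -/
def bumpTerm (β ρ : ℝ) (V : ℝ → ℝ) (N : ℕ) (ι : Fin N → Bool) (k : ℕ) (u : ℝ) (j : Fin N) : ℝ :=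
  (if ι j then 1 else 0) * ρ * (1 / (N : ℝ)) ^ β *
    ((N : ℝ) ^ k * iteratedDeriv k V (cellCoord N j u))

/-- The `k`-th derivative of the perturbation. -/
def bumpDeriv (β ρ : ℝ) (V : ℝ → ℝ) (N : ℕ) (ι : Fin N → Bool) (k : ℕ) (u : ℝ) : ℝ :=
  ∑ j, bumpTerm β ρ V N ι k u j

section

variable {β ρ : ℝ} {V : ℝ → ℝ} {N : ℕ} {ι : Fin N → Bool}

lemma bumpCDF_eq (F₀ : ℝ → ℝ) (u : ℝ) :
    bumpCDF β ρ V F₀ N ι u = F₀ u + bumpDeriv β ρ V N ι 0 u := by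
  simp [bumpCDF, bumpDeriv, bumpTerm, cellCoord]

lemma hasDerivAt_bumpTerm (hV : IsBump V) (k : ℕ) (j : Fin N) (u : ℝ) :
    HasDerivAt (fun u => bumpTerm β ρ V N ι k u j) (bumpTerm β ρ V N ι (k + 1) u j) u := by
  have hd : Differentiable ℝ (iteratedDeriv k V) :=
    hV.smooth.differentiable_iteratedDeriv k (by exact_mod_cast ENat.natCast_lt_top k)
  have hc : HasDerivAt (cellCoord N j) (N : ℝ) u := by
    rw [show cellCoord N j = fun u => N * (u - cellMid N j) from funext (cellCoord_eq N j)]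
    simpa using ((hasDerivAt_id u).sub_const (cellMid N j)).const_mul (N : ℝ)
  have h := (((hd _).hasDerivAt.comp u hc).const_mul ((N : ℝ) ^ k)).const_mul
    ((if ι j then 1 else 0) * ρ * (1 / (N : ℝ)) ^ β)
  refine h.congr_deriv ?_
  rw [bumpTerm, iteratedDeriv_succ]; ring

lemma hasDerivAt_bumpDeriv (hV : IsBump V) (k : ℕ) (u : ℝ) :
    HasDerivAt (bumpDeriv β ρ V N ι k) (bumpDeriv β ρ V N ι (k + 1) u) u := by
  unfold bumpDeriv
  exact HasDerivAt.fun_sum fun j _ => hasDerivAt_bumpTerm hV k j u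

lemma iteratedDeriv_bumpDeriv (hV : IsBump V) (k : ℕ) :
    iteratedDeriv k (bumpDeriv β ρ V N ι 0) = bumpDeriv β ρ V N ι k := by
  induction k with
  | zero => simp
  | succ k ih =>
    rw [iteratedDeriv_succ, ih]
    exact funext fun u => (hasDerivAt_bumpDeriv hV k u).deriv

lemma contDiff_bumpDeriv (hV : IsBump V) : ContDiff ℝ ∞ (bumpDeriv β ρ V N ι 0) :=
  contDiff_of_differentiable_iteratedDeriv fun m _ => by
    rw [iteratedDeriv_bumpDeriv hV]
    exact fun u => (hasDerivAt_bumpDeriv hV m u).differentiableAt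

lemma bumpTerm_ne_zero (hV : IsBump V) {k : ℕ} {u : ℝ} {j : Fin N}
    (h : bumpTerm β ρ V N ι k u j ≠ 0) : cellCoord N j u ∈ Ioo (-(1 / 4) : ℝ) (1 / 4) := by
  by_contra hz
  exact h (by rw [bumpTerm, hV.iteratedDeriv_eq_zero k hz]; ring)

lemma bumpTerm_inj (hV : IsBump V) (hN : 1 ≤ N) {k : ℕ} {u : ℝ} (i j : Fin N)
    (hi : bumpTerm β ρ V N ι k u i ≠ 0) (hj : bumpTerm β ρ V N ι k u j ≠ 0) : i = j :=
  cellCoord_inj hN (bumpTerm_ne_zero hV hi) (bumpTerm_ne_zero hV hj)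

lemma bumpDeriv_eq_zero (hV : IsBump V) (hN : 1 ≤ N) (k : ℕ) {u : ℝ}
    (hu : u ∉ Ioo (-(1 / 4) : ℝ) (1 / 4)) : bumpDeriv β ρ V N ι k u = 0 :=
  Finset.sum_eq_zero fun j _ => by
    by_contra h
    exact hu (mem_of_cellCoord_mem hN (bumpTerm_ne_zero hV h))

lemma bumpDeriv_eq_single (hV : IsBump V) (hN : 1 ≤ N) (k : ℕ) {u : ℝ} {j : Fin N}
    (hj : cellCoord N j u ∈ Ioo (-(1 / 4) : ℝ) (1 / 4)) :
    bumpDeriv β ρ V N ι k u = bumpTerm β ρ V N ι k u j :=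
  Finset.sum_eq_single j (fun i _ hi => by
    by_contra h
    exact hi (cellCoord_inj hN (bumpTerm_ne_zero hV h) hj)) (by simp)

/-- The amplitude `h^β` compensates the factor `N^k` from rescaling, which bounds the derivatives up
to order `β` uniformly in `N`. -/
lemma rpow_scale_le (hN : 1 ≤ N) {k : ℕ} (hk : (k : ℝ) ≤ β) :
    (1 / (N : ℝ)) ^ β * (N : ℝ) ^ k ≤ 1 := by
  have h1 : (1 : ℝ) ≤ N := by exact_mod_cast hN
  rw [one_div, Real.inv_rpow (by positivity), inv_mul_le_iff₀ (by positivity), mul_one,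
    ← Real.rpow_natCast]
  exact Real.rpow_le_rpow_of_exponent_le h1 hk

lemma abs_bumpDeriv_le (hV : IsBump V) (hρ : 0 ≤ ρ) (hN : 1 ≤ N) {k : ℕ}
    (hk : (k : ℝ) ≤ β) {M : ℝ} (hM : ∀ z, |iteratedDeriv k V z| ≤ M) (u : ℝ) :
    |bumpDeriv β ρ V N ι k u| ≤ ρ * M := by
  have hM0 : 0 ≤ M := (abs_nonneg _).trans (hM 0)
  refine abs_sum_le_of_subsingleton (by positivity) (bumpTerm_inj hV hN) fun j => ?_
  have hs := rpow_scale_le hN hk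
  have hn : 0 ≤ (1 / (N : ℝ)) ^ β * (N : ℝ) ^ k := by positivity
  have hi : |(if ι j then (1 : ℝ) else 0)| ≤ 1 := by split_ifs <;> simp
  have e : bumpTerm β ρ V N ι k u j = (if ι j then 1 else 0) *
      (((1 / (N : ℝ)) ^ β * (N : ℝ) ^ k) * (ρ * iteratedDeriv k V (cellCoord N j u))) := by
    rw [bumpTerm]; ring
  rw [e, abs_mul, abs_mul ((1 / (N : ℝ)) ^ β * (N : ℝ) ^ k), abs_of_nonneg hn, abs_mul ρ,
    abs_of_nonneg hρ]
  calc _ ≤ 1 * (1 * (ρ * M)) := by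
        gcongr
        exact hM _
    _ = ρ * M := by ring

/-- Rescaling the Hölder bound of `V` yields `N^(β-q)`, which cancels `h^β N^q` exactly. One factor
2 comes from `holder_of_bounds`, the other from points in different cells. -/
lemma holder_bumpDeriv (hV : IsBump V) (hβ : 2 ≤ β) (hρ : 0 ≤ ρ) (hN : 1 ≤ N) {M : ℝ}
    (h0 : ∀ z, |iteratedDeriv ⌊β⌋₊ V z| ≤ M) (h1 : ∀ z, |iteratedDeriv (⌊β⌋₊ + 1) V z| ≤ M)
    (x y : ℝ) : |bumpDeriv β ρ V N ι ⌊β⌋₊ x - bumpDeriv β ρ V N ι ⌊β⌋₊ y|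
      ≤ 4 * (ρ * M) * |x - y| ^ (β - (⌊β⌋₊ : ℝ)) := by
  obtain ⟨h2, γ0, γ1⟩ := floor_bounds hβ
  have hM0 : 0 ≤ M := (abs_nonneg _).trans (h0 0)
  have hN0 : (0 : ℝ) < N := by positivity
  have hd : Differentiable ℝ (iteratedDeriv ⌊β⌋₊ V) :=
    hV.smooth.differentiable_iteratedDeriv _ (by exact_mod_cast ENat.natCast_lt_top _)
  have key : ∀ j, |bumpTerm β ρ V N ι ⌊β⌋₊ x j - bumpTerm β ρ V N ι ⌊β⌋₊ y j|
      ≤ 2 * (ρ * M) * |x - y| ^ (β - (⌊β⌋₊ : ℝ)) := by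
    intro j
    have hh := holder_of_bounds hd h0 (fun u => by rw [← iteratedDeriv_succ]; exact h1 u) γ0 γ1
      (cellCoord N j x) (cellCoord N j y)
    have hz : |cellCoord N j x - cellCoord N j y| = N * |x - y| := by
      rw [cellCoord_eq, cellCoord_eq, ← mul_sub, abs_mul, abs_of_pos hN0]
      congr 2; ring
    rw [hz, Real.mul_rpow hN0.le (abs_nonneg _)] at hh
    have e : bumpTerm β ρ V N ι ⌊β⌋₊ x j - bumpTerm β ρ V N ι ⌊β⌋₊ y j
        = (if ι j then 1 else 0) * (((1 / (N : ℝ)) ^ β * (N : ℝ) ^ ⌊β⌋₊) *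
          (ρ * (iteratedDeriv ⌊β⌋₊ V (cellCoord N j x)
            - iteratedDeriv ⌊β⌋₊ V (cellCoord N j y)))) := by
      rw [bumpTerm, bumpTerm]; ring
    have hi : |(if ι j then (1 : ℝ) else 0)| ≤ 1 := by split_ifs <;> simp
    have hn : 0 ≤ (1 / (N : ℝ)) ^ β * (N : ℝ) ^ ⌊β⌋₊ := by positivity
    have hs : (1 / (N : ℝ)) ^ β * (N : ℝ) ^ ⌊β⌋₊ * (N : ℝ) ^ (β - (⌊β⌋₊ : ℝ)) = 1 := by
      rw [mul_assoc, ← Real.rpow_natCast, ← Real.rpow_add hN0, one_div, Real.inv_rpow hN0.le,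
        add_sub_cancel, inv_mul_cancel₀ (by positivity)]
    rw [e, abs_mul, abs_mul ((1 / (N : ℝ)) ^ β * (N : ℝ) ^ ⌊β⌋₊), abs_of_nonneg hn, abs_mul ρ,
      abs_of_nonneg hρ]
    calc _ ≤ 1 * (((1 / (N : ℝ)) ^ β * (N : ℝ) ^ ⌊β⌋₊) * (ρ * (2 * M *
          ((N : ℝ) ^ (β - (⌊β⌋₊ : ℝ)) * |x - y| ^ (β - (⌊β⌋₊ : ℝ)))))) := by gcongr
      _ = ((1 / (N : ℝ)) ^ β * (N : ℝ) ^ ⌊β⌋₊ * (N : ℝ) ^ (β - (⌊β⌋₊ : ℝ))) *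
          (2 * (ρ * M) * |x - y| ^ (β - (⌊β⌋₊ : ℝ))) := by ring
      _ = _ := by rw [hs, one_mul]
  have := abs_sum_sub_le (by positivity) (bumpTerm_inj (β := β) (ρ := ρ) (ι := ι) hV hN)
    (bumpTerm_inj (β := β) (ρ := ρ) (ι := ι) hV hN) key
  refine this.trans (le_of_eq ?_)
  ring

end

/-! ### Baselines -/

section

variable {β : ℝ} {F₀ : ℝ → ℝ} (hF₀ : IsBaseline β F₀)

include hF₀

lemma IsBaseline.contDiff : ContDiff ℝ ⌊β⌋₊ F₀ := by
  obtain ⟨C, hC⟩ := hF₀.smooth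
  exact contDiffOn_univ.1 hC.1

lemma IsBaseline.contDiff_two (hβ : 2 ≤ β) : ContDiff ℝ 2 F₀ :=
  hF₀.contDiff.of_le (by exact_mod_cast (floor_bounds hβ).1)

lemma IsBaseline.hasDerivAt (hβ : 2 ≤ β) (u : ℝ) : HasDerivAt F₀ (deriv F₀ u) u :=
  ((hF₀.contDiff_two hβ).differentiable (by norm_num) u).hasDerivAt

lemma IsBaseline.contDiff_deriv (hβ : 2 ≤ β) : ContDiff ℝ 1 (deriv F₀) := by
  have h := hF₀.contDiff_two hβ
  rw [show (2 : WithTop ℕ∞) = 1 + 1 by norm_num, contDiff_succ_iff_deriv] at h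
  exact h.2.2

lemma IsBaseline.hasDerivAt_deriv (hβ : 2 ≤ β) (u : ℝ) :
    HasDerivAt (deriv F₀) (deriv (deriv F₀) u) u :=
  ((hF₀.contDiff_deriv hβ).differentiable (by norm_num) u).hasDerivAt

lemma IsBaseline.deriv_pos (u : ℝ) : 0 < deriv F₀ u := by
  obtain ⟨c, -, h⟩ := hF₀.incr
  exact (h u (mem_univ u)).1

lemma IsBaseline.deriv_eq (hβ : 2 ≤ β) {u : ℝ} (hu : u ∈ Icc (-(1 / 4) : ℝ) (1 / 4)) :
    deriv F₀ u = 1 := by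
  have ho : ∀ v ∈ Ioo (-(1 / 4) : ℝ) (1 / 4), deriv F₀ v = 1 := by
    intro v hv
    have : F₀ =ᶠ[𝓝 v] fun u => u + 1 / 2 :=
      eventually_of_mem (isOpen_Ioo.mem_nhds hv) fun w hw =>
        hF₀.eq_on w (Ioo_subset_Icc_self hw)
    rw [this.deriv_eq]; simp
  have hcl : closure (Ioo (-(1 / 4) : ℝ) (1 / 4)) ⊆ {v | deriv F₀ v = 1} :=
    closure_minimal ho (isClosed_eq (hF₀.contDiff_deriv hβ).continuous continuous_const)
  rw [closure_Ioo (by norm_num)] at hcl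
  exact hcl hu

lemma IsBaseline.deriv_deriv_eq (hβ : 2 ≤ β) {u : ℝ} (hu : u ∈ Icc (-(1 / 4) : ℝ) (1 / 4)) :
    deriv (deriv F₀) u = 0 := by
  have ho : ∀ v ∈ Ioo (-(1 / 4) : ℝ) (1 / 4), deriv (deriv F₀) v = 0 := by
    intro v hv
    have : deriv F₀ =ᶠ[𝓝 v] fun _ => 1 :=
      eventually_of_mem (isOpen_Ioo.mem_nhds hv) fun w hw =>
        hF₀.deriv_eq hβ (Ioo_subset_Icc_self hw)
    rw [this.deriv_eq]; simp
  have hcl : closure (Ioo (-(1 / 4) : ℝ) (1 / 4)) ⊆ {v | deriv (deriv F₀) v = 0} :=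
    closure_minimal ho (isClosed_eq ((hF₀.contDiff_deriv hβ).continuous_deriv le_rfl)
      continuous_const)
  rw [closure_Ioo (by norm_num)] at hcl
  exact hcl hu

end

/-! ### Perturbed baselines -/

section

variable {β ρ : ℝ} {V F₀ : ℝ → ℝ} {N : ℕ} {ι : Fin N → Bool} (hβ : 2 ≤ β) (hF₀ : IsBaseline β F₀)
  (hV : IsBump V)

include hβ hF₀ hV

lemma hasDerivAt_bumpCDF (u : ℝ) : HasDerivAt (bumpCDF β ρ V F₀ N ι)
    (deriv F₀ u + bumpDeriv β ρ V N ι 1 u) u := by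
  rw [show bumpCDF β ρ V F₀ N ι = fun u => F₀ u + bumpDeriv β ρ V N ι 0 u from
    funext (bumpCDF_eq F₀)]
  exact (hF₀.hasDerivAt hβ u).add (hasDerivAt_bumpDeriv hV 0 u)

lemma hasDerivAt_deriv_bumpCDF (u : ℝ) : HasDerivAt
    (fun u => deriv F₀ u + bumpDeriv β ρ V N ι 1 u)
    (deriv (deriv F₀) u + bumpDeriv β ρ V N ι 2 u) u :=
  (hF₀.hasDerivAt_deriv hβ u).add (hasDerivAt_bumpDeriv hV 1 u)

lemma betaSmoothOn_bumpCDF {C M : ℝ} (hC : BetaSmoothOn β C F₀ univ) (hρ : 0 ≤ ρ) (hN : 1 ≤ N)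
    (h0 : ∀ z, |iteratedDeriv ⌊β⌋₊ V z| ≤ M) (h1 : ∀ z, |iteratedDeriv (⌊β⌋₊ + 1) V z| ≤ M) :
    BetaSmoothOn β (C + 4 * (ρ * M)) (bumpCDF β ρ V F₀ N ι) univ := by
  have e : bumpCDF β ρ V F₀ N ι = F₀ + bumpDeriv β ρ V N ι 0 := funext (bumpCDF_eq F₀)
  have c1 := hF₀.contDiff
  have c2 : ContDiff ℝ ⌊β⌋₊ (bumpDeriv β ρ V N ι 0) :=
    (contDiff_bumpDeriv hV).of_le (by exact_mod_cast le_top)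
  refine ⟨by rw [e]; exact (c1.add c2).contDiffOn, fun x _ y _ => ?_⟩
  rw [iteratedDerivWithin_univ, e, iteratedDeriv_add c1.contDiffAt c2.contDiffAt,
    iteratedDeriv_add c1.contDiffAt c2.contDiffAt, iteratedDeriv_bumpDeriv hV, add_sub_add_comm,
    add_mul]
  have := hC.2 x (mem_univ x) y (mem_univ y)
  rw [iteratedDerivWithin_univ] at this
  exact (abs_add_le _ _).trans (add_le_add this (holder_bumpDeriv hV hβ hρ hN h0 h1 x y))

variable (hρ : 0 ≤ ρ) (hN : 1 ≤ N) {M : ℝ} (hM : ∀ k ≤ 2, ∀ z, |iteratedDeriv k V z| ≤ M)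
  (hρM : ρ * M ≤ 1 / 64)

include hρ hN hM hρM

lemma abs_bumpDeriv_le_const {k : ℕ} (hk : k ≤ 2) (u : ℝ) :
    |bumpDeriv β ρ V N ι k u| ≤ 1 / 64 := by
  refine (abs_bumpDeriv_le hV hρ hN ?_ (hM k hk) u).trans hρM
  have : (k : ℝ) ≤ 2 := by exact_mod_cast hk
  linarith

/-- Inside `(-1/4, 1/4)` the baseline density is 1 and the perturbation is at most `1/64`; outside,
the perturbation vanishes. The same split is used for `φ`. -/
lemma deriv_bumpCDF_pos (u : ℝ) : 0 < deriv F₀ u + bumpDeriv β ρ V N ι 1 u := by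
  by_cases hu : u ∈ Ioo (-(1 / 4) : ℝ) (1 / 4)
  · rw [hF₀.deriv_eq hβ (Ioo_subset_Icc_self hu)]
    have := (abs_le.1 (abs_bumpDeriv_le_const (ι := ι) hβ hF₀ hV hρ hN hM hρM (k := 1)
      (by norm_num) u)).1
    linarith
  · rw [bumpDeriv_eq_zero hV hN 1 hu, add_zero]
    exact hF₀.deriv_pos u

lemma isCDF_bumpCDF : IsCDF (bumpCDF β ρ V F₀ N ι) := by
  have hd := hasDerivAt_bumpCDF (ρ := ρ) (ι := ι) hβ hF₀ hV
  obtain ⟨ν, hν, h⟩ := hF₀.isCDF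
  have hF : (cdf ν : ℝ → ℝ) = F₀ := funext h
  refine isCDF_of_monotone ?_ (continuous_iff_continuousAt.2 fun u => (hd u).continuousAt) ?_ ?_
  · exact monotone_of_deriv_nonneg (fun u => (hd u).differentiableAt) fun u => by
      rw [(hd u).deriv]; exact (deriv_bumpCDF_pos hβ hF₀ hV hρ hN hM hρM u).le
  · have ht := tendsto_cdf_atBot ν
    rw [hF] at ht
    refine ht.congr' ?_
    filter_upwards [eventually_le_atBot (-(1 / 4))] with u hu
    rw [bumpCDF_eq, bumpDeriv_eq_zero hV hN 0 fun h => by linarith [h.1], add_zero]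
  · have ht := tendsto_cdf_atTop ν
    rw [hF] at ht
    refine ht.congr' ?_
    filter_upwards [eventually_ge_atTop (1 / 4)] with u hu
    rw [bumpCDF_eq, bumpDeriv_eq_zero hV hN 0 fun h => by linarith [h.2], add_zero]

lemma hasDerivAt_phi_bumpCDF (u : ℝ) : HasDerivAt (phi (bumpCDF β ρ V F₀ N ι))
    (2 + (1 - bumpCDF β ρ V F₀ N ι u) * (deriv (deriv F₀) u + bumpDeriv β ρ V N ι 2 u)
      / (deriv F₀ u + bumpDeriv β ρ V N ι 1 u) ^ 2) u :=
  hasDerivAt_phi (hasDerivAt_bumpCDF hβ hF₀ hV) (hasDerivAt_deriv_bumpCDF hβ hF₀ hV u)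
    (deriv_bumpCDF_pos hβ hF₀ hV hρ hN hM hρM u)

/-- On the plateau the baseline has `φ' = 2`, and the perturbation changes this by at most 1. -/
lemma deriv_phi_bumpCDF_mem {u : ℝ} (hu : u ∈ Icc (-(1 / 4) : ℝ) (1 / 4)) :
    deriv (phi (bumpCDF β ρ V F₀ N ι)) u ∈ Icc (1 : ℝ) 3 := by
  rw [(hasDerivAt_phi_bumpCDF hβ hF₀ hV hρ hN hM hρM u).deriv, hF₀.deriv_eq hβ hu,
    hF₀.deriv_deriv_eq hβ hu, zero_add]
  obtain ⟨ν, -, hν⟩ := isCDF_bumpCDF (ι := ι) hβ hF₀ hV hρ hN hM hρM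
  have c0 := cdf_nonneg ν u
  have c1 := cdf_le_one ν u
  rw [hν] at c0 c1
  have b1 := abs_le.1 (abs_bumpDeriv_le_const (ι := ι) hβ hF₀ hV hρ hN hM hρM (k := 1)
      (by norm_num) u)
  have b2 := abs_bumpDeriv_le_const (ι := ι) hβ hF₀ hV hρ hN hM hρM (k := 2) le_rfl u
  have hq : |(1 - bumpCDF β ρ V F₀ N ι u) * bumpDeriv β ρ V N ι 2 u
      / (1 + bumpDeriv β ρ V N ι 1 u) ^ 2| ≤ 1 := by
    have hden : 1 / 4 ≤ (1 + bumpDeriv β ρ V N ι 1 u) ^ 2 := by nlinarith [b1.1]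
    rw [abs_div, abs_mul, abs_of_nonneg (sub_nonneg.2 c1),
      abs_of_nonneg (sq_nonneg (1 + bumpDeriv β ρ V N ι 1 u)),
      div_le_one (by linarith)]
    nlinarith [abs_nonneg (bumpDeriv β ρ V N ι 2 u)]
  have := abs_le.1 hq
  constructor <;> linarith

lemma transformIncreasingOn_bumpCDF {c : ℝ} (hc : TransformIncreasingOn c F₀ univ) :
    TransformIncreasingOn (min 1 c) (bumpCDF β ρ V F₀ N ι) univ := by
  intro u _
  have hp := hasDerivAt_phi_bumpCDF (ι := ι) hβ hF₀ hV hρ hN hM hρM u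
  refine ⟨?_, hp.differentiableAt, ?_⟩
  · rw [(hasDerivAt_bumpCDF hβ hF₀ hV u).deriv]
    exact deriv_bumpCDF_pos hβ hF₀ hV hρ hN hM hρM u
  · by_cases hu : u ∈ Ioo (-(1 / 4) : ℝ) (1 / 4)
    · exact (min_le_left _ _).trans
        (deriv_phi_bumpCDF_mem hβ hF₀ hV hρ hN hM hρM (Ioo_subset_Icc_self hu)).1
    · refine (min_le_right _ _).trans ?_
      rw [hp.deriv, bumpCDF_eq, bumpDeriv_eq_zero hV hN 0 hu, bumpDeriv_eq_zero hV hN 1 hu,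
        bumpDeriv_eq_zero hV hN 2 hu, add_zero, add_zero, add_zero]
      have h0 := hasDerivAt_phi (hF₀.hasDerivAt hβ) (hF₀.hasDerivAt_deriv hβ u) (hF₀.deriv_pos u)
      rw [← h0.deriv]
      exact (hc u (mem_univ u)).2.2

end

end

section

open Filter Topology

/-! ### Quadratic loss around the optimal price -/

/-- The derivative of the revenue at `p` is `-f(p - x)(φ(p - x) + x)`, so `φ(q - x) = -x` is the
first-order condition, and the slope of `φ` times the density provides curvature. -/
lemma quadratic_loss {F f : ℝ → ℝ} {a c : ℝ} (hF : ∀ u, HasDerivAt F (f u) u)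
    (ha : ∀ u ∈ Icc (-(1 / 4) : ℝ) 1, a ≤ f u) (ha0 : 0 < a) (hc : 0 < c)
    (hφ : Differentiable ℝ (phi F)) (hφ' : ∀ u, c ≤ deriv (phi F) u)
    {x p q : ℝ} (hx : x ∈ Icc (-(1 / 4) : ℝ) (1 / 4)) (hp : p ∈ prices) (hq : q ∈ prices)
    (hopt : phi F (q - x) = -x) :
    a * c / 2 * (p - q) ^ 2 ≤ q * (1 - F (q - x)) - p * (1 - F (p - x)) := by
  -- Revenue plus the claimed quadratic gain; it suffices that `g` increases up to `q` and decreases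
  -- after it.
  set g : ℝ → ℝ := fun p => p * (1 - F (p - x)) + a * c / 2 * (p - q) ^ 2 with hg
  have hmem : ∀ v ∈ Icc (1 / 8 : ℝ) (7 / 16), v - x ∈ Icc (-(1 / 4) : ℝ) 1 := fun v hv =>
    ⟨by linarith [hv.1, hx.2], by linarith [hv.2, hx.1]⟩
  have hphi : ∀ v ∈ Icc (1 / 8 : ℝ) (7 / 16),
      1 - F (v - x) - v * f (v - x) = -(f (v - x) * (phi F (v - x) - phi F (q - x))) := by
    intro v hv
    have h0 : f (v - x) ≠ 0 := (ha0.trans_le (ha _ (hmem v hv))).ne'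
    rw [hopt, phi, (hF _).deriv]
    field_simp
    ring
  have hd : ∀ v, HasDerivAt g (1 - F (v - x) - v * f (v - x) + a * c * (v - q)) v := by
    intro v
    have h1 : HasDerivAt (fun v => F (v - x)) (f (v - x)) v := by
      simpa using (hF (v - x)).comp_sub_const v x
    have h2 := ((hasDerivAt_id v).mul (h1.const_sub 1)).add
      ((((hasDerivAt_id v).sub_const q).pow 2).const_mul (a * c / 2))
    refine h2.congr_deriv ?_
    simp
    ring
  have hcont : Continuous g := continuous_iff_continuousAt.2 fun v => (hd v).continuousAt
  have hslope : ∀ {v w : ℝ}, v ≤ w → c * (w - v) ≤ phi F w - phi F v := fun h =>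
    mul_sub_le_image_sub_of_le_deriv hφ hφ' h
  have hgq : g q = q * (1 - F (q - x)) := by simp [hg]
  have hle : g p ≤ g q := by
    rcases le_total q p with h | h
    · have : AntitoneOn g (Icc q p) := by
        refine antitoneOn_of_deriv_nonpos (convex_Icc _ _) hcont.continuousOn
          (fun v _ => (hd v).differentiableAt.differentiableWithinAt) fun v hv => ?_
        rw [interior_Icc] at hv
        have hv' : v ∈ Icc (1 / 8 : ℝ) (7 / 16) := ⟨hq.1.trans hv.1.le, hv.2.le.trans hp.2⟩
        rw [(hd v).deriv, hphi v hv']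
        have h1 := hslope (v := q - x) (w := v - x) (by linarith [hv.1])
        have h2 := ha _ (hmem v hv')
        have h3 : c * (v - x - (q - x)) = c * (v - q) := by ring
        rw [h3] at h1
        have h4 : 0 ≤ c * (v - q) := mul_nonneg hc.le (by linarith [hv.1])
        have := mul_le_mul h2 h1 h4 (ha0.le.trans h2)
        linarith
      exact this (left_mem_Icc.2 h) (right_mem_Icc.2 h) h
    · have : MonotoneOn g (Icc p q) := by
        refine monotoneOn_of_deriv_nonneg (convex_Icc _ _) hcont.continuousOn
          (fun v _ => (hd v).differentiableAt.differentiableWithinAt) fun v hv => ?_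
        rw [interior_Icc] at hv
        have hv' : v ∈ Icc (1 / 8 : ℝ) (7 / 16) := ⟨hp.1.trans hv.1.le, hv.2.le.trans hq.2⟩
        rw [(hd v).deriv, hphi v hv']
        have h1 := hslope (v := v - x) (w := q - x) (by linarith [hv.2])
        have h2 := ha _ (hmem v hv')
        have h3 : c * (q - x - (v - x)) = c * (q - v) := by ring
        rw [h3] at h1
        have h4 : 0 ≤ c * (q - v) := mul_nonneg hc.le (by linarith [hv.2])
        have := mul_le_mul h2 h1 h4 (ha0.le.trans h2)
        linarith
      exact this (left_mem_Icc.2 h) (right_mem_Icc.2 h) h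
  rw [hgq] at hle
  simp only [hg] at hle
  linarith

/-- The interval contains `p - x` for all admissible prices and `|x| ≤ 1/4`. The cap `1/2` keeps `a`
valid for the perturbed density on the plateau. -/
lemma IsBaseline.exists_deriv_lower {β : ℝ} {F₀ : ℝ → ℝ} (hF₀ : IsBaseline β F₀) (hβ : 2 ≤ β) :
    ∃ a, 0 < a ∧ a ≤ 1 / 2 ∧ ∀ u ∈ Icc (-(1 / 4) : ℝ) 1, a ≤ deriv F₀ u := by
  obtain ⟨v, hv, hmin⟩ := (isCompact_Icc (a := (-(1 / 4) : ℝ)) (b := 1)).exists_isMinOn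
    ⟨0, by norm_num, by norm_num⟩ (hF₀.contDiff_deriv hβ).continuous.continuousOn
  exact ⟨min (deriv F₀ v) (1 / 2), lt_min (hF₀.deriv_pos v) (by norm_num), min_le_right _ _,
    fun u hu => (min_le_left _ _).trans (hmin hu)⟩

/-- A nonzero function of compact support is not constant. The derivative of `V` is what counts,
since its effect on the optimal price exceeds that of `V` by a factor `N`. -/
lemma IsBump.exists_deriv_lower {V : ℝ → ℝ} (hV : IsBump V) : ∃ z₁ z₂ v : ℝ, z₁ < z₂ ∧ 0 < v ∧
    ∀ z ∈ Icc z₁ z₂, z ∈ Ioo (-(1 / 4) : ℝ) (1 / 4) ∧ v ≤ |iteratedDeriv 1 V z| := by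
  have hcont : Continuous (iteratedDeriv 1 V) :=
    hV.smooth.continuous_iteratedDeriv 1 (by exact_mod_cast le_top)
  have hex : ∃ z, iteratedDeriv 1 V z ≠ 0 := by
    by_contra! h
    obtain ⟨u, hu⟩ := hV.ne_zero
    have hc := is_const_of_deriv_eq_zero (hV.smooth.differentiable (by norm_num))
      (fun x => by rw [← iteratedDeriv_one]; exact h x) u 1
    have h1 : V 1 = 0 := by
      by_contra h1
      have := (hV.support h1).2
      norm_num at this
    exact hu (hc.trans h1)
  obtain ⟨z, hz⟩ := hex
  have hzm : z ∈ Ioo (-(1 / 4) : ℝ) (1 / 4) := by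
    by_contra h
    exact hz (hV.iteratedDeriv_eq_zero 1 h)
  have hpos : 0 < |iteratedDeriv 1 V z| := abs_pos.2 hz
  have hev : ∀ᶠ w in 𝓝 z, w ∈ Ioo (-(1 / 4) : ℝ) (1 / 4) ∧
      |iteratedDeriv 1 V z| / 2 < |iteratedDeriv 1 V w| :=
    (Filter.Eventually.and (isOpen_Ioo.mem_nhds hzm)
      <| hcont.abs.continuousAt.eventually_const_lt (half_lt_self hpos))
  obtain ⟨ε, hε, hball⟩ := Metric.eventually_nhds_iff.1 hev
  refine ⟨z - ε / 2, z + ε / 2, |iteratedDeriv 1 V z| / 2, by linarith, by linarith,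
    fun w hw => ?_⟩
  have := hball (y := w) (by rw [Real.dist_eq, abs_lt]; constructor <;> linarith [hw.1, hw.2])
  exact ⟨this.1, this.2.le⟩

/-! ### Optimal prices for perturbed baselines -/

section

variable {β ρ : ℝ} {V F₀ : ℝ → ℝ} {N : ℕ} {ι : Fin N → Bool} (hβ : 2 ≤ β) (hF₀ : IsBaseline β F₀)
  (hV : IsBump V) (hρ : 0 ≤ ρ) (hN : 1 ≤ N) {M : ℝ}
  (hM : ∀ k ≤ 2, ∀ z, |iteratedDeriv k V z| ≤ M) (hρM : ρ * M ≤ 1 / 64)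

include hβ hF₀ hV hρ hN hM hρM

/-- Isolates the deviation from the affine baseline transform, for which `φ(u) = -x` has the
solution `u = 1/4 - x/2`. -/
lemma phi_bumpCDF {u : ℝ} (hu : u ∈ Icc (-(1 / 4) : ℝ) (1 / 4)) :
    phi (bumpCDF β ρ V F₀ N ι) u = 2 * u - 1 / 2 +
      ((1 / 2 - u) * bumpDeriv β ρ V N ι 1 u + bumpDeriv β ρ V N ι 0 u)
        / (1 + bumpDeriv β ρ V N ι 1 u) := by
  have hb := (abs_le.1 (abs_bumpDeriv_le_const (ι := ι) hβ hF₀ hV hρ hN hM hρM (k := 1)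
      (by norm_num) u)).1
  have h0 : 1 + bumpDeriv β ρ V N ι 1 u ≠ 0 := by linarith
  rw [phi, (hasDerivAt_bumpCDF hβ hF₀ hV u).deriv, bumpCDF_eq, hF₀.deriv_eq hβ hu,
    hF₀.eq_on u hu]
  field_simp
  ring

lemma differentiable_phi_bumpCDF : Differentiable ℝ (phi (bumpCDF β ρ V F₀ N ι)) :=
  fun u => (hasDerivAt_phi_bumpCDF hβ hF₀ hV hρ hN hM hρM u).differentiableAt

lemma abs_phi_sub_le {u v : ℝ} (hu : u ∈ Icc (-(1 / 4) : ℝ) (1 / 4))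
    (hv : v ∈ Icc (-(1 / 4) : ℝ) (1 / 4)) :
    |u - v| ≤ |phi (bumpCDF β ρ V F₀ N ι) u - phi (bumpCDF β ρ V F₀ N ι) v| ∧
    |phi (bumpCDF β ρ V F₀ N ι) u - phi (bumpCDF β ρ V F₀ N ι) v| ≤ 3 * |u - v| := by
  have hd := differentiable_phi_bumpCDF (ι := ι) hβ hF₀ hV hρ hN hM hρM
  have hI : ∀ w ∈ Icc (-(1 / 4) : ℝ) (1 / 4),
      deriv (phi (bumpCDF β ρ V F₀ N ι)) w ∈ Icc (1 : ℝ) 3 :=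
    fun w hw => deriv_phi_bumpCDF_mem hβ hF₀ hV hρ hN hM hρM hw
  constructor
  · have key : ∀ {v w : ℝ}, v ∈ Icc (-(1 / 4) : ℝ) (1 / 4) → w ∈ Icc (-(1 / 4) : ℝ) (1 / 4) →
        v ≤ w → w - v ≤ phi (bumpCDF β ρ V F₀ N ι) w - phi (bumpCDF β ρ V F₀ N ι) v := by
      intro v w hv hw h
      have := (convex_Icc (-(1 / 4) : ℝ) (1 / 4)).mul_sub_le_image_sub_of_le_deriv
        hd.continuous.continuousOn hd.differentiableOn (C := 1)
        (fun x hx => (hI x (interior_subset hx)).1) v hv w hw h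
      linarith
    rcases le_total u v with h | h
    · rw [abs_sub_comm, abs_of_nonneg (sub_nonneg.2 h), abs_sub_comm]
      exact (key hu hv h).trans (le_abs_self _)
    · rw [abs_of_nonneg (sub_nonneg.2 h)]
      exact (key hv hu h).trans (le_abs_self _)
  · have := Convex.norm_image_sub_le_of_norm_deriv_le (f := phi (bumpCDF β ρ V F₀ N ι))
      (s := Icc (-(1 / 4) : ℝ) (1 / 4)) (C := 3) (fun w _ => hd w)
      (fun w hw => by
        rw [Real.norm_eq_abs, abs_of_nonneg (by linarith [(hI w hw).1])]
        exact (hI w hw).2) (convex_Icc _ _) hv hu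
    simpa using this

/-- The first-order condition has a solution near `1/4 - x/2`, at a distance comparable to the
perturbation at that point. -/
lemma exists_critical {x : ℝ} (hx : x ∈ Icc (0 : ℝ) (1 / 4)) :
    ∃ u, phi (bumpCDF β ρ V F₀ N ι) u = -x ∧ x + u ∈ prices ∧
      |(1 / 2 - (1 / 4 - x / 2)) * bumpDeriv β ρ V N ι 1 (1 / 4 - x / 2)
        + bumpDeriv β ρ V N ι 0 (1 / 4 - x / 2)| ≤ 6 * |u - (1 / 4 - x / 2)| ∧
      (bumpDeriv β ρ V N ι 1 (1 / 4 - x / 2) = 0 → bumpDeriv β ρ V N ι 0 (1 / 4 - x / 2) = 0 →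
        u = 1 / 4 - x / 2) := by
  have hd := differentiable_phi_bumpCDF (ι := ι) hβ hF₀ hV hρ hN hM hρM
  set u₀ := 1 / 4 - x / 2 with hu₀
  have hu₀m : u₀ ∈ Icc (-(1 / 4) : ℝ) (1 / 4) := ⟨by linarith [hx.2], by linarith [hx.1]⟩
  -- The perturbation vanishes at both ends of the plateau, so `φ` runs from `-1` to `0` and takes
  -- the value `-x`.
  have hl : phi (bumpCDF β ρ V F₀ N ι) (-(1 / 4)) = -1 := by
    rw [phi_bumpCDF hβ hF₀ hV hρ hN hM hρM ⟨by norm_num, by norm_num⟩,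
      bumpDeriv_eq_zero hV hN 0 (by norm_num), bumpDeriv_eq_zero hV hN 1 (by norm_num)]
    norm_num
  have hr : phi (bumpCDF β ρ V F₀ N ι) (1 / 4) = 0 := by
    rw [phi_bumpCDF hβ hF₀ hV hρ hN hM hρM ⟨by norm_num, by norm_num⟩,
      bumpDeriv_eq_zero hV hN 0 (by norm_num), bumpDeriv_eq_zero hV hN 1 (by norm_num)]
    norm_num
  obtain ⟨u, hu, hux⟩ := intermediate_value_Icc (show (-(1 / 4) : ℝ) ≤ 1 / 4 by norm_num)
    hd.continuous.continuousOn (show -x ∈ Icc _ _ by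
      rw [hl, hr]; exact ⟨by linarith [hx.2], by linarith [hx.1]⟩)
  have hb0 := abs_le.1 (abs_bumpDeriv_le_const (ι := ι) hβ hF₀ hV hρ hN hM hρM (k := 0)
      (by norm_num) u₀)
  have hb1 := abs_le.1 (abs_bumpDeriv_le_const (ι := ι) hβ hF₀ hV hρ hN hM hρM (k := 1)
      (by norm_num) u₀)
  have hphi : phi (bumpCDF β ρ V F₀ N ι) u₀ - phi (bumpCDF β ρ V F₀ N ι) u =
      ((1 / 2 - u₀) * bumpDeriv β ρ V N ι 1 u₀ + bumpDeriv β ρ V N ι 0 u₀)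
        / (1 + bumpDeriv β ρ V N ι 1 u₀) := by
    rw [hux, phi_bumpCDF hβ hF₀ hV hρ hN hM hρM hu₀m, hu₀]; ring
  obtain ⟨h1, h2⟩ := abs_phi_sub_le (ι := ι) hβ hF₀ hV hρ hN hM hρM hu₀m hu
  rw [hphi, abs_div, abs_of_pos (show 0 < 1 + bumpDeriv β ρ V N ι 1 u₀ by linarith)] at h1 h2
  rw [le_div_iff₀ (by linarith)] at h1
  rw [div_le_iff₀ (by linarith)] at h2
  have hnn := abs_nonneg (u₀ - u)
  have hnum : |(1 / 2 - u₀) * bumpDeriv β ρ V N ι 1 u₀ + bumpDeriv β ρ V N ι 0 u₀| ≤ 1 / 32 := by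
    rw [abs_le]
    constructor <;> nlinarith [hu₀m.1, hu₀m.2, hx.1, hx.2]
  refine ⟨u, hux, ?_, ?_, fun e1 e0 => ?_⟩
  -- The baseline price `x + u₀ = 1/4 + x/2` lies in `[1/4, 3/8]`, hence at distance at least `1/16`
  -- from the ends of the price range.
  · have : |u₀ - u| ≤ 1 / 16 := by nlinarith
    have := abs_le.1 this
    exact ⟨by linarith [hx.1], by linarith [hx.2]⟩
  · rw [abs_sub_comm u u₀]
    refine h2.trans ?_
    nlinarith
  · rw [e1, e0] at h1
    simp at h1
    linarith

end

end

/-! ### Summation over the hypercube -/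

/-- Switch the `j`-th bit. -/
def flipBit {N : ℕ} (j : Fin N) (ι : Fin N → Bool) : Fin N → Bool := Function.update ι j (!ι j)

lemma flipBit_flipBit {N : ℕ} (j : Fin N) : Function.Involutive (flipBit j) := by
  intro ι
  simp [flipBit]

lemma sum_flipBit {N : ℕ} (j : Fin N) (f : (Fin N → Bool) → ℝ) :
    ∑ ι, f (flipBit j ι) = ∑ ι, f ι :=
  Equiv.sum_comp (flipBit_flipBit j).toPerm f

/-- Assouad's argument: two-point bounds along the edges of the hypercube, together with a bound
on the total information of all coordinates, give a vertex with large total error. -/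
lemma exists_large_of_two_point {N T : ℕ} {G : Finset (Fin N)}
    {A B : Fin N → (Fin N → Bool) → ℕ → ℝ} {r : (Fin N → Bool) → ℕ → ℝ} {κ K : ℝ} (hκ : 0 ≤ κ)
    (hB0 : ∀ j ι s, 0 ≤ B j ι s)
    (h : ∀ j ∈ G, ∀ ι, ∀ t < T, κ ≤ 3 / 4 * (A j ι t + A j (flipBit j ι) t) + κ / 2
      + κ / 2 * ∑ s ∈ Finset.range t, (B j ι s + B j (flipBit j ι) s))
    (hA : ∀ ι t, ∑ j ∈ G, A j ι t ≤ r ι t) (hB : ∀ ι s, ∑ j ∈ G, B j ι s ≤ K)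
    (hK : K * T ≤ G.card / 4) :
    ∃ ι, T * G.card * κ / 6 ≤ ∑ t ∈ Finset.range T, r ι t := by
  by_contra! hcon
  obtain ⟨n, hn⟩ : ∃ n : ℝ, n = ((Finset.univ : Finset (Fin N → Bool)).card : ℝ) := ⟨_, rfl⟩
  have hn0 : 0 < n := by rw [hn]; exact_mod_cast Finset.card_pos.2 Finset.univ_nonempty
  -- Flipping a bit permutes the hypercube, so both ends of the edges contribute the same sum. The
  -- information is summed over all cells first, where it is at most `K` per round.
  have step : ∀ t ∈ Finset.range T, n * G.card * κ ≤ 3 / 2 * ∑ ι, r ι t + n * G.card * κ / 2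
      + κ * (n * (T * K)) := by
    intro t ht
    have ht' := Finset.mem_range.1 ht
    have h1 : ∀ j ∈ G, n * κ ≤ 3 / 2 * ∑ ι, A j ι t + n * κ / 2
        + κ * ∑ s ∈ Finset.range T, ∑ ι, B j ι s := by
      intro j hj
      have h2 : ∀ ι ∈ (Finset.univ : Finset (Fin N → Bool)), κ ≤
          3 / 4 * (A j ι t + A j (flipBit j ι) t) + κ / 2
          + κ / 2 * ∑ s ∈ Finset.range T, (B j ι s + B j (flipBit j ι) s) := by
        intro ι _
        refine (h j hj ι t ht').trans ?_
        gcongr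
        exact fun s _ _ => add_nonneg (hB0 _ _ _) (hB0 _ _ _)
      have h3 := Finset.sum_le_sum h2
      simp only [Finset.sum_add_distrib, ← Finset.mul_sum, Finset.sum_const, nsmul_eq_mul] at h3
      rw [sum_flipBit j fun ι => A j ι t,
        sum_flipBit j fun ι => ∑ s ∈ Finset.range T, B j ι s, Finset.sum_comm, ← hn] at h3
      linarith
    have h4 := Finset.sum_le_sum h1
    simp only [Finset.sum_add_distrib, ← Finset.mul_sum, Finset.sum_const, nsmul_eq_mul] at h4
    have h5 : ∑ j ∈ G, ∑ ι, A j ι t ≤ ∑ ι, r ι t := by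
      rw [Finset.sum_comm]
      exact Finset.sum_le_sum fun ι _ => hA ι t
    have h6 : ∑ j ∈ G, ∑ s ∈ Finset.range T, ∑ ι, B j ι s ≤ n * (T * K) := by
      rw [Finset.sum_comm]
      calc ∑ s ∈ Finset.range T, ∑ j ∈ G, ∑ ι, B j ι s
          ≤ ∑ s ∈ Finset.range T, n * K := by
            refine Finset.sum_le_sum fun s _ => ?_
            rw [Finset.sum_comm]
            refine (Finset.sum_le_sum fun ι _ => hB ι s).trans ?_
            rw [Finset.sum_const, nsmul_eq_mul, ← hn]
        _ = n * (T * K) := by rw [Finset.sum_const, nsmul_eq_mul, Finset.card_range]; ring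
    have h7 := mul_le_mul_of_nonneg_left h6 hκ
    have h8 : (G.card : ℝ) * (n * κ / 2) = n * G.card * κ / 2 := by ring
    have h9 : n * ((G.card : ℝ) * κ) = n * G.card * κ := by ring
    rw [h8, h9] at h4
    linarith
  have h1 := Finset.sum_le_sum step
  simp only [Finset.sum_add_distrib, ← Finset.mul_sum, Finset.sum_const, nsmul_eq_mul,
    Finset.card_range] at h1
  rw [Finset.sum_comm] at h1
  -- The constant `1/6` fits because `3/2 * 1/6 = 1 - 1/2 - 1/4`.
  have h2 : ∑ ι : Fin N → Bool, ∑ t ∈ Finset.range T, r ι t < n * (T * G.card * κ / 6) := by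
    calc _ < ∑ ι : Fin N → Bool, (T * G.card * κ / 6) :=
          Finset.sum_lt_sum_of_nonempty Finset.univ_nonempty fun ι _ => hcon ι
      _ = _ := by rw [Finset.sum_const, nsmul_eq_mul, ← hn]
  have h3 : T * (κ * (n * (T * K))) ≤ T * (κ * (n * (G.card / 4))) := by
    gcongr
    linarith
  have h4 : n * G.card * (T * κ) = 4 * (T * (κ * (n * (G.card / 4)))) := by ring
  have h5 : (T : ℝ) * (n * G.card * κ / 2) = 2 * (T * (κ * (n * (G.card / 4)))) := by ring
  have h6 : n * (T * G.card * κ / 6) = 2 / 3 * (T * (κ * (n * (G.card / 4)))) := by ring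
  have h7 : T * (κ * (n * (T * K))) = κ * (n * (T * (T * K))) := by ring
  rw [h4, h5] at h1
  rw [h6] at h2
  rw [h7] at h3
  linarith

/-! ### The lower bound from the second class -/

lemma hell_self {D₀ D₁ : ℝ × ℝ → ℝ} {z : ℝ × ℝ} (h₀ : D₀ z ∈ Icc (0 : ℝ) 1) (h : D₀ z = D₁ z) :
    hell D₀ D₁ z = 0 := by
  rw [hell, ← h, Real.sqrt_mul_self h₀.1, Real.sqrt_mul_self (sub_nonneg.2 h₀.2)]
  ring

/-- The covariates whose unperturbed optimal price meets the window `[z₁, z₂]` of cell `j`. -/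
def cellWindow (N : ℕ) (z₁ z₂ : ℝ) (j : Fin N) : Set ℝ :=
  {x | cellCoord N j (1 / 4 - x / 2) ∈ Icc z₁ z₂}

lemma cellWindow_eq {N : ℕ} (hN : 1 ≤ N) (z₁ z₂ : ℝ) (j : Fin N) :
    cellWindow N z₁ z₂ j =
      Icc (1 - (2 * z₂ + (j + 1 / 2)) / N) (1 - (2 * z₁ + (j + 1 / 2)) / N) := by
  have hN0 : (0 : ℝ) < N := by positivity
  ext x
  have h1 : 1 - (2 * z₂ + (j + 1 / 2)) / N ≤ x ↔ (1 - x) * N ≤ 2 * z₂ + (j + 1 / 2) := by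
    rw [sub_le_comm, le_div_iff₀ hN0]
  have h2 : x ≤ 1 - (2 * z₁ + (j + 1 / 2)) / N ↔ 2 * z₁ + (j + 1 / 2) ≤ (1 - x) * N := by
    rw [le_sub_comm, div_le_iff₀ hN0]
  rw [mem_Icc, h1, h2]
  change cellCoord N j (1 / 4 - x / 2) ∈ Icc z₁ z₂ ↔ _
  rw [cellCoord_formula hN, mem_Icc]
  constructor <;> rintro ⟨h1, h2⟩ <;> constructor <;> linarith

/-- The cells that lie in `[1/8, 1/4]`. -/
def goodCells (N : ℕ) : Finset (Fin N) := Finset.univ.filter fun j => 3 * N ≤ 4 * (j : ℕ)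

lemma card_goodCells {N : ℕ} (hN : 8 ≤ N) : (N : ℝ) / 8 ≤ (goodCells N).card := by
  have h1 : (Finset.univ.filter fun j : Fin N => (⟨(3 * N + 3) / 4, by omega⟩ : Fin N) ≤ j)
      ⊆ goodCells N := by
    intro j hj
    simp only [Finset.mem_filter, Finset.mem_univ, true_and, goodCells, Fin.le_def] at hj ⊢
    omega
  have h2 := Finset.card_le_card h1
  rw [show (Finset.univ.filter fun j : Fin N => (⟨(3 * N + 3) / 4, by omega⟩ : Fin N) ≤ j)
    = Finset.Ici ⟨(3 * N + 3) / 4, by omega⟩ by ext; simp, Fin.card_Ici] at h2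
  simp only at h2
  rw [div_le_iff₀ (by norm_num)]
  have h3 : N ≤ (goodCells N).card * 8 := by omega
  exact_mod_cast h3

/-- For `u = 1/4 - x/2` in this range the covariate is in `[0, 1/4]`, where `exists_critical`
applies. -/
lemma mem_of_goodCell {N : ℕ} (hN : 1 ≤ N) {j : Fin N} (hj : j ∈ goodCells N) {u : ℝ}
    (hu : cellCoord N j u ∈ Ioo (-(1 / 4) : ℝ) (1 / 4)) : u ∈ Icc (1 / 8 : ℝ) (1 / 4) := by
  refine ⟨?_, (mem_of_cellCoord_mem hN hu).2.le⟩
  have h := hu.1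
  rw [cellCoord_formula hN] at h
  have hj' : 3 * N ≤ 4 * (j : ℕ) := (Finset.mem_filter.1 hj).2
  have hj'' : 3 * (N : ℝ) ≤ 4 * (j : ℕ) := by exact_mod_cast hj'
  have hN0 : (0 : ℝ) < N := by positivity
  by_contra hlt
  push Not at hlt
  have : (N : ℝ) * (u + 1 / 4) < N * (3 / 8) := by
    have := mul_lt_mul_of_pos_left hlt hN0
    linarith
  linarith

lemma bumpDeriv_flipBit {β ρ : ℝ} {V : ℝ → ℝ} (hV : IsBump V) {N : ℕ}
    (ι : Fin N → Bool) (j : Fin N) (k : ℕ) {u : ℝ}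
    (hu : cellCoord N j u ∉ Ioo (-(1 / 4) : ℝ) (1 / 4)) :
    bumpDeriv β ρ V N (flipBit j ι) k u = bumpDeriv β ρ V N ι k u := by
  refine Finset.sum_congr rfl fun i _ => ?_
  by_cases hij : i = j
  · subst hij
    rw [bumpTerm, bumpTerm, hV.iteratedDeriv_eq_zero k hu]; ring
  · simp [bumpTerm, flipBit, hij]

section

variable {β ρ : ℝ} {V F₀ : ℝ → ℝ} {N : ℕ} (hβ : 2 ≤ β) (hF₀ : IsBaseline β F₀)
  (hV : IsBump V) (hρ : 0 ≤ ρ) (hN : 1 ≤ N) {M : ℝ}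
  (hM : ∀ k ≤ 2, ∀ z, |iteratedDeriv k V z| ≤ M) (hρM : ρ * M ≤ 1 / 64)

include hβ hF₀ hV hρ hN hM hρM

/-- The two demands differ only in cell `j`, by the bump itself. The bound does not involve `ι`, so
it can be summed over disjoint cells. -/
lemma hell_demand_le {I J : Market} {ι : Fin N → Bool} {j : Fin N}
    (uI : I.util = fun x => x) (uJ : J.util = fun x => x)
    (FI : I.F = bumpCDF β ρ V F₀ N ι) (FJ : J.F = bumpCDF β ρ V F₀ N (flipBit j ι)) (z : ℝ × ℝ) :
    hell I.demand J.demand z ≤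
      16 * (ρ * (1 / (N : ℝ)) ^ β) ^ 2 * V (cellCoord N j (z.2 - z.1)) ^ 2 := by
  have hI : I.demand z = 1 - (F₀ (z.2 - z.1) + bumpDeriv β ρ V N ι 0 (z.2 - z.1)) := by
    rw [Market.demand, FI, uI, bumpCDF_eq]
  have hJ : J.demand z =
      1 - (F₀ (z.2 - z.1) + bumpDeriv β ρ V N (flipBit j ι) 0 (z.2 - z.1)) := by
    rw [Market.demand, FJ, uJ, bumpCDF_eq]
  set u := z.2 - z.1
  by_cases hu : cellCoord N j u ∈ Ioo (-(1 / 4) : ℝ) (1 / 4)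
  · have hu4 := Ioo_subset_Icc_self (mem_of_cellCoord_mem hN hu)
    have hb := abs_le.1 (abs_bumpDeriv_le_const (ι := ι) hβ hF₀ hV hρ hN hM hρM (k := 0)
      (by norm_num) u)
    have hmem : I.demand z ∈ Icc (1 / 16 : ℝ) (15 / 16) := by
      rw [hI, hF₀.eq_on u hu4]
      constructor
      · linarith [hu4.2]
      · linarith [hu4.1]
    refine (hell_le hmem (J.demand_mem z)).trans (le_of_eq ?_)
    rw [hI, hJ, bumpDeriv_eq_single hV hN 0 hu, bumpDeriv_eq_single hV hN 0 hu]
    simp only [bumpTerm, flipBit, Function.update_self, pow_zero, one_mul, iteratedDeriv_zero]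
    cases ι j <;> simp <;> ring
  · rw [hell_self (I.demand_mem z) (by rw [hI, hJ, bumpDeriv_flipBit hV ι j 0 hu])]
    positivity

/-- The loss is quadratic around a price that solves the first-order condition. -/
lemma quadratic_le_loss {a c : ℝ} (ha0 : 0 < a) (ha1 : a ≤ 1 / 2)
    (ha : ∀ u ∈ Icc (-(1 / 4) : ℝ) 1, a ≤ deriv F₀ u)
    (hc0 : 0 < c) (hc : TransformIncreasingOn c F₀ univ)
    {I : Market} {ι : Fin N → Bool} (uI : I.util = fun x => x) (FI : I.F = bumpCDF β ρ V F₀ N ι)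
    {x p u : ℝ} (hx : x ∈ Icc (0 : ℝ) (1 / 4)) (hp : p ∈ prices) (hu : x + u ∈ prices)
    (hphi : phi (bumpCDF β ρ V F₀ N ι) u = -x) :
    a * min 1 c / 2 * (p - (x + u)) ^ 2 ≤ I.loss (x, p) := by
  have htr := transformIncreasingOn_bumpCDF (ι := ι) hβ hF₀ hV hρ hN hM hρM hc
  have hq := quadratic_loss (hasDerivAt_bumpCDF (ρ := ρ) (ι := ι) hβ hF₀ hV) (a := a)
    (c := min 1 c)
    (by
      intro w hw
      by_cases hw4 : w ∈ Ioo (-(1 / 4) : ℝ) (1 / 4)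
      · rw [hF₀.deriv_eq hβ (Ioo_subset_Icc_self hw4)]
        have := (abs_le.1 (abs_bumpDeriv_le_const (ι := ι) hβ hF₀ hV hρ hN hM hρM (k := 1)
          (by norm_num) w)).1
        linarith
      · rw [bumpDeriv_eq_zero hV hN 1 hw4, add_zero]
        exact ha w hw)
    ha0 (lt_min one_pos hc0) (differentiable_phi_bumpCDF hβ hF₀ hV hρ hN hM hρM)
    (fun w => (htr w (mem_univ w)).2.2) (x := x) ⟨by linarith [hx.1], hx.2⟩ hp hu
    (by rw [add_sub_cancel_left]; exact hphi)
  refine (hq.trans (le_of_eq ?_)).trans (I.revenue_sub_le_loss (x := x) hu)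
  simp only [Market.revenue, FI, uI]

/-- Without the bump the optimal price is the baseline one; with it the optimum moves by at least
the gap `s N v / 48`. No price is within half the gap of both, and the loss is quadratic. -/
lemma separation {a c : ℝ} (ha0 : 0 < a) (ha1 : a ≤ 1 / 2)
    (ha : ∀ u ∈ Icc (-(1 / 4) : ℝ) 1, a ≤ deriv F₀ u)
    (hc0 : 0 < c) (hc : TransformIncreasingOn c F₀ univ) {z₁ z₂ v : ℝ}
    (hv : ∀ z ∈ Icc z₁ z₂, z ∈ Ioo (-(1 / 4) : ℝ) (1 / 4) ∧ v ≤ |iteratedDeriv 1 V z|)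
    (hvN : 8 * M ≤ N * v) (hv0 : 0 < v)
    {I J : Market} {ι : Fin N → Bool} {j : Fin N} (hj : j ∈ goodCells N)
    (uI : I.util = fun x => x) (uJ : J.util = fun x => x)
    (FI : I.F = bumpCDF β ρ V F₀ N ι) (FJ : J.F = bumpCDF β ρ V F₀ N (flipBit j ι))
    {x p : ℝ} (hx : x ∈ cellWindow N z₁ z₂ j) (hp : p ∈ prices) :
    a * min 1 c / 4 * (ρ * (1 / (N : ℝ)) ^ β * (N * v / 48)) ^ 2
      ≤ I.loss (x, p) + J.loss (x, p) := by
  set u₀ := 1 / 4 - x / 2 with hu₀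
  obtain ⟨hz, hvz⟩ := hv _ hx
  have hu₀m : u₀ ∈ Icc (1 / 8 : ℝ) (1 / 4) := mem_of_goodCell hN hj hz
  have hx4 : x ∈ Icc (0 : ℝ) (1 / 4) := ⟨by linarith [hu₀m.2], by linarith [hu₀m.1]⟩
  set s := ρ * (1 / (N : ℝ)) ^ β with hs
  have hs0 : 0 ≤ s := by positivity
  have hk : 0 ≤ a * min 1 c / 2 := by have := lt_min one_pos hc0; positivity
  -- the claim when `κ` has the bump in cell `j` and `ι` does not
  have main : ∀ {I J : Market} {ι κ : Fin N → Bool}, I.util = (fun x => x) → J.util = (fun x => x) →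
      I.F = bumpCDF β ρ V F₀ N ι → J.F = bumpCDF β ρ V F₀ N κ → ι j = false → κ j = true →
      a * min 1 c / 4 * (s * (N * v / 48)) ^ 2 ≤ I.loss (x, p) + J.loss (x, p) := by
    intro I J ι κ uI uJ FI FJ hι hκ
    have b0 : ∀ k, bumpDeriv β ρ V N ι k u₀ = 0 := by
      intro k
      rw [bumpDeriv_eq_single hV hN k hz, bumpTerm, hι]; simp
    have b1 : ∀ k, bumpDeriv β ρ V N κ k u₀
        = s * ((N : ℝ) ^ k * iteratedDeriv k V (cellCoord N j u₀)) := by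
      intro k
      rw [bumpDeriv_eq_single hV hN k hz, bumpTerm, hκ, if_pos rfl, one_mul]
    obtain ⟨y, hy1, hy2, -, hy4⟩ := exists_critical (ι := ι) hβ hF₀ hV hρ hN hM hρM hx4
    have hy := hy4 (b0 1) (b0 0)
    obtain ⟨w, hw1, hw2, hw3, -⟩ := exists_critical (ι := κ) hβ hF₀ hV hρ hN hM hρM hx4
    rw [← hu₀, b1 0, b1 1] at hw3
    -- Since `1/2 - u₀ ≥ 1/4`, the term with `V'` is at least `N v / 4`, and `|V| ≤ M ≤ N v / 8`
    -- cannot cancel it; the factor 6 comes from `exists_critical`.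
    have hgap : s * (N * v / 48) ≤ |w - u₀| := by
      set D := iteratedDeriv 1 V (cellCoord N j u₀)
      set W := iteratedDeriv 0 V (cellCoord N j u₀)
      have hW : |W| ≤ M := hM 0 (by norm_num) _
      have e : (1 / 2 - u₀) * (s * ((N : ℝ) ^ 1 * D)) + s * ((N : ℝ) ^ 0 * W)
          = s * ((1 / 2 - u₀) * (N * D) + W) := by ring
      rw [e, abs_mul, abs_of_nonneg hs0] at hw3
      have h1 : N * v / 8 ≤ |(1 / 2 - u₀) * (N * D) + W| := by
        have h2 : 1 / 4 * (N * v) ≤ |(1 / 2 - u₀) * (N * D)| := by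
          rw [abs_mul, abs_mul, abs_of_pos (by linarith [hu₀m.2]), Nat.abs_cast]
          have : (N : ℝ) * v ≤ N * |D| := by gcongr
          exact mul_le_mul (by linarith [hu₀m.2]) this (by positivity) (by linarith [hu₀m.2])
        have h3 := abs_sub_abs_le_abs_sub ((1 / 2 - u₀) * (N * D)) (-W)
        rw [abs_neg, sub_neg_eq_add] at h3
        linarith
      have := mul_le_mul_of_nonneg_left h1 hs0
      linarith
    have l1 := quadratic_le_loss hβ hF₀ hV hρ hN hM hρM ha0 ha1 ha hc0 hc uI FI hx4 hp hy2 hy1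
    have l2 := quadratic_le_loss hβ hF₀ hV hρ hN hM hρM ha0 ha1 ha hc0 hc uJ FJ hx4 hp hw2 hw1
    rw [hy, ← hu₀] at l1
    have h5 : (s * (N * v / 48)) ^ 2 ≤ (w - u₀) ^ 2 := by
      rw [← sq_abs (w - u₀)]
      exact pow_le_pow_left₀ (by positivity) hgap 2
    have h6 : (w - u₀) ^ 2 / 2 ≤ (p - (x + u₀)) ^ 2 + (p - (x + w)) ^ 2 := by
      nlinarith [sq_nonneg ((p - (x + u₀)) + (p - (x + w)))]
    have h7 : a * min 1 c / 2 * ((s * (N * v / 48)) ^ 2 / 2) ≤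
        a * min 1 c / 2 * ((p - (x + u₀)) ^ 2 + (p - (x + w)) ^ 2) :=
      mul_le_mul_of_nonneg_left (by linarith) hk
    linarith
  by_cases hι : ι j = true
  · rw [add_comm]
    exact main uJ uI FJ FI (by simp [flipBit, hι]) hι
  · rw [Bool.not_eq_true] at hι
    exact main uI uJ FI FJ hι (by simp [flipBit, hι])

lemma exists_mem_classTwo (ι : Fin N → Bool) :
    ∃ I ∈ classTwo β ρ V F₀ N, I.ctx = unif (-(1 / 4)) (1 / 4) ∧ I.dom = Icc (-(1 / 4)) (1 / 4) ∧
      (I.util = fun x => x) ∧ I.F = bumpCDF β ρ V F₀ N ι := by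
  obtain ⟨I, h1, h2, h3, h4⟩ := exists_market (lo := -(1 / 4)) (hi := 1 / 4) (by norm_num)
    (m := fun x => x) measurable_id (isCDF_bumpCDF (ι := ι) hβ hF₀ hV hρ hN hM hρM)
  exact ⟨I, ⟨h1, h2, h3, ι, h4.symm⟩, h1, h2, h3, h4⟩

lemma classTwo_lower_of_cells {a c : ℝ} (ha0 : 0 < a) (ha1 : a ≤ 1 / 2)
    (ha : ∀ u ∈ Icc (-(1 / 4) : ℝ) 1, a ≤ deriv F₀ u)
    (hc0 : 0 < c) (hc : TransformIncreasingOn c F₀ univ) {z₁ z₂ v : ℝ} (hz : z₁ < z₂)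
    (hv : ∀ z ∈ Icc z₁ z₂, z ∈ Ioo (-(1 / 4) : ℝ) (1 / 4) ∧ v ≤ |iteratedDeriv 1 V z|)
    (hvN : 8 * M ≤ N * v) (hv0 : 0 < v) (hN8 : 8 ≤ N) {T : ℕ}
    (hT : T * (1 / (N : ℝ)) ^ β * (1 / (N : ℝ)) ^ β ≤ N) (π : Policy) :
    ∃ I ∈ classTwo β ρ V F₀ N,
      T * (a * min 1 c * (z₂ - z₁) / 48 * (ρ * (1 / (N : ℝ)) ^ β * (N * v / 48)) ^ 2)
        ≤ I.expectedRegret π T := by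
  have hN0 : (0 : ℝ) < N := by positivity
  have hmin : 0 < min 1 c := lt_min one_pos hc0
  choose I hI Ic Id Iu IF using exists_mem_classTwo (β := β) (ρ := ρ) (V := V) (F₀ := F₀) (N := N)
    hβ hF₀ hV hρ hN hM hρM
  have cF : ∀ ι, Continuous (I ι).F := fun ι => by
    rw [IF]
    exact continuous_iff_continuousAt.2 fun u => (hasDerivAt_bumpCDF hβ hF₀ hV u).continuousAt
  have cu : ∀ ι, Continuous (I ι).util := fun ι => by rw [Iu]; exact continuous_id
  set s := ρ * (1 / (N : ℝ)) ^ β with hs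
  set κ₁ := a * min 1 c / 4 * (s * (N * v / 48)) ^ 2 with hκ₁
  have hκ₁0 : 0 ≤ κ₁ := by positivity
  set X := cellWindow N z₁ z₂ with hX
  have hXm : ∀ j, MeasurableSet (X j) := fun j => by
    rw [hX, cellWindow_eq hN]; exact measurableSet_Icc
  have hXsub : ∀ j ∈ goodCells N, X j ⊆ Icc (0 : ℝ) (1 / 4) := by
    intro j hj x hx
    have := mem_of_goodCell hN hj (hv _ hx).1
    exact ⟨by linarith [this.2], by linarith [this.1]⟩
  -- The map `x ↦ 1/4 - x/2` halves lengths, so the window has length `2 (z₂ - z₁) / N` in an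
  -- interval of length `1/2`.
  have hXmeas : ∀ j ∈ goodCells N, (unif (-(1 / 4)) (1 / 4)).real (X j) = 4 * (z₂ - z₁) / N := by
    intro j hj
    have hsub := hXsub j hj
    have hle : 1 - (2 * z₂ + ((j : ℕ) + 1 / 2 : ℝ)) / N ≤ 1 - (2 * z₁ + ((j : ℕ) + 1 / 2 : ℝ)) / N := by
      gcongr
    rw [hX, cellWindow_eq hN] at hsub ⊢
    have h1 := (hsub (left_mem_Icc.2 hle)).1
    have h2 := (hsub (right_mem_Icc.2 hle)).2
    rw [unif_real_Icc (by norm_num) (by linarith) h2 hle]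
    field_simp
    ring
  -- the loss at covariates in the window of a cell
  let A : Fin N → (Fin N → Bool) → ℕ → ℝ := fun j ι t =>
    ∫ z, (Prod.fst ⁻¹' X j).indicator (I ι).loss z ∂(I ι).round π t
  -- the information about a cell
  let b : Fin N → ℝ × ℝ → ℝ := fun j z => 16 * s ^ 2 * V (cellCoord N j (z.2 - z.1)) ^ 2
  let B : Fin N → (Fin N → Bool) → ℕ → ℝ := fun j ι t => ∫ z, b j z ∂(I ι).round π t
  have hbc : ∀ j, Continuous (b j) := by
    intro j
    have := hV.smooth.continuous
    have h2 : Continuous (cellCoord N j) := by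
      rw [show cellCoord N j = fun u => N * (u - cellMid N j) from funext (cellCoord_eq N j)]
      fun_prop
    simp only [b]
    fun_prop
  have hVM : ∀ z, V z ^ 2 ≤ M ^ 2 := fun z => by
    have := hM 0 (by norm_num) z
    rw [iteratedDeriv_zero] at this
    exact sq_le_sq' (abs_le.1 this).1 (abs_le.1 this).2
  have hb0 : ∀ j z, 0 ≤ b j z := fun j z => by simp only [b]; positivity
  have hbi : ∀ j ι t, Integrable (b j) ((I ι).round π t) := fun j ι t =>
    (I ι).integrable_of_bound π t (hbc j).measurable (16 * s ^ 2 * M ^ 2) fun x _ p _ => by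
      rw [abs_of_nonneg (hb0 j _)]
      simp only [b]
      exact mul_le_mul_of_nonneg_left (hVM _) (by positivity)
  have two : ∀ j ∈ goodCells N, ∀ ι, ∀ t < T, κ₁ * (4 * (z₂ - z₁) / N) ≤
      3 / 4 * (A j ι t + A j (flipBit j ι) t) + κ₁ * (4 * (z₂ - z₁) / N) / 2
      + κ₁ * (4 * (z₂ - z₁) / N) / 2 *
        ∑ s ∈ Finset.range t, (B j ι s + B j (flipBit j ι) s) := by
    intro j hj ι t _
    have h := (I ι).two_point_loss (I (flipBit j ι)) ((Ic _).trans (Ic _).symm) (cF _) (cF _)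
      (cu _) (cu _) π t (hXm j) hκ₁0 fun x hx _ p hp =>
        separation hβ hF₀ hV hρ hN hM hρM ha0 ha1 ha hc0 hc hv hvN hv0 hj (Iu _) (Iu _) (IF _)
          (IF _) hx hp
    rw [Ic ι, hXmeas j hj] at h
    refine h.trans ?_
    have hh : ∀ ι', ∀ s', ∫ z, hell (I ι).demand (I (flipBit j ι)).demand z ∂(I ι').round π s'
        ≤ B j ι' s' := fun ι' s' =>
      integral_mono ((I ι').integrable_hell π s' (I ι).measurable_demand
        (I (flipBit j ι)).measurable_demand (I ι).demand_mem (I (flipBit j ι)).demand_mem)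
        (hbi j ι' s') fun z => hell_demand_le hβ hF₀ hV hρ hN hM hρM (Iu _) (Iu _) (IF _) (IF _) z
    have hsum := Finset.sum_le_sum (s := Finset.range t)
      fun s' _ => add_le_add (hh ι s') (hh (flipBit j ι) s')
    have hpos : 0 ≤ κ₁ * (4 * (z₂ - z₁) / N) / 2 := by
      have := sub_pos.2 hz
      positivity
    have := mul_le_mul_of_nonneg_left hsum hpos
    simp only [A]
    linarith
  -- The windows are disjoint, so each covariate is charged at most once.
  have hA : ∀ ι t, ∑ j ∈ goodCells N, A j ι t ≤ ∫ z, (I ι).loss z ∂(I ι).round π t := by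
    intro ι t
    have hli := (I ι).integrable_loss (cF ι) (cu ι) π t
    have hmm : ∀ j, MeasurableSet (Prod.fst ⁻¹' X j : Set (ℝ × ℝ)) := fun j => measurable_fst (hXm j)
    simp only [A]
    rw [← integral_finsetSum _ fun j _ => hli.indicator (hmm j)]
    refine (I ι).integral_mono_round π t (integrable_finsetSum _ fun j _ => hli.indicator (hmm j))
      hli fun x _ p hp => ?_
    have hl := (I ι).loss_nonneg (x := x) hp
    have hle : ∑ j : Fin N, (Prod.fst ⁻¹' X j : Set (ℝ × ℝ)).indicator (I ι).loss (x, p)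
        ≤ (I ι).loss (x, p) := by
      refine (le_abs_self _).trans (abs_sum_le_of_subsingleton hl (fun i j hi hj => ?_) fun j => ?_)
      · have h1 : (x, p) ∈ (Prod.fst ⁻¹' X i : Set (ℝ × ℝ)) := mem_of_indicator_ne_zero hi
        have h2 : (x, p) ∈ (Prod.fst ⁻¹' X j : Set (ℝ × ℝ)) := mem_of_indicator_ne_zero hj
        exact cellCoord_inj hN (hv _ h1).1 (hv _ h2).1
      · by_cases h : (x, p) ∈ (Prod.fst ⁻¹' X j : Set (ℝ × ℝ))
        · rw [indicator_of_mem h, abs_of_nonneg hl]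
        · rw [indicator_of_notMem h, abs_zero]; exact hl
    refine (Finset.sum_le_sum_of_subset_of_nonneg (Finset.subset_univ _) fun j _ _ => ?_).trans hle
    by_cases h : (x, p) ∈ (Prod.fst ⁻¹' X j : Set (ℝ × ℝ))
    · rw [indicator_of_mem h]; exact hl
    · rw [indicator_of_notMem h]
  -- The difference `p - x` lies in at most one cell, so an observation informs about at most one
  -- bit, however the price is chosen.
  have hB : ∀ ι t, ∑ j ∈ goodCells N, B j ι t ≤ 16 * s ^ 2 * M ^ 2 := by
    intro ι t
    simp only [B]
    rw [← integral_finsetSum _ fun j _ => hbi j ι t]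
    have hc : ∫ z, (16 * s ^ 2 * M ^ 2 : ℝ) ∂(I ι).round π t = 16 * s ^ 2 * M ^ 2 := by simp
    rw [← hc]
    refine integral_mono (integrable_finsetSum _ fun j _ => hbi j ι t) (integrable_const _)
      fun z => ?_
    have hle : ∑ j : Fin N, b j z ≤ 16 * s ^ 2 * M ^ 2 := by
      refine (le_abs_self _).trans (abs_sum_le_of_subsingleton (by positivity)
        (fun i j hi hj => ?_) fun j => ?_)
      · have aux : ∀ j, b j z ≠ 0 → cellCoord N j (z.2 - z.1) ∈ Ioo (-(1 / 4) : ℝ) (1 / 4) := by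
          intro j hj
          by_contra h
          have := hV.iteratedDeriv_eq_zero 0 h
          rw [iteratedDeriv_zero] at this
          exact hj (by simp only [b, this]; ring)
        exact cellCoord_inj hN (aux i hi) (aux j hj)
      · rw [abs_of_nonneg (hb0 j z)]
        simp only [b]
        exact mul_le_mul_of_nonneg_left (hVM _) (by positivity)
    exact (Finset.sum_le_sum_of_subset_of_nonneg (Finset.subset_univ _) fun j _ _ => hb0 j z).trans hle
  have hG := card_goodCells hN8
  -- The left side is at most `16 / 64² * N = N / 256`, and a quarter of the good cells is at least
  -- `N / 32`.
  have hK : 16 * s ^ 2 * M ^ 2 * T ≤ (goodCells N).card / 4 := by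
    have hM0 : 0 ≤ M := (abs_nonneg _).trans (hM 0 (by norm_num) 0)
    have e : 16 * s ^ 2 * M ^ 2 * T =
        16 * (ρ * M) ^ 2 * (T * (1 / (N : ℝ)) ^ β * (1 / (N : ℝ)) ^ β) := by rw [hs]; ring
    have h1 : (ρ * M) ^ 2 ≤ (1 / 64) ^ 2 := pow_le_pow_left₀ (by positivity) hρM 2
    rw [e]
    calc _ ≤ 16 * (1 / 64) ^ 2 * (N : ℝ) := by gcongr
      _ ≤ _ := by linarith
  obtain ⟨ι, hι⟩ := exists_large_of_two_point
    (A := A) (B := B) (r := fun ι t => ∫ z, (I ι).loss z ∂(I ι).round π t)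
    (κ := κ₁ * (4 * (z₂ - z₁) / N)) (by have := sub_pos.2 hz; positivity)
    (fun j ι s => integral_nonneg (hb0 j)) two hA hB hK
  refine ⟨I ι, hI ι, ?_⟩
  rw [(I ι).expectedRegret_eq_sum (cF ι) (cu ι)]
  refine le_trans ?_ hι
  have hz0 := sub_pos.2 hz
  calc (T : ℝ) * (a * min 1 c * (z₂ - z₁) / 48 * (s * (N * v / 48)) ^ 2)
      = T * (N / 8) * (κ₁ * (4 * (z₂ - z₁) / N)) / 6 := by
        rw [hκ₁]; field_simp; ring
    _ ≤ T * (goodCells N).card * (κ₁ * (4 * (z₂ - z₁) / N)) / 6 := by gcongr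

end

/-! ### The rates -/

lemma BetaSmoothOn.mono {β C C' : ℝ} {F : ℝ → ℝ} {S : Set ℝ} (h : BetaSmoothOn β C F S)
    (hC : C ≤ C') : BetaSmoothOn β C' F S :=
  ⟨h.1, fun x hx y hy => (h.2 x hx y hy).trans
    (mul_le_mul_of_nonneg_right hC (Real.rpow_nonneg (abs_nonneg _) _))⟩

lemma le_cellCount (β : ℝ) (T : ℕ) : (T : ℝ) ^ (1 / (2 * β + 1)) ≤ cellCount β T :=
  Nat.le_ceil _

lemma cellCount_le {β : ℝ} (hβ : 2 ≤ β) {T : ℕ} (hT : 1 ≤ T) :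
    (cellCount β T : ℝ) ≤ 2 * (T : ℝ) ^ (1 / (2 * β + 1)) := by
  have h1 : (1 : ℝ) ≤ (T : ℝ) ^ (1 / (2 * β + 1)) :=
    Real.one_le_rpow (by exact_mod_cast hT) (by positivity)
  have h2 := Nat.ceil_lt_add_one (zero_le_one.trans h1)
  rw [cellCount]
  linarith

/-- Rounding up gives `T ≤ N^(2β+1)`, so each cell receives bounded information. -/
lemma horizon_le_cellCount {β : ℝ} (hβ : 2 ≤ β) {T : ℕ} (hT : 1 ≤ T) :
    T * (1 / (cellCount β T : ℝ)) ^ β * (1 / (cellCount β T : ℝ)) ^ β ≤ cellCount β T := by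
  have hT0 : (0 : ℝ) < T := by exact_mod_cast hT
  have h1 := le_cellCount β T
  have hN : (0 : ℝ) < cellCount β T := (Real.rpow_pos_of_pos hT0 _).trans_le h1
  have h2 := Real.rpow_le_rpow (by positivity) h1 (show 0 ≤ 2 * β + 1 by linarith)
  rw [← Real.rpow_mul hT0.le, one_div_mul_cancel (by linarith), Real.rpow_one,
    show 2 * β + 1 = β + β + 1 by ring, Real.rpow_add hN, Real.rpow_add hN, Real.rpow_one] at h2
  have h3 := Real.rpow_pos_of_pos hN β
  rw [one_div, Real.inv_rpow hN.le, mul_assoc, ← mul_inv, ← div_eq_mul_inv,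
    div_le_iff₀ (by positivity)]
  linarith

/-- The right side is `T N^(2-2β)` with a negative exponent, so the upper bound on `N` is used; `1 +
(2 - 2β)/(2β + 1) = 3/(2β + 1)`. -/
lemma rate_le_cellCount {β : ℝ} (hβ : 2 ≤ β) {T : ℕ} (hT : 1 ≤ T) :
    2 ^ (2 - 2 * β) * (T : ℝ) ^ (3 / (2 * β + 1)) ≤
      T * ((1 / (cellCount β T : ℝ)) ^ β * cellCount β T) ^ 2 := by
  have hT0 : (0 : ℝ) < T := by exact_mod_cast hT
  have hr := Real.rpow_pos_of_pos hT0 (1 / (2 * β + 1))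
  have hN : (0 : ℝ) < cellCount β T := hr.trans_le (le_cellCount β T)
  have e1 : ((1 / (cellCount β T : ℝ)) ^ β * cellCount β T) ^ 2
      = (cellCount β T : ℝ) ^ (2 - 2 * β) := by
    rw [one_div, Real.inv_rpow hN.le, ← Real.rpow_neg hN.le, ← Real.rpow_add_one hN.ne',
      ← Real.rpow_natCast, ← Real.rpow_mul hN.le]
    congr 1
    push_cast
    ring
  have e2 := Real.rpow_le_rpow_of_nonpos hN (cellCount_le hβ hT) (show 2 - 2 * β ≤ 0 by linarith)
  rw [Real.mul_rpow (by norm_num) hr.le, ← Real.rpow_mul hT0.le] at e2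
  have e3 : (T : ℝ) ^ (3 / (2 * β + 1))
      = T * (T : ℝ) ^ (1 / (2 * β + 1) * (2 - 2 * β)) := by
    rw [mul_comm (T : ℝ), ← Real.rpow_add_one hT0.ne']
    congr 1
    have : 2 * β + 1 ≠ 0 := by linarith
    field_simp
    ring
  rw [e1, e3]
  calc _ = T * (2 ^ (2 - 2 * β) * (T : ℝ) ^ (1 / (2 * β + 1) * (2 - 2 * β))) := by ring
    _ ≤ _ := by gcongr

/-- The lower bound of order `T^{3/(2β+1)}` from the second class, for large horizons. -/
lemma classTwo_lower {β ρ : ℝ} {V F₀ : ℝ → ℝ} (hβ : 2 ≤ β) (hF₀ : IsBaseline β F₀) (hV : IsBump V)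
    (hρ : 0 < ρ) {M : ℝ} (hM : ∀ k ≤ 2, ∀ z, |iteratedDeriv k V z| ≤ M) (hρM : ρ * M ≤ 1 / 64) :
    ∃ c > 0, ∃ T₀ : ℕ, ∀ T : ℕ, T₀ ≤ T → ∀ π : Policy,
      ∃ I ∈ classTwo β ρ V F₀ (cellCount β T),
        c * (T : ℝ) ^ (3 / (2 * β + 1)) ≤ I.expectedRegret π T := by
  obtain ⟨a, ha0, ha1, ha⟩ := hF₀.exists_deriv_lower hβ
  obtain ⟨c, hc0, hc⟩ := hF₀.incr
  obtain ⟨z₁, z₂, v, hz, hv0, hv⟩ := hV.exists_deriv_lower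
  have hmin : 0 < min 1 c := lt_min one_pos hc0
  have hz0 := sub_pos.2 hz
  set k := a * min 1 c * (z₂ - z₁) / 48 * (ρ * (v / 48)) ^ 2 with hk
  have hk0 : 0 < k := by positivity
  have hlim : Filter.Tendsto (fun T : ℕ => (T : ℝ) ^ (1 / (2 * β + 1))) Filter.atTop Filter.atTop :=
    (tendsto_rpow_atTop (by positivity)).comp tendsto_natCast_atTop_atTop
  -- Large horizons guarantee enough good cells (`N ≥ 8`) and that `V'` outweighs `V` (`N v ≥ 8 M`).
  obtain ⟨T₁, hT₁⟩ := Filter.eventually_atTop.1 (hlim.eventually_ge_atTop (max 8 (8 * M / v)))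
  refine ⟨k * 2 ^ (2 - 2 * β), by positivity, max 1 T₁, fun T hT π => ?_⟩
  have hT1 : 1 ≤ T := (le_max_left _ _).trans hT
  have hlarge := (hT₁ T ((le_max_right _ _).trans hT)).trans (le_cellCount β T)
  have hN8 : 8 ≤ cellCount β T := by exact_mod_cast (le_max_left _ _).trans hlarge
  have hvN : 8 * M ≤ cellCount β T * v := by
    rw [← div_le_iff₀ hv0]
    exact (le_max_right _ _).trans hlarge
  obtain ⟨I, hI, h⟩ := classTwo_lower_of_cells hβ hF₀ hV hρ.le (by omega) hM hρM ha0 ha1 ha hc0 hc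
    hz hv hvN hv0 hN8 (horizon_le_cellCount hβ hT1) π
  refine ⟨I, hI, le_trans ?_ h⟩
  have := mul_le_mul_of_nonneg_left (rate_le_cellCount hβ hT1) hk0.le
  calc _ = k * (2 ^ (2 - 2 * β) * (T : ℝ) ^ (3 / (2 * β + 1))) := by ring
    _ ≤ _ := this
    _ = _ := by rw [hk]; ring

lemma union_lower {β ρ : ℝ} {V F₀ : ℝ → ℝ} (hβ : 2 ≤ β) (hF₀ : IsBaseline β F₀) (hV : IsBump V)
    (hρ : 0 < ρ) {M : ℝ} (hM : ∀ k ≤ 2, ∀ z, |iteratedDeriv k V z| ≤ M) (hρM : ρ * M ≤ 1 / 64)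
    {η : ℝ} (hη₀ : 0 < η) (hη : η ≤ 1 / 32) :
    ∃ c : ℝ, 0 < c ∧ ∀ T : ℕ, 1 ≤ T → ∀ π : Policy,
      ∃ I ∈ classOne η ∪ classTwo β ρ V F₀ (cellCount β T),
        c * (T : ℝ) ^ (max (3 / (2 * β + 1)) (1 / 2)) ≤ I.expectedRegret π T := by
  obtain ⟨c₁, hc₁, h₁⟩ := classOne_lower hη₀ hη
  obtain ⟨c₂, hc₂, T₀, h₂⟩ := classTwo_lower hβ hF₀ hV hρ hM hρM
  refine ⟨min c₂ (c₁ / (T₀ + 1)), by positivity, fun T hT π => ?_⟩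
  have hT1 : (1 : ℝ) ≤ T := by exact_mod_cast hT
  have hT0 : (0 : ℝ) < T := zero_lt_one.trans_le hT1
  have hc₁' : c₁ / (T₀ + 1) ≤ c₁ := div_le_self hc₁.le (by linarith [T₀.cast_nonneg (α := ℝ)])
  obtain ⟨I, hI, h⟩ := h₁ T hT π
  rcases le_total (3 / (2 * β + 1)) (1 / 2) with hle | hle
  · refine ⟨I, Or.inl hI, le_trans ?_ h⟩
    rw [max_eq_right hle]
    exact mul_le_mul_of_nonneg_right ((min_le_right _ _).trans hc₁') (by positivity)
  rw [max_eq_left hle]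
  rcases le_or_gt T₀ T with hlt | hlt
  · obtain ⟨J, hJ, h'⟩ := h₂ T hlt π
    exact ⟨J, Or.inr hJ, le_trans
      (mul_le_mul_of_nonneg_right (min_le_left _ _) (by positivity)) h'⟩
  -- Below the threshold the first class suffices: the exponent is at most 1, so the rate is at most
  -- `T₀ + 1`, which the divisor in the constant absorbs.
  · refine ⟨I, Or.inl hI, le_trans ?_ h⟩
    have hlt' : (T : ℝ) ≤ T₀ + 1 := by
      have : (T : ℝ) < T₀ := by exact_mod_cast hlt
      linarith
    have e1 : (T : ℝ) ^ (3 / (2 * β + 1)) ≤ T := by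
      refine Real.rpow_le_self_of_one_le hT1 ?_
      rw [div_le_one (by linarith)]
      linarith
    have e2 : (1 : ℝ) ≤ (T : ℝ) ^ (1 / 2 : ℝ) := Real.one_le_rpow hT1 (by norm_num)
    calc _ ≤ c₁ / (T₀ + 1) * (T₀ + 1) :=
          mul_le_mul (min_le_right _ _) (e1.trans hlt') (by positivity) (by positivity)
      _ = c₁ * 1 := by field_simp
      _ ≤ _ := by gcongr

end Pricing

end

/-! ### Assembly of the theorem -/

theorem theorem3p2 (β : ℝ) (hβ : 2 ≤ β) :
    -- smoothness and monotonicity for the first class, with constants common to the whole class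
    (∃ C cφ : ℝ, 0 < cφ ∧ ∀ a b : ℝ, 0 < a →
      Pricing.IsCDF (Pricing.clippedLinear a b) ∧
      Pricing.BetaSmoothOn β C (Pricing.clippedLinear a b) (Pricing.linearRegion a b) ∧
      Pricing.TransformIncreasingOn cφ (Pricing.clippedLinear a b) (Pricing.linearRegion a b)) ∧
    -- in the hard part of the first class the clipping is never active at admissible prices
    (∀ η : ℝ, 0 < η → η ≤ 1 / 32 → ∀ a ∈ Set.Icc (1 - η) (1 + η),
      ∀ b ∈ Set.Icc (1 / 2 - η) (1 / 2 + η), ∀ θ ∈ Set.Icc (1 - η) (1 + η),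
      ∀ p ∈ Pricing.prices, ∀ x ∈ Set.Icc (0 : ℝ) (1 / 4),
        p - θ * x ∈ Pricing.linearRegion a b) ∧
    -- feature diversity and conditional mean regularity for both classes
    (∀ R : ℝ, 1 ≤ R → ∃ (cd Cd : ℝ) (L : NNReal), 0 < cd ∧ cd ≤ Cd ∧
      ∀ mhat ∈ Pricing.linearUtilities {θ | R⁻¹ ≤ |θ| ∧ |θ| ≤ R},
        Pricing.FeatureDiverse (Pricing.unif 0 (1 / 4)) (Set.Icc 0 (1 / 4)) mhat 0 cd Cd ∧
        Pricing.FeatureDiverse (Pricing.unif (-(1 / 4)) (1 / 4)) (Set.Icc (-(1 / 4)) (1 / 4))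
          mhat 0 cd Cd ∧
        (∀ m ∈ Pricing.linearUtilities Set.univ,
          Pricing.ConditionalMeanRegular (Pricing.unif 0 (1 / 4)) (Set.Icc 0 (1 / 4)) mhat m L) ∧
        Pricing.ConditionalMeanRegular (Pricing.unif (-(1 / 4)) (1 / 4))
          (Set.Icc (-(1 / 4)) (1 / 4)) mhat (fun x => x) L) ∧
    -- a baseline for the second class exists
    (∃ F₀ : ℝ → ℝ, Pricing.IsBaseline β F₀) ∧
    -- the second class, and the lower bound over the union
    ∀ V : ℝ → ℝ, Pricing.IsBump V → ∀ F₀ : ℝ → ℝ, Pricing.IsBaseline β F₀ →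
      ∃ ρ₀ C cφ : ℝ, 0 < ρ₀ ∧ 0 < cφ ∧ ∀ ρ : ℝ, 0 < ρ → ρ ≤ ρ₀ →
        (∀ N : ℕ, 1 ≤ N → ∀ ι : Fin N → Bool,
          Pricing.IsCDF (Pricing.bumpCDF β ρ V F₀ N ι) ∧
          Pricing.BetaSmoothOn β C (Pricing.bumpCDF β ρ V F₀ N ι) Set.univ ∧
          Pricing.TransformIncreasingOn cφ (Pricing.bumpCDF β ρ V F₀ N ι) Set.univ) ∧
        ∀ η : ℝ, 0 < η → η ≤ 1 / 32 →
          ∃ c : ℝ, 0 < c ∧ ∀ T : ℕ, 1 ≤ T → ∀ π : Pricing.Policy,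
            ∃ I ∈ Pricing.classOne η ∪ Pricing.classTwo β ρ V F₀ (Pricing.cellCount β T),
              c * (T : ℝ) ^ (max (3 / (2 * β + 1)) (1 / 2)) ≤ I.expectedRegret π T := by
  refine ⟨⟨0, 2, two_pos, fun a b ha => ⟨Pricing.isCDF_clippedLinear b ha,
    Pricing.betaSmoothOn_clippedLinear hβ a b, Pricing.transformIncreasingOn_clippedLinear b ha⟩⟩,
    fun η hη₀ hη a ha b hb θ hθ p hp x hx => Pricing.sub_mem_linearRegion hη ha hb hθ hp hx,
    fun R hR => Pricing.exists_covariate_constants hR,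
    Pricing.exists_isBaseline hβ, fun V hV F₀ hF₀ => ?_⟩
  -- Order `⌊β⌋ + 1` is needed for the Hölder condition; `M ≥ 1` makes `ρ₀ = 1/(64 M)` meaningful.
  obtain ⟨M, hM1, hM⟩ := hV.exists_bound (⌊β⌋₊ + 1)
  obtain ⟨C, hC⟩ := hF₀.smooth
  obtain ⟨c, hc0, hc⟩ := hF₀.incr
  have hM0 : 0 < M := one_pos.trans_le hM1
  have h2 : 2 ≤ ⌊β⌋₊ := Nat.le_floor (by exact_mod_cast hβ)
  have hM2 : ∀ k ≤ 2, ∀ z, |iteratedDeriv k V z| ≤ M := fun k hk => hM k (by omega)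
  refine ⟨1 / (64 * M), C + 4 * (1 / 64), min 1 c, by positivity, lt_min one_pos hc0,
    fun ρ hρ hρ₀ => ?_⟩
  have hρM : ρ * M ≤ 1 / 64 := by
    rw [le_div_iff₀ (by positivity)] at hρ₀
    linarith
  refine ⟨fun N hN ι => ⟨Pricing.isCDF_bumpCDF hβ hF₀ hV hρ.le hN hM2 hρM, ?_,
    Pricing.transformIncreasingOn_bumpCDF hβ hF₀ hV hρ.le hN hM2 hρM hc⟩,
    fun η hη₀ hη => Pricing.union_lower hβ hF₀ hV hρ hM2 hρM hη₀ hη⟩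
  exact (Pricing.betaSmoothOn_bumpCDF hβ hF₀ hV hC hρ.le hN
    (hM _ (Nat.le_succ _)) (hM _ le_rfl)).mono (by linarith)
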